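/- **Setting.** All chain complexes are over $\mathbb F_2$ with preferred finite bases. A CSS code is a complex $\mathcal A_2\to\mathcal A_1\to\mathcal A_0$ whose $2$-, $1$-, $0$-cells are the $Z$-stabilizers, the qubits and the $X$-stabilizers. $N$ is the number of qubits, $K=\dim H_1$, $d_Z$ (resp. $d_X$) is the least weight of a nontrivial $1$-cycle (resp. $1$-cocycle), $\infty$ if there is none; $w_X,w_Z$ are the maximal weights of $X$-, $Z$-stabilizers and $q_X,q_Z$ the maximal numbers of $X$-, $Z$-stabilizers acting on one qubit. **Input.** Let $C'$ be a code with complex $\mathcal A$, with $N$ qubits, $N'_Z$ $Z$-stabilizers (the direct ones) and maximal $Z$-stabilizer weight $w'_Z$. Let $Q_1,\dots,Q_m$ be sets of qubits such that the product of Pauli $Z$ over each $Q_i$ commutes with all $X$-stabilizers and, for each $i$ and each $X$-stabilizer $S$, let the qubits of $Q_i$ on which $S$ acts be paired off. Let $G_i$ be the multigraph with vertex set $Q_i$ and one edge for every $X$-stabilizer $S$ and every pair of $S$, joining the two qubits of the pair. $\mathcal B_i$ has the vertices of $G_i$ as $1$-cells and the edges of $G_i$ as $0$-cells; the boundary of a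 vertex is the sum of the edges at it. The *induced code* has the qubits and $X$-stabilizers of $C'$; its $Z$-stabilizers are those of $C'$ and, for every $i$ and every connected component of $G_i$, the product of Pauli $Z$ over the qubits of this component. Parameters without a tilde are those of the induced code; assume $q_X\ge 1$. **Construction.** Choose for each $i$ a basis of the cycle space of $G_i$ that consists of simple cycles (two parallel edges form a cycle). $\overline{\mathcal B}_i$ is $\mathcal B_i$ with one additional $(-1)$-cell for each basis cycle, whose coboundary is the sum of the edges of the cycle. The *cone code* is $\operatorname{Cone}(f)$, where $f:\bigoplus_i\overline{\mathcal B}_i\to\mathcal A$ maps a vertex of $G_i$ to its qubit, an edge to its $X$-stabilizer, and $(-1)$-cells to $0$. Thicken it dually (with $X$ and $Z$ interchanged) by an interval with $\ell\ge1$ points (heights): for cells $z,e,x$ of the cone code of dimension $2,1,0$, the $Z$-stabilizers are the $(z,k)$ with $k$ a point, the qubits are the $(e,k)$ with $k$ a point and the $(z,j)$ with $j$ a segment, and the $X$-stabilizers are the $(e,j)$ with $j$ a segment and, for each $x$, one stabilizer $(x,h_x)$ at one chosen height $h_x$. Finally cellulate the discs: for each basis cycle $c$, of length $w$ with vertices $v_0,\dots,v_{w-1}$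 in cyclic order, cut the disc bounded by $c$ by the chords joining $v_j$ and $v_{w-j}$, $0<j<w-j$; each chord becomes a new qubit, on which the $Z$-stabilizers of its two end points at the height $h_c$ act as well, and the $X$-stabilizer $(c,h_c)$ is replaced by one $X$-stabilizer for each face, acting on the chords of the face and on the edges of $c$ in the face at the height $h_c$. The result is the *reduced cone code*; its parameters carry a tilde. For $i$ let $$\lambda_i=\min_{u}\ \max_{v:\ \partial v=u}\frac{|u|}{|v|},$$ where $u$ runs over the nonzero closed $0$-chains and $v$ over the $1$-chains of $\overline{\mathcal B}_i$, let $h(G_i)$ be the least value of $|\partial w|/|w|$ over the nonempty sets $w$ of vertices that lie in one connected component of $G_i$ and contain at most half of its vertices ($\partial w$ is the set of edges leaving $w$), minima over the empty set being $+\infty$, and let $\lambda=\min(1,\min_i\lambda_i)$. **Lemma.** There is an absolute constant $\kappa$, and for all $\epsilon>0$ and $a>0$ there is an integer $b=b(\epsilon,a)$, such that for every input as above and every integer $\ell\ge 1$ with $\ell\ge a\,\log(w_Z)^{2+2\epsilon}\,w_Z^{\epsilon}$ (in particular one may take $\ell=\Theta(\log(w_Z)^{2+2\epsilon}w_Z^{\epsilon})$)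 the following holds. There are cycle bases in which each edge of $G_i$ lies in at most $\kappa\log(|Q_i|)^2$ basis cycles, together with heights such that, for each edge and each height, at most $b$ basis cycles through this edge are placed at this height. Moreover, for all cycle bases and all heights with the latter property (at most $b$ basis cycles for each edge and height): 1. $\tilde N\le (b+2)\,\bigl(\max(N,N'_Z)+\sum_i|Q_i|\,q_X\bigr)\,\ell$; hence $\tilde N\le O(N+\sum_i|Q_i|q_X)\,\ell$ if $N'_Z\le N$, for instance if the direct stabilizers are independent. 2. $\tilde K=K$. 3. $\tilde w_Z\le\max\bigl(w'_Z,\ q_X+1+\lfloor b\,q_X/2\rfloor\bigr)+2$. 4. $\tilde q_Z\le\max(q_Z,2)$. 5. $w_X\le\tilde w_X\le\max\bigl(w_X+\lfloor w_Xq_Z/2\rfloor,\ q_Z+2,\ 4\bigr)$. 6. $\tilde q_X\le\max(q_X+2,\ w'_Z,\ b+3)$. 7. $\tilde d_X\ge d_X$. 8. $\tilde d_Z\ge d_Z\,\lambda\,\ell$, and $\lambda\ge\min(1,\min_ih(G_i))$. -/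

import Mathlib

open scoped ENNReal

set_option linter.unusedSectionVars false

/-- A CSS code as a complex of `𝔽₂`-vector spaces `𝔽₂^Z → 𝔽₂^Q → 𝔽₂^X` with preferred bases:
`X` indexes the `X`-stabilizers, `Q` the qubits, `Z` the `Z`-stabilizers. -/
structure CSSCode (X Q Z : Type*) [Fintype Q] where
  d1 : Matrix X Q (ZMod 2)
  d2 : Matrix Q Z (ZMod 2)
  comm : d1 * d2 = 0

namespace CSSCode

variable {X Q Z : Type*} [Fintype X] [Fintype Q] [Fintype Z]

/-- Maximal weight of an `X`-stabilizer. -/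
def wX (C : CSSCode X Q Z) : ℕ :=
  Finset.univ.sup fun x : X => (Finset.univ.filter fun q : Q => C.d1 x q ≠ 0).card

/-- Maximal number of `X`-stabilizers acting on a qubit. -/
def qX (C : CSSCode X Q Z) : ℕ :=
  Finset.univ.sup fun q : Q => (Finset.univ.filter fun x : X => C.d1 x q ≠ 0).card

/-- Maximal weight of a `Z`-stabilizer. -/
def wZ (C : CSSCode X Q Z) : ℕ :=
  Finset.univ.sup fun z : Z => (Finset.univ.filter fun q : Q => C.d2 q z ≠ 0).card

/-- Maximal number of `Z`-stabilizers acting on a qubit. -/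
def qZ (C : CSSCode X Q Z) : ℕ :=
  Finset.univ.sup fun q : Q => (Finset.univ.filter fun z : Z => C.d2 q z ≠ 0).card

/-- The number of logical qubits, the dimension of `H₁ = ker ∂₁ / im ∂₂`. -/
noncomputable def K (C : CSSCode X Q Z) : ℕ :=
  Module.finrank (ZMod 2)
    (LinearMap.ker C.d1.mulVecLin ⧸
      (LinearMap.range C.d2.mulVecLin).submoduleOf (LinearMap.ker C.d1.mulVecLin))

/-- `Z`-distance: the least weight of a cycle that is not a boundary (`⊤` if there is none). -/
noncomputable def dZ (C : CSSCode X Q Z) : ℕ∞ :=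
  ⨅ (u : Q → ZMod 2) (_ : C.d1.mulVec u = 0) (_ : u ∉ LinearMap.range C.d2.mulVecLin),
    ((hammingNorm u : ℕ) : ℕ∞)

/-- `X`-distance: the least weight of a cocycle that is not a coboundary (`⊤` if there is none). -/
noncomputable def dX (C : CSSCode X Q Z) : ℕ∞ :=
  ⨅ (u : Q → ZMod 2) (_ : C.d2.transpose.mulVec u = 0)
    (_ : u ∉ LinearMap.range C.d1.transpose.mulVecLin), ((hammingNorm u : ℕ) : ℕ∞)

end CSSCode

/-- Boundary operator of the interval with `ℓ` points and `ℓ - 1` segments; the segment `j` has the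
end points `j` and `j + 1`. -/
def intervalBoundary (ℓ : ℕ) : Matrix (Fin ℓ) (Fin (ℓ - 1)) (ZMod 2) :=
  Matrix.of fun k j => if (k : ℕ) = j ∨ (k : ℕ) = j + 1 then 1 else 0

namespace CSSCode

variable {X Q Z : Type*} [Fintype Q] [Fintype Z]

/-- `X`-stabilizers of the dually thickened code: each old `X`-stabilizer `x`, placed at its height
`h x` only, and one stabilizer for each pair (qubit, segment). -/
noncomputable def thickenD1 (C : CSSCode X Q Z) (ℓ : ℕ) (h : X → Fin ℓ) :
    Matrix (X ⊕ Q × Fin (ℓ - 1)) (Q × Fin ℓ ⊕ Z × Fin (ℓ - 1)) (ZMod 2) :=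
  open scoped Classical in
  Matrix.of fun
    | .inl x, .inl (q, k) => if k = h x then C.d1 x q else 0
    | .inl _, .inr _ => 0
    | .inr (q, j), .inl (q', k) => if q = q' then intervalBoundary ℓ k j else 0
    | .inr (q, j), .inr (z, j') => if j = j' then C.d2 q z else 0

/-- `Z`-stabilizers of the dually thickened code: one for each pair (old `Z`-stabilizer, point). -/
noncomputable def thickenD2 (C : CSSCode X Q Z) (ℓ : ℕ) :
    Matrix (Q × Fin ℓ ⊕ Z × Fin (ℓ - 1)) (Z × Fin ℓ) (ZMod 2) :=
  open scoped Classical in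
  Matrix.of fun
    | .inl (q, k), (z, k') => if k = k' then C.d2 q z else 0
    | .inr (z, j), (z', k) => if z = z' then intervalBoundary ℓ k j else 0

theorem thicken_comm (C : CSSCode X Q Z) (ℓ : ℕ) (h : X → Fin ℓ) :
    C.thickenD1 ℓ h * C.thickenD2 ℓ = 0 := by
  classical
  ext r c
  obtain ⟨z, k⟩ := c
  rw [Matrix.mul_apply, Fintype.sum_sum_type, Matrix.zero_apply]
  rcases r with x | ⟨q, j⟩
  · have hc := congrFun (congrFun C.comm x) z
    rw [Matrix.mul_apply, Matrix.zero_apply] at hc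
    by_cases hk : k = h x
    · subst hk
      simpa [thickenD1, thickenD2, Fintype.sum_prod_type, ite_mul, mul_ite] using hc
    · have hk' : ∀ a : Fin ℓ, a = h x → a ≠ k := by
        rintro a rfl hh; exact hk hh.symm
      simp only [thickenD1, thickenD2, Matrix.of_apply, Fintype.sum_prod_type, zero_mul,
        Finset.sum_const_zero, add_zero]
      refine Finset.sum_eq_zero fun q _ => Finset.sum_eq_zero fun a _ => ?_
      by_cases ha : a = h x
      · simp [hk' a ha]
      · simp [ha]
  · have h1 : (∑ a : Q × Fin ℓ, C.thickenD1 ℓ h (.inr (q, j)) (.inl a) *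
        C.thickenD2 ℓ (.inl a) (z, k)) = intervalBoundary ℓ k j * C.d2 q z := by
      simp [thickenD1, thickenD2, Fintype.sum_prod_type, ite_mul, mul_ite]
    have h2 : (∑ a : Z × Fin (ℓ - 1), C.thickenD1 ℓ h (.inr (q, j)) (.inr a) *
        C.thickenD2 ℓ (.inr a) (z, k)) = C.d2 q z * intervalBoundary ℓ k j := by
      simp [thickenD1, thickenD2, Fintype.sum_prod_type, ite_mul, mul_ite]
    rw [h1, h2, mul_comm]
    exact CharTwo.add_self_eq_zero _

/-- Dual thickening (that is, with `X` and `Z` interchanged) of a code by an interval with `ℓ` points,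
keeping each old `X`-stabilizer at one chosen height only. -/
noncomputable def thicken (C : CSSCode X Q Z) (ℓ : ℕ) (h : X → Fin ℓ) :
    CSSCode (X ⊕ Q × Fin (ℓ - 1)) (Q × Fin ℓ ⊕ Z × Fin (ℓ - 1)) (Z × Fin ℓ) where
  d1 := C.thickenD1 ℓ h
  d2 := C.thickenD2 ℓ
  comm := C.thicken_comm ℓ h

end CSSCode

/-- The input of the coning construction, for the code `A` (the code with the direct
`Z`-stabilizers only): a sequence of sets of qubits `Qset 0, …, Qset (m - 1)`, and for each `i` and each
`X`-stabilizer `s` a pairing of the qubits of `Qset i` on which `s` acts. A pairing exists exactly if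
the number of these qubits is even, i.e. if the product of Pauli `Z` over `Qset i` commutes with `s`. -/
structure ConeInput {X Q Z : Type*} [Fintype Q] (A : CSSCode X Q Z) where
  m : ℕ
  Qset : Fin m → Finset Q
  pairs : Fin m → X → Finset (Sym2 Q)
  not_diag : ∀ i s, ∀ p ∈ pairs i s, ¬ p.IsDiag
  mem_pair : ∀ i s, ∀ p ∈ pairs i s, ∀ q ∈ p, q ∈ Qset i ∧ A.d1 s q ≠ 0
  cover : ∀ i s q, q ∈ Qset i → A.d1 s q ≠ 0 → ∃! p, p ∈ pairs i s ∧ q ∈ p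

namespace ConeInput

variable {X Q Z : Type*} [Fintype X] [Fintype Q] {A : CSSCode X Q Z}

/-- The `1`-cells of `𝓑ᵢ`, which are the vertices of the graph `Gᵢ`: the qubits in `Qset i`. -/
abbrev Vert (D : ConeInput A) (i : Fin D.m) : Type _ := ↥(D.Qset i)

/-- The `0`-cells of `𝓑ᵢ`, which are the edges of the (multi)graph `Gᵢ`: an `X`-stabilizer together
with one of its pairs. -/
abbrev Edge (D : ConeInput A) (i : Fin D.m) : Type _ := Σ s : X, ↥(D.pairs i s)

/-- The boundary operator of `𝓑ᵢ` from `1`-cells to `0`-cells. -/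
noncomputable def bdry (D : ConeInput A) (i : Fin D.m) :
    Matrix (D.Edge i) (D.Vert i) (ZMod 2) :=
  open scoped Classical in
  Matrix.of fun e v => if (v : Q) ∈ (e.2 : Sym2 Q) then 1 else 0

/-- The graph `Gᵢ`, with multiplicities of edges forgotten. -/
def graph (D : ConeInput A) (i : Fin D.m) : SimpleGraph (D.Vert i) :=
  SimpleGraph.fromRel fun u v => ∃ e : D.Edge i, (e.2 : Sym2 Q) = s((u : Q), (v : Q))

/-- Connected components of `Gᵢ`. -/
abbrev Comp (D : ConeInput A) (i : Fin D.m) : Type _ := (D.graph i).ConnectedComponent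

noncomputable instance (D : ConeInput A) (i : Fin D.m) : Fintype (D.Comp i) :=
  Fintype.ofFinite _

/-- The chain map on `1`-cells: a vertex of `Gᵢ` goes to the corresponding qubit. -/
noncomputable def f1 (D : ConeInput A) : Matrix Q (Σ i, D.Vert i) (ZMod 2) :=
  open scoped Classical in
  Matrix.of fun q v => if q = (v.2 : Q) then 1 else 0

/-- The chain map on `0`-cells: a pair `(s, j)` goes to the `X`-stabilizer `s`. -/
noncomputable def f0 (D : ConeInput A) : Matrix X (Σ i, D.Edge i) (ZMod 2) :=
  open scoped Classical in
  Matrix.of fun x e => if x = e.2.1 then 1 else 0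

/-- The boundary operator of `⊕ᵢ 𝓑ᵢ` from `1`-cells to `0`-cells. -/
noncomputable def bdrySum (D : ConeInput A) :
    Matrix (Σ i, D.Edge i) (Σ i, D.Vert i) (ZMod 2) :=
  Matrix.blockDiagonal' D.bdry

theorem chainMap (D : ConeInput A) : A.d1 * D.f1 = D.f0 * D.bdrySum := by
  classical
  ext x ⟨i, v⟩
  have h1 : (A.d1 * D.f1) x ⟨i, v⟩ = A.d1 x v := by
    simp [Matrix.mul_apply, f1]
  have h2 : (D.f0 * D.bdrySum) x ⟨i, v⟩ =
      ∑ p : ↥(D.pairs i x), if (v : Q) ∈ (p : Sym2 Q) then (1 : ZMod 2) else 0 := by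
    rw [Matrix.mul_apply, Fintype.sum_sigma, Finset.sum_eq_single i]
    · rw [Fintype.sum_sigma, Finset.sum_eq_single x]
      · simp [f0, bdrySum, bdry]
      · intro s _ hs
        refine Finset.sum_eq_zero fun p _ => ?_
        simp [f0, hs.symm]
      · simp
    · intro i' _ hi
      refine Finset.sum_eq_zero fun e _ => ?_
      simp [bdrySum, Matrix.blockDiagonal'_apply_ne _ _ _ hi]
    · simp
  rw [h1, h2]
  by_cases hx : A.d1 x v = 0
  · rw [hx]
    symm
    refine Finset.sum_eq_zero fun p _ => if_neg fun hp => ?_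
    exact (D.mem_pair i x p p.2 v hp).2 hx
  · have hone : A.d1 x v = 1 := by
      generalize A.d1 x v = a at hx
      revert a; decide
    obtain ⟨p, ⟨hp, hv⟩, huniq⟩ := D.cover i x v v.2 hx
    rw [hone, Finset.sum_eq_single (⟨p, hp⟩ : ↥(D.pairs i x))]
    · simp [hv]
    · rintro ⟨p', hp'⟩ _ hne
      refine if_neg fun hv' => hne (Subtype.ext (huniq p' ⟨hp', hv'⟩))
    · simp

/-- Indicator vectors of the connected components of the graphs `Gᵢ`. -/
noncomputable def compInd (D : ConeInput A) :
    Matrix (Σ i, D.Vert i) (Σ i, D.Comp i) (ZMod 2) :=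
  open scoped Classical in
  Matrix.blockDiagonal' fun i => Matrix.of fun (v : D.Vert i) (c : D.Comp i) =>
    if (D.graph i).connectedComponentMk v = c then 1 else 0

theorem exists_ends (D : ConeInput A) (i : Fin D.m) (e : D.Edge i) :
    ∃ u v : D.Vert i, u ≠ v ∧ (e.2 : Sym2 Q) = s((u : Q), (v : Q)) := by
  obtain ⟨s, p, hp⟩ := e
  induction p using Sym2.ind with
  | _ a b =>
    have ha := D.mem_pair i s _ hp a (Sym2.mem_mk_left a b)
    have hb := D.mem_pair i s _ hp b (Sym2.mem_mk_right a b)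
    refine ⟨⟨a, ha.1⟩, ⟨b, hb.1⟩, fun h => ?_, rfl⟩
    exact D.not_diag i s _ hp (Sym2.mk_isDiag_iff.mpr (congrArg Subtype.val h))

theorem bdry_sum (D : ConeInput A) (i : Fin D.m) (e : D.Edge i) (u v : D.Vert i) (huv : u ≠ v)
    (he : (e.2 : Sym2 Q) = s((u : Q), (v : Q))) (g : D.Vert i → ZMod 2) :
    ∑ w, D.bdry i e w * g w = g u + g v := by
  classical
  have hmem : ∀ w : D.Vert i, (w : Q) ∈ (e.2 : Sym2 Q) ↔ w = u ∨ w = v := fun w => by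
    rw [he, Sym2.mem_iff, Subtype.ext_iff, Subtype.ext_iff]
  have : ∀ w, D.bdry i e w * g w = (if w = u then g w else 0) + (if w = v then g w else 0) := by
    intro w
    simp only [bdry, Matrix.of_apply, hmem]
    by_cases h1 : w = u
    · have h2 : w ≠ v := fun h => huv (h1.symm.trans h)
      simp [h1, huv]
    · simp [h1]
  simp [this, Finset.sum_add_distrib]

theorem bdrySum_compInd (D : ConeInput A) : D.bdrySum * D.compInd = 0 := by
  classical
  unfold bdrySum compInd
  rw [← Matrix.blockDiagonal'_mul]
  refine Eq.trans (congrArg Matrix.blockDiagonal' (funext fun i => ?_)) Matrix.blockDiagonal'_zero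
  ext e c
  obtain ⟨u, v, huv, he⟩ := D.exists_ends i e
  rw [Matrix.mul_apply, D.bdry_sum i e u v huv he]
  have hadj : (D.graph i).Adj u v := by
    rw [graph, SimpleGraph.fromRel_adj]
    exact ⟨huv, Or.inl ⟨e, he⟩⟩
  have hc : (D.graph i).connectedComponentMk u = (D.graph i).connectedComponentMk v :=
    SimpleGraph.ConnectedComponent.sound hadj.reachable
  simp only [Matrix.of_apply, hc]
  exact CharTwo.add_self_eq_zero _

/-- The induced code: the qubits and `X`-stabilizers of `A`, and as `Z`-stabilizers those of `A` (direct
ones) and, for each connected component of each `Gᵢ`, the product of Pauli `Z` over the qubits of the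
component (induced ones; these products generate the operators given by the elements of `H₁(𝓑ᵢ)`). -/
noncomputable def inducedCode (D : ConeInput A) : CSSCode X Q (Z ⊕ Σ i, D.Comp i) where
  d1 := A.d1
  d2 := Matrix.fromCols A.d2 (D.f1 * D.compInd)
  comm := by
    rw [Matrix.mul_fromCols, A.comm, ← Matrix.mul_assoc, D.chainMap, Matrix.mul_assoc,
      D.bdrySum_compInd, Matrix.mul_zero, Matrix.fromCols_zero]

/-- A simple cycle in the multigraph `Gᵢ` (two parallel edges form a cycle of length `2`), with the
vertices `v₀, …, v_{w-1}` and the edges `e₀, …, e_{w-1}` in cyclic order, `eₜ` joining `vₜ` and `vₜ₊₁`. -/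
structure SimpleCycle (D : ConeInput A) (i : Fin D.m) where
  len : ℕ
  two_le : 2 ≤ len
  vert : Fin len → D.Vert i
  edge : Fin len → D.Edge i
  vert_inj : Function.Injective vert
  edge_inj : Function.Injective edge
  ends : ∀ t, ((edge t).2 : Sym2 Q) = s((vert t : Q), (vert (finRotate len t) : Q))

/-- The chain of edges of a cycle. -/
noncomputable def SimpleCycle.chain {D : ConeInput A} {i : Fin D.m} (c : D.SimpleCycle i) :
    D.Edge i → ZMod 2 :=
  open scoped Classical in
  fun e => if ∃ t, c.edge t = e then 1 else 0

/-- A choice, for each `i`, of simple cycles of `Gᵢ` that form a basis of the cycle space of `Gᵢ`, which is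
the zeroth cohomology of `𝓑ᵢ`. -/
structure CycleBasis (D : ConeInput A) where
  num : Fin D.m → ℕ
  cyc : ∀ i, Fin (num i) → D.SimpleCycle i
  indep : ∀ i, LinearIndependent (ZMod 2) fun c => (cyc i c).chain
  span : ∀ i, Submodule.span (ZMod 2) (Set.range fun c => (cyc i c).chain) =
    LinearMap.ker (D.bdry i).transpose.mulVecLin

namespace CycleBasis

variable {D : ConeInput A}

/-- The added `-1`-cells: one for each cycle in the chosen bases. -/
abbrev Cyc (B : CycleBasis D) : Type := Σ i, Fin (B.num i)

/-- The boundary operator from `0`-cells to `-1`-cells of the complex `𝓑ᵢ` extended by `-1`-cells. -/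
noncomputable def bdry0 (B : CycleBasis D) (i : Fin D.m) :
    Matrix (Fin (B.num i)) (D.Edge i) (ZMod 2) :=
  Matrix.of fun c => (B.cyc i c).chain

theorem bdry0_mul_bdry (B : CycleBasis D) (i : Fin D.m) : B.bdry0 i * D.bdry i = 0 := by
  ext c v
  have hc : (B.cyc i c).chain ∈ LinearMap.ker (D.bdry i).transpose.mulVecLin := by
    rw [← B.span i]; exact Submodule.subset_span ⟨c, rfl⟩
  have := congrFun (LinearMap.mem_ker.mp hc) v
  rw [Matrix.mulVecLin_apply, Matrix.mulVec_transpose] at this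
  exact this

/-- The boundary operator from `0`-cells to `-1`-cells of the direct sum over `i`. -/
noncomputable def bdry0Sum (B : CycleBasis D) : Matrix B.Cyc (Σ i, D.Edge i) (ZMod 2) :=
  Matrix.blockDiagonal' B.bdry0

/-- The cone code: the mapping cone of the chain map from the direct sum of the extended complexes
to the complex of `A`. -/
noncomputable def coneCode (B : CycleBasis D) :
    CSSCode (X ⊕ B.Cyc) (Q ⊕ Σ i, D.Edge i) (Z ⊕ Σ i, D.Vert i) where
  d1 := Matrix.fromBlocks A.d1 D.f0 0 B.bdry0Sum
  d2 := Matrix.fromBlocks A.d2 D.f1 0 D.bdrySum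
  comm := by
    have h : B.bdry0Sum * D.bdrySum = 0 := by
      unfold bdry0Sum bdrySum
      rw [← Matrix.blockDiagonal'_mul]
      refine Eq.trans (congrArg Matrix.blockDiagonal' (funext fun i => ?_))
        Matrix.blockDiagonal'_zero
      exact B.bdry0_mul_bdry i
    rw [Matrix.fromBlocks_multiply, A.comm, D.chainMap, h]
    ext (a | a) (b | b) <;> simp [CharTwo.add_self_eq_zero]

/-- The number of cycles of the basis of `Gᵢ` that use the edge `e`. -/
noncomputable def congestion (B : CycleBasis D) (i : Fin D.m) (e : D.Edge i) : ℕ :=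
  Set.ncard {c : Fin (B.num i) | ∃ t, (B.cyc i c).edge t = e}

/-- The number of discs (cycles of the basis) placed at height `k` that use the edge `e`. -/
noncomputable def multiplicity (B : CycleBasis D) {ℓ : ℕ} (h : X ⊕ B.Cyc → Fin ℓ) (i : Fin D.m)
    (e : D.Edge i) (k : Fin ℓ) : ℕ :=
  Set.ncard {c : Fin (B.num i) | (∃ t, (B.cyc i c).edge t = e) ∧ h (.inr ⟨i, c⟩) = k}

/-- The cycle (boundary of the disc) labelled by an element of `B.Cyc`. -/
abbrev get (B : CycleBasis D) (c : B.Cyc) : D.SimpleCycle c.1 := B.cyc c.1 c.2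

/-- Chords of the disc bounded by a cycle of length `w`: the chord `s` joins the vertices `j` and
`w - j` with `j = s + 1`, for all `j` with `0 < j < w - j`. -/
abbrev Chord (B : CycleBasis D) : Type := Σ c : B.Cyc, Fin (((B.get c).len - 1) / 2)

/-- Faces of the cellulated discs; the face `t` lies between the chords `t - 1` and `t`. -/
abbrev Face (B : CycleBasis D) : Type := Σ c : B.Cyc, Fin (((B.get c).len - 1) / 2 + 1)

/-- Incidence of faces and edges of the cycle: the face `t` has the edges `eₜ` and `e_{w-1-t}` (which
coincide in the last face if `w` is odd). -/
def faceEdge (B : CycleBasis D) (φ : B.Face) (e : Σ i, D.Edge i) : Prop :=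
  ∃ r : Fin (B.get φ.1).len, e = ⟨φ.1.1, (B.get φ.1).edge r⟩ ∧
    ((r : ℕ) = φ.2 ∨ (r : ℕ) + φ.2 + 1 = (B.get φ.1).len)

/-- Incidence of faces and chords. -/
def faceChord (B : CycleBasis D) (φ : B.Face) (s : B.Chord) : Prop :=
  φ.1 = s.1 ∧ ((s.2 : ℕ) = φ.2 ∨ (s.2 : ℕ) + 1 = φ.2)

/-- Incidence of chords and vertices. -/
def chordVert (B : CycleBasis D) (s : B.Chord) (v : Σ i, D.Vert i) : Prop :=
  ∃ r : Fin (B.get s.1).len, v = ⟨s.1.1, (B.get s.1).vert r⟩ ∧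
    ((r : ℕ) = s.2 + 1 ∨ (r : ℕ) + s.2 + 1 = (B.get s.1).len)

variable [Fintype Z]

/-- `X`-stabilizers of the reduced cone code: those of the dually thickened cone code, except that each
stabilizer which corresponds to a cycle is replaced by the faces of the cellulated disc, placed at the
height of the cycle; the chords of the discs are additional qubits. -/
noncomputable def reducedD1 (B : CycleBasis D) (ℓ : ℕ) (h : X ⊕ B.Cyc → Fin ℓ) :
    Matrix ((X ⊕ B.Face) ⊕ (Q ⊕ Σ i, D.Edge i) × Fin (ℓ - 1))
      (((Q ⊕ Σ i, D.Edge i) × Fin ℓ ⊕ (Z ⊕ Σ i, D.Vert i) × Fin (ℓ - 1)) ⊕ B.Chord) (ZMod 2) :=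
  open scoped Classical in
  Matrix.of fun
    | .inl (.inl x), .inl q => (B.coneCode.thicken ℓ h).d1 (.inl (.inl x)) q
    | .inl (.inl _), .inr _ => 0
    | .inl (.inr φ), .inl (.inl (.inr e, k)) =>
        if B.faceEdge φ e ∧ k = h (.inr φ.1) then 1 else 0
    | .inl (.inr _), .inl _ => 0
    | .inl (.inr φ), .inr s => if B.faceChord φ s then 1 else 0
    | .inr p, .inl q => (B.coneCode.thicken ℓ h).d1 (.inr p) q
    | .inr _, .inr _ => 0

/-- `Z`-stabilizers of the reduced cone code: those of the dually thickened cone code; the one of a vertex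
at a height acts also on the chords at the vertex of the discs placed at this height. -/
noncomputable def reducedD2 (B : CycleBasis D) (ℓ : ℕ) (h : X ⊕ B.Cyc → Fin ℓ) :
    Matrix (((Q ⊕ Σ i, D.Edge i) × Fin ℓ ⊕ (Z ⊕ Σ i, D.Vert i) × Fin (ℓ - 1)) ⊕ B.Chord)
      ((Z ⊕ Σ i, D.Vert i) × Fin ℓ) (ZMod 2) :=
  open scoped Classical in
  Matrix.of fun
    | .inl q, z => (B.coneCode.thicken ℓ h).d2 q z
    | .inr s, (.inr v, k) => if B.chordVert s v ∧ k = h (.inr s.1) then 1 else 0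
    | .inr _, (.inl _, _) => 0

theorem thicken_d2_inl {X Q Z : Type*} [Fintype Q] [Fintype Z] (C : CSSCode X Q Z) (ℓ : ℕ)
    (h : X → Fin ℓ) (q : Q) (k k' : Fin ℓ) (z : Z) :
    (C.thicken ℓ h).d2 (.inl (q, k)) (z, k') = if k = k' then C.d2 q z else 0 := by
  simp [CSSCode.thicken, CSSCode.thickenD2]

theorem chord_count (w n t r0 : ℕ) (hw : 2 ≤ w) (hn : n = (w - 1) / 2) (ht : t ≤ n) (hr : r0 < w) :
    (if r0 = t ∨ r0 + t + 1 = w then (1 : ZMod 2) else 0) +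
      (if (r0 = 0 ∧ (w - 1 = t ∨ w - 1 + t + 1 = w)) ∨
          (0 < r0 ∧ (r0 - 1 = t ∨ r0 - 1 + t + 1 = w)) then 1 else 0) +
      ((if t < n ∧ (r0 = t + 1 ∨ r0 + t + 1 = w) then 1 else 0) +
      (if 0 < t ∧ (r0 = t ∨ r0 + t = w) then 1 else 0)) = 0 := by
  split_ifs <;> first | (exfalso; omega) | decide

theorem chord_sum (n t : ℕ) (ht : t ≤ n) (g : ℕ → ZMod 2) :
    ∑ s : Fin n, (if (s : ℕ) = t ∨ (s : ℕ) + 1 = t then g s else 0) =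
      (if t < n then g t else 0) + (if 0 < t then g (t - 1) else 0) := by
  rw [Fin.sum_univ_eq_sum_range (fun s => if s = t ∨ s + 1 = t then g s else 0)]
  have : ∀ s ∈ Finset.range n, (if s = t ∨ s + 1 = t then g s else 0) =
      (if s = t then g s else 0) + (if s = t - 1 then (if 0 < t then g s else 0) else 0) := by
    intro s _
    split_ifs <;> first | (exfalso; omega) | simp
  rw [Finset.sum_congr rfl this, Finset.sum_add_distrib, Finset.sum_ite_eq', Finset.sum_ite_eq']
  simp only [Finset.mem_range]
  congr 1
  split_ifs <;> first | (exfalso; omega) | rfl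

theorem finRotate_symm_val {w : ℕ} (hw : 2 ≤ w) (r0 : Fin w) :
    (((finRotate w).symm r0 : Fin w) : ℕ) = if (r0 : ℕ) = 0 then w - 1 else (r0 : ℕ) - 1 := by
  obtain ⟨w, rfl⟩ : ∃ w', w = w' + 1 := ⟨w - 1, by omega⟩
  generalize hq : (finRotate (w + 1)).symm r0 = q
  rw [Equiv.symm_apply_eq] at hq
  have := coe_finRotate q
  rw [← hq] at this
  have hq2 := q.2
  have hiff : q = Fin.last w ↔ (q : ℕ) = w := by rw [Fin.ext_iff, Fin.val_last]
  simp only [hiff] at this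
  split_ifs at this ⊢ <;> omega

theorem face_comm (B : CycleBasis D) (i : Fin D.m) (c : Fin (B.num i))
    (t : Fin (((B.cyc i c).len - 1) / 2 + 1)) (v : D.Vert i) :
    open scoped Classical in
    (∑ r : Fin (B.cyc i c).len,
        (if (r : ℕ) = t ∨ (r : ℕ) + t + 1 = (B.cyc i c).len then
          D.bdry i ((B.cyc i c).edge r) v else 0)) +
      (∑ s : Fin (((B.cyc i c).len - 1) / 2), if (s : ℕ) = t ∨ (s : ℕ) + 1 = t then
        (if ∃ r : Fin (B.cyc i c).len, v = (B.cyc i c).vert r ∧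
          ((r : ℕ) = s + 1 ∨ (r : ℕ) + s + 1 = (B.cyc i c).len) then (1 : ZMod 2) else 0)
          else 0) = 0 := by
  classical
  generalize hγ : B.cyc i c = γ at t
  have hb : ∀ r, D.bdry i (γ.edge r) v =
      (if v = γ.vert r then 1 else 0) + (if v = γ.vert (finRotate γ.len r) then 1 else 0) := by
    intro r
    have hne : γ.vert r ≠ γ.vert (finRotate γ.len r) := by
      intro h
      refine D.not_diag i _ _ (γ.edge r).2.2 ?_
      rw [γ.ends r, Sym2.mk_isDiag_iff, ← h]
    simp only [bdry, Matrix.of_apply, γ.ends r, Sym2.mem_iff, ← Subtype.ext_iff]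
    by_cases h1 : v = γ.vert r
    · rw [h1, if_pos (Or.inl rfl), if_pos rfl, if_neg hne, add_zero]
    · simp only [h1, false_or, if_false, zero_add]
  simp only [hb]
  by_cases hv : ∃ r, v = γ.vert r
  · obtain ⟨r0, rfl⟩ := hv
    have hchord : ∀ s : ℕ, (∃ r : Fin γ.len, γ.vert r0 = γ.vert r ∧
        ((r : ℕ) = s + 1 ∨ (r : ℕ) + s + 1 = γ.len)) ↔
        ((r0 : ℕ) = s + 1 ∨ (r0 : ℕ) + s + 1 = γ.len) := by
      intro s
      constructor
      · rintro ⟨r, hr, h⟩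
        rw [γ.vert_inj hr]; exact h
      · intro h; exact ⟨r0, rfl, h⟩
    simp only [hchord]
    simp only [γ.vert_inj.eq_iff]
    rw [chord_sum _ _ (Nat.lt_succ_iff.mp t.2)
      (fun s => if (r0 : ℕ) = s + 1 ∨ (r0 : ℕ) + s + 1 = γ.len then 1 else 0)]
    have hsum : (∑ r : Fin γ.len, if (r : ℕ) = t ∨ (r : ℕ) + t + 1 = γ.len then
        ((if r0 = r then (1 : ZMod 2) else 0) + if r0 = finRotate γ.len r then 1 else 0) else 0) =
        (if (r0 : ℕ) = t ∨ (r0 : ℕ) + t + 1 = γ.len then 1 else 0) +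
        (if (((finRotate γ.len).symm r0 : Fin γ.len) : ℕ) = t ∨
          (((finRotate γ.len).symm r0 : Fin γ.len) : ℕ) + t + 1 = γ.len then 1 else 0) := by
      have : ∀ r : Fin γ.len, (if (r : ℕ) = t ∨ (r : ℕ) + t + 1 = γ.len then
          ((if r0 = r then (1 : ZMod 2) else 0) + if r0 = finRotate γ.len r then 1 else 0)
          else 0) =
          (if r0 = r then (if (r : ℕ) = t ∨ (r : ℕ) + t + 1 = γ.len then 1 else 0) else 0) +
          (if (finRotate γ.len).symm r0 = r then
            (if (r : ℕ) = t ∨ (r : ℕ) + t + 1 = γ.len then 1 else 0) else 0) := by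
        intro r
        simp only [Equiv.symm_apply_eq]
        split_ifs <;> simp
      rw [Finset.sum_congr rfl fun r _ => this r, Finset.sum_add_distrib, Finset.sum_ite_eq,
        Finset.sum_ite_eq]
      simp
    rw [hsum]
    rw [finRotate_symm_val γ.two_le r0]
    have := chord_count γ.len ((γ.len - 1) / 2) t r0 γ.two_le rfl (Nat.lt_succ_iff.mp t.2) r0.2
    convert this using 2
    · congr 1
      split_ifs <;> first | (exfalso; omega) | rfl
    · split_ifs <;> first | (exfalso; omega) | rfl
  · push Not at hv
    simp [hv]

theorem face_edge_sum (B : CycleBasis D) (φ : B.Face) (g : (Σ i, D.Edge i) → ZMod 2) :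
    open scoped Classical in
    (∑ e, if B.faceEdge φ e then g e else 0) =
      ∑ r : Fin (B.get φ.1).len, if (r : ℕ) = φ.2 ∨ (r : ℕ) + φ.2 + 1 = (B.get φ.1).len then
        g ⟨φ.1.1, (B.get φ.1).edge r⟩ else 0 := by
  classical
  have hinj : Function.Injective fun r : Fin (B.get φ.1).len =>
      (⟨φ.1.1, (B.get φ.1).edge r⟩ : Σ i, D.Edge i) := by
    intro r r' hr
    exact (B.get φ.1).edge_inj (eq_of_heq (Sigma.mk.inj hr).2)
  rw [← Finset.sum_filter, ← Finset.sum_filter]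
  refine Eq.trans (Finset.sum_congr ?_ fun _ _ => rfl)
    (Finset.sum_map (Finset.univ.filter _) ⟨_, hinj⟩ g)
  ext e
  rw [Finset.mem_filter, Finset.mem_map]
  constructor
  · rintro ⟨_, r, rfl, hr⟩
    exact ⟨r, Finset.mem_filter.mpr ⟨Finset.mem_univ _, hr⟩, rfl⟩
  · rintro ⟨r, hr, rfl⟩
    exact ⟨Finset.mem_univ _, r, rfl, (Finset.mem_filter.mp hr).2⟩

theorem reduced_comm (B : CycleBasis D) (ℓ : ℕ) (h : X ⊕ B.Cyc → Fin ℓ) :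
    B.reducedD1 ℓ h * B.reducedD2 ℓ h = 0 := by
  classical
  have hT := (B.coneCode.thicken ℓ h).comm
  ext r z
  have hTz := fun r' => congrFun (congrFun hT r') z
  simp only [Matrix.mul_apply, Matrix.zero_apply] at hTz
  rw [Matrix.mul_apply, Fintype.sum_sum_type, Matrix.zero_apply]
  rcases r with (x | φ) | p
  · simpa [reducedD1, reducedD2] using hTz (.inl (.inl x))
  · obtain ⟨zz, k⟩ := z
    have h1 : (∑ a, B.reducedD1 ℓ h (.inl (.inr φ)) (.inl a) * B.reducedD2 ℓ h (.inl a) (zz, k)) =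
        if k = h (.inr φ.1) then
          ∑ e, (if B.faceEdge φ e then B.coneCode.d2 (.inr e) zz else 0) else 0 := by
      simp only [reducedD1, reducedD2, Fintype.sum_sum_type, Fintype.sum_prod_type,
        Matrix.of_apply, zero_mul, Finset.sum_const_zero, zero_add, add_zero, thicken_d2_inl]
      split_ifs with hk
      · refine Finset.sum_congr rfl fun e _ => ?_
        rw [Finset.sum_eq_single k]
        · simp [hk]
        · intro a _ ha; simp [ha]
        · simp
      · refine Finset.sum_eq_zero fun e _ => Finset.sum_eq_zero fun a _ => ?_
        by_cases ha : a = h (.inr φ.1)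
        · have : a ≠ k := fun hak => hk (hak ▸ ha)
          simp [this]
        · simp [ha]
    have h2 : (∑ s, B.reducedD1 ℓ h (.inl (.inr φ)) (.inr s) *
        B.reducedD2 ℓ h (.inr s) (zz, k)) =
        ∑ s : Fin (((B.get φ.1).len - 1) / 2), (if (s : ℕ) = φ.2 ∨ (s : ℕ) + 1 = φ.2 then
          B.reducedD2 ℓ h (.inr ⟨φ.1, s⟩) (zz, k) else 0) := by
      rw [Fintype.sum_sigma, Finset.sum_eq_single φ.1]
      · refine Finset.sum_congr rfl fun s _ => ?_
        simp [reducedD1, faceChord]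
      · intro c _ hc
        refine Finset.sum_eq_zero fun s _ => ?_
        simp [reducedD1, faceChord, hc.symm]
      · simp
    rw [h1, h2, B.face_edge_sum]
    by_cases hk : k = h (.inr φ.1)
    · rw [if_pos hk]
      rcases zz with z | ⟨i', v⟩
      · simp [reducedD2, coneCode]
      · obtain ⟨⟨i, c⟩, t⟩ := φ
        by_cases hi : i = i'
        · subst hi
          have := B.face_comm i c t v
          simpa [reducedD2, coneCode, bdrySum, chordVert, hk] using this
        · have hb : ∀ e, D.bdrySum ⟨i, e⟩ ⟨i', v⟩ = 0 := fun e =>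
            Matrix.blockDiagonal'_apply_ne _ _ _ hi
          have hi' : ¬ i' = i := fun h => hi h.symm
          simp [reducedD2, coneCode, hb, chordVert, hi']
    · rw [if_neg hk, zero_add]
      refine Finset.sum_eq_zero fun s _ => ?_
      rcases zz with z | v <;> simp [reducedD2, hk]
  · simpa [reducedD1, reducedD2] using hTz (.inr p)

/-- The reduced cone code, for given cycle bases, amount `ℓ` of thickening and heights of the
`X`-stabilizers of the cone code. -/
noncomputable def reducedConeCode (B : CycleBasis D) (ℓ : ℕ) (h : X ⊕ B.Cyc → Fin ℓ) :
    CSSCode ((X ⊕ B.Face) ⊕ (Q ⊕ Σ i, D.Edge i) × Fin (ℓ - 1))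
      (((Q ⊕ Σ i, D.Edge i) × Fin ℓ ⊕ (Z ⊕ Σ i, D.Vert i) × Fin (ℓ - 1)) ⊕ B.Chord)
      ((Z ⊕ Σ i, D.Vert i) × Fin ℓ) where
  d1 := B.reducedD1 ℓ h
  d2 := B.reducedD2 ℓ h
  comm := B.reduced_comm ℓ h

/-- The soundness factor `λᵢ`: the largest `c` such that each nonzero closed `0`-chain `u` of the extended
complex is the boundary of some `1`-chain `v` with `|u| ≥ c |v|` (`⊤` if there is no such `u`). -/
noncomputable def soundness (B : CycleBasis D) (i : Fin D.m) : ℝ≥0∞ :=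
  ⨅ (u : D.Edge i → ZMod 2) (_ : (B.bdry0 i).mulVec u = 0) (_ : u ≠ 0),
    ⨆ (v : D.Vert i → ZMod 2) (_ : (D.bdry i).mulVec v = u),
      ((hammingNorm u : ℕ) : ℝ≥0∞) / ((hammingNorm v : ℕ) : ℝ≥0∞)

/-- `λ = min (1, minᵢ λᵢ)`. -/
noncomputable def soundnessFactor (B : CycleBasis D) : ℝ≥0∞ :=
  min 1 (⨅ i, B.soundness i)

end CycleBasis

/-- The Cheeger constant of `Gᵢ`: the least ratio `|∂w| / |w|` over the sets `w` of vertices in one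
connected component with `0 < |w| ≤ |V| / 2`, where `V` is the set of vertices of this component; for a
disconnected graph this is the minimum over the components (`⊤` if there is no such `w`). -/
noncomputable def cheeger (D : ConeInput A) (i : Fin D.m) : ℝ≥0∞ :=
  ⨅ (c : D.Comp i) (w : D.Vert i → ZMod 2)
    (_ : ∀ v, w v ≠ 0 → (D.graph i).connectedComponentMk v = c)
    (_ : 0 < hammingNorm w ∧ 2 * hammingNorm w ≤ c.supp.ncard),
    ((hammingNorm ((D.bdry i).mulVec w) : ℕ) : ℝ≥0∞) / ((hammingNorm w : ℕ) : ℝ≥0∞)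

end ConeInput

/-!
The proof has two independent parts: the existence of cycle bases with heights, and the comparison of
the reduced cone code with the induced code for any cycle bases and heights.

**Existence.** This is the decongestion argument of Freedman and Hastings. A multigraph on fewer than
`2 ^ R` vertices, all of degree at least `3`, has a cycle of length at most `2 R + 1`
(`exists_short_cycle`), since otherwise balls double in size with each step. Degree-`1` vertices are
removed and degree-`2` vertices are contracted, so that always a short cycle can be put into the basis
and one of its edges deleted. Deleting the edge of largest weight, where the weight of an edge grows by
the factor `1 + 1 / (2 R + 1)` with each cycle through it, never increases the total weight, so that an
edge is used `O(log² n)` times (`exists_spanning_weighted`). Parallel edges are first reduced to one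
representative by cycles of length `2`, at the cost of two more cycles per edge
(`exists_parallel_reduction`); this bounds the number of remaining edges, and so the total weight, by the
square of the number of vertices. The elements of the cycle space found in this way are cut into
edge-disjoint simple cycles (`ConeInput.exists_simpleCycles_of_family`). A component has at most `w_Z`
vertices because it is the support of an induced stabilizer. Heights are chosen by a union bound over the
sets of `b₀ + 1` cycles through a common edge (`exists_coloring`): with the assumption on `ℓ`, it works
for `w_Z` large, with `b₀` depending on `ε` only, and for bounded `w_Z` any heights will do
(`exists_multiplicity_bound`).

**Homology.** Since the basis cycles span the cycle space, each closed `0`-chain of the extended complex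
is a boundary (`ConeInput.CycleBasis.exists_bdry_eq`). The faces of a disc add up to its boundary cycle
and the stabilizers of the segments make all slices of a cycle homologous, so each slice of a cycle of the
reduced cone code is a cycle of the cone code. Adding `Z`-stabilizers clears the segments and, with a
chain of vertices whose boundary is the edge part of one slice, also the edges; then the faces force the
chords to vanish. Hence each cycle is homologous to a chain of the original qubits repeated at all heights
(`ConeInput.CycleBasis.add_constChain_mem_range`), and such a repeated chain is a boundary exactly if the
chain is one in the induced code. This gives the number of logical qubits. For the `X`-distance, a cocycle
is summed over the heights. For the `Z`-distance, in each of the `ℓ` slices the edge part is replaced by a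
chain of vertices which is larger by a factor of at most `1 / λ`; the result is a nontrivial cycle of the
induced code, so each slice has weight at least `λ d_Z`.

**Weights.** These are double counts. The ones that are not read off the block structure are: the chords
at a vertex and a height, each of which belongs to a cycle through two edges at this vertex
(`ConeInput.CycleBasis.card_chords_at_mul_two_le`), the faces at an edge and a height, one for each cycle
(`ConeInput.CycleBasis.card_faces_at_le`), and the edges of an `X`-stabilizer, which pair off qubits
(`ConeInput.two_mul_hammingNorm_f0_row_le`).
-/

/-! ### Short cycles in multigraphs -/

theorem ZMod2.fun_add_self {ι : Type*} (x : ι → ZMod 2) : x + x = 0 :=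
  funext fun _ => CharTwo.add_self_eq_zero _

theorem ZMod2.fun_neg {ι : Type*} (x : ι → ZMod 2) : -x = x :=
  funext fun _ => CharTwo.neg_eq _

section Multigraph

variable {V E : Type*} [DecidableEq V] [Fintype E] [DecidableEq E]

/-- Boundary operator, with `𝔽₂` coefficients, of the multigraph on `V` whose edges `e : E` join `s e`
and `t e`. Loops are allowed and have boundary `0`. -/
def edgeBoundary (s t : E → V) : (E → ZMod 2) →ₗ[ZMod 2] (V → ZMod 2) :=
  Fintype.linearCombination (ZMod 2) fun e => Pi.single (s e) 1 + Pi.single (t e) 1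

theorem edgeBoundary_single (s t : E → V) (e : E) :
    edgeBoundary s t (Pi.single e 1) = Pi.single (s e) 1 + Pi.single (t e) 1 := by
  rw [edgeBoundary, Fintype.linearCombination_apply_single, one_smul]

theorem edgeBoundary_apply (s t : E → V) (z : E → ZMod 2) (v : V) :
    edgeBoundary s t z v =
      ∑ e, z e * ((if s e = v then 1 else 0) + (if t e = v then 1 else 0)) := by
  simp [edgeBoundary, Fintype.linearCombination_apply, Finset.sum_apply, Pi.single_apply, eq_comm,
    mul_add]

/-- The cycle space of the multigraph formed by the edges in `F`: the `𝔽₂`-chains supported on `F` with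
zero boundary. -/
def cyclesIn (s t : E → V) (F : Finset E) : Submodule (ZMod 2) (E → ZMod 2) :=
  LinearMap.ker (edgeBoundary s t) ⊓ Submodule.pi ((F : Set E)ᶜ) fun _ => ⊥

theorem mem_cyclesIn {s t : E → V} {F : Finset E} {z : E → ZMod 2} :
    z ∈ cyclesIn s t F ↔ edgeBoundary s t z = 0 ∧ ∀ e ∉ F, z e = 0 := by
  simp [cyclesIn, Submodule.mem_inf, Submodule.mem_pi]

/-- Degree of `v` in the multigraph formed by the edges in `F`; a loop counts twice. -/
def degIn (s t : E → V) (F : Finset E) (v : V) : ℕ :=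
  ∑ e ∈ F, ((if s e = v then 1 else 0) + (if t e = v then 1 else 0))

theorem hammingNorm_add_le {ι : Type*} [Fintype ι] (x y : ι → ZMod 2) :
    hammingNorm (x + y) ≤ hammingNorm x + hammingNorm y := by
  have h := hammingDist_triangle x 0 (-y)
  rw [hammingDist_zero_right, hammingDist_zero_left] at h
  rw [hammingDist_eq_hammingNorm] at h
  simpa [ZMod2.fun_neg] using h

theorem hammingNorm_single_le (e : E) : hammingNorm (Pi.single e 1 : E → ZMod 2) ≤ 1 := by
  unfold hammingNorm
  refine Finset.card_le_one.mpr fun a ha b hb => ?_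
  have h : ∀ c, (Pi.single e 1 : E → ZMod 2) c ≠ 0 → c = e := fun c hc => by
    by_contra hne
    exact hc (Pi.single_eq_of_ne hne 1)
  rw [h a (Finset.mem_filter.mp ha).2, h b (Finset.mem_filter.mp hb).2]

theorem ZMod2.eq_one_of_ne_zero {a : ZMod 2} (h : a ≠ 0) : a = 1 := by
  revert a; decide

/-- `P u` is a chain of at most `r` edges of `F` that joins `u` to `v₀`, for each `u ∈ T`. -/
def PathsFrom (s t : E → V) (F : Finset E) (v₀ : V) (T : Finset V) (P : V → E → ZMod 2) (r : ℕ) :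
    Prop :=
  ∀ u ∈ T, (∀ e ∉ F, P u e = 0) ∧ edgeBoundary s t (P u) = Pi.single u 1 + Pi.single v₀ 1 ∧
    hammingNorm (P u) ≤ r

/-- Without short cycles, the unit vector of an edge inside `T` is the sum of the two paths of its end
points, so these linearly independent vectors lie in the span of `#T` vectors. -/
theorem PathsFrom.card_inner_le {s t : E → V} {F : Finset E} {v₀ : V} {T : Finset V}
    {P : V → E → ZMod 2} {r : ℕ} (hP : PathsFrom s t F v₀ T P r)
    (hno : ∀ z ∈ cyclesIn s t F, hammingNorm z ≤ 2 * r + 1 → z = 0) :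
    (F.filter fun e => s e ∈ T ∧ t e ∈ T).card ≤ T.card := by
  have key : ∀ e ∈ F.filter fun e => s e ∈ T ∧ t e ∈ T,
      (Pi.single e 1 : E → ZMod 2) = P (s e) + P (t e) := by
    intro e he
    obtain ⟨heF, hs, ht⟩ := Finset.mem_filter.mp he
    have hz := hno (Pi.single e 1 + (P (s e) + P (t e))) ?_ ?_
    · rw [← sub_eq_zero, sub_eq_add_neg]
      rw [show -(P (s e) + P (t e)) = P (s e) + P (t e) from ZMod2.fun_neg _]
      exact hz
    · refine mem_cyclesIn.mpr ⟨?_, fun e' he' => ?_⟩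
      · rw [map_add, map_add, edgeBoundary_single, (hP _ hs).2.1, (hP _ ht).2.1]
        have := ZMod2.fun_add_self (Pi.single v₀ 1 : V → ZMod 2)
        have h2 := ZMod2.fun_add_self (Pi.single (s e) 1 + Pi.single (t e) 1 : V → ZMod 2)
        linear_combination this + h2
      · have : e' ≠ e := fun h => he' (h ▸ heF)
        simp [this, (hP _ hs).1 e' he', (hP _ ht).1 e' he']
    · have h1 := hammingNorm_add_le (Pi.single e 1) (P (s e) + P (t e))
      have h2 := hammingNorm_add_le (P (s e)) (P (t e))
      have h3 := hammingNorm_single_le e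
      have h4 := (hP _ hs).2.2
      have h5 := (hP _ ht).2.2
      omega
  have hli : LinearIndependent (ZMod 2)
      fun e : ↥(F.filter fun e => s e ∈ T ∧ t e ∈ T) => (Pi.single (e : E) 1 : E → ZMod 2) := by
    have := (Pi.basisFun (ZMod 2) E).linearIndependent.comp
      (Subtype.val : ↥(F.filter fun e => s e ∈ T ∧ t e ∈ T) → E) Subtype.val_injective
    simpa [Function.comp_def] using this
  have := linearIndependent_le_span_aux' _ hli (T.image P : Set (E → ZMod 2)) ?_
  · rw [Fintype.card_coe] at this
    refine this.trans ?_
    simp only [Finset.coe_sort_coe, Fintype.card_coe]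
    exact Finset.card_image_le
  · rintro _ ⟨⟨e, he⟩, rfl⟩
    obtain ⟨heF, hs, ht⟩ := Finset.mem_filter.mp he
    simp only [key e he]
    exact Submodule.add_mem _ (Submodule.subset_span (by simpa using ⟨_, hs, rfl⟩))
      (Submodule.subset_span (by simpa using ⟨_, ht, rfl⟩))

/-- Without short cycles and without vertices of degree `1` and `2`, paths of length at most `r` reach at
least `2 ^ r` vertices. For the step, the edges that touch `T` number at most `#T'` for the next ball `T'`,
at most `#T` of them are inside `T`, and together these two numbers count the at least `3 #T` edge ends
at `T`. -/
theorem exists_pathsFrom {s t : E → V} {F : Finset E} {v₀ : V} (hv₀ : degIn s t F v₀ ≠ 0) (R : ℕ)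
    (hdeg : ∀ v, degIn s t F v = 0 ∨ 3 ≤ degIn s t F v)
    (hno : ∀ z ∈ cyclesIn s t F, hammingNorm z ≤ 2 * R + 1 → z = 0) (r : ℕ) (hr : r ≤ R) :
    ∃ (T : Finset V) (P : V → E → ZMod 2), PathsFrom s t F v₀ T P r ∧
      (∀ u ∈ T, degIn s t F u ≠ 0) ∧ 2 ^ r ≤ T.card := by
  induction r with
  | zero =>
    refine ⟨{v₀}, fun _ => 0, ?_, by simpa using hv₀, by simp⟩
    intro u hu
    rw [Finset.mem_singleton] at hu
    subst hu
    refine ⟨fun _ _ => rfl, ?_, by simp⟩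
    rw [map_zero]; exact (ZMod2.fun_add_self _).symm
  | succ r ih =>
    obtain ⟨T, P, hP, hT, hcard⟩ := ih (by omega)
    -- `F₁` are the edges touching `T`, `T'` is `T` with all its neighbours
    set F₁ := F.filter fun e => s e ∈ T ∨ t e ∈ T with hF₁
    set T' := T ∪ F₁.image s ∪ F₁.image t with hT'
    have hnew : ∀ u, ∃ p : E → ZMod 2, u ∈ T' → (∀ e ∉ F, p e = 0) ∧
        edgeBoundary s t p = Pi.single u 1 + Pi.single v₀ 1 ∧ hammingNorm p ≤ r + 1 := by
      intro u
      by_cases hu : u ∈ T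
      · exact ⟨P u, fun _ => ⟨(hP u hu).1, (hP u hu).2.1, (hP u hu).2.2.trans (Nat.le_succ r)⟩⟩
      by_cases hu' : u ∈ T'
      · have : ∃ e ∈ F, ∃ w ∈ T, (Pi.single (s e) 1 + Pi.single (t e) 1 : V → ZMod 2) =
            Pi.single u 1 + Pi.single w 1 := by
          simp only [hT', Finset.mem_union, Finset.mem_image, hF₁, Finset.mem_filter] at hu'
          rcases hu' with (h | ⟨e, ⟨heF, h⟩, rfl⟩) | ⟨e, ⟨heF, h⟩, rfl⟩
          · exact absurd h hu
          · exact ⟨e, heF, t e, h.resolve_left hu, rfl⟩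
          · exact ⟨e, heF, s e, h.resolve_right hu, add_comm _ _⟩
        obtain ⟨e, heF, w, hw, hsum⟩ := this
        refine ⟨P w + Pi.single e 1, fun _ => ⟨fun e' he' => ?_, ?_, ?_⟩⟩
        · have : e' ≠ e := fun h => he' (h ▸ heF)
          simp [this, (hP _ hw).1 e' he']
        · rw [map_add, edgeBoundary_single, hsum, (hP w hw).2.1]
          have := ZMod2.fun_add_self (Pi.single w 1 : V → ZMod 2)
          linear_combination this
        · have h1 := hammingNorm_add_le (P w) (Pi.single e 1)
          have h3 := hammingNorm_single_le e
          have h4 := (hP _ hw).2.2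
          omega
      · exact ⟨0, fun h => absurd h hu'⟩
    choose P' hP' using hnew
    have hpaths : PathsFrom s t F v₀ T' P' (r + 1) := fun u hu => hP' u hu
    refine ⟨T', P', hpaths, fun u hu => ?_, ?_⟩
    · simp only [hT', Finset.mem_union, Finset.mem_image, hF₁, Finset.mem_filter] at hu
      rcases hu with (h | ⟨e, ⟨heF, h⟩, rfl⟩) | ⟨e, ⟨heF, h⟩, rfl⟩
      · exact hT u h
      · intro h0
        have := (Finset.sum_eq_zero_iff.mp h0) e heF
        simp at this
      · intro h0
        have := (Finset.sum_eq_zero_iff.mp h0) e heF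
        simp at this
    · have h1 : F₁.card ≤ T'.card := by
        refine le_trans (Finset.card_le_card ?_)
          (hpaths.card_inner_le fun z hz hn => hno z hz (hn.trans (by omega)))
        intro e he
        have heF := (Finset.mem_filter.mp he).1
        refine Finset.mem_filter.mpr ⟨heF, ?_, ?_⟩
        · exact Finset.mem_union_left _ (Finset.mem_union_right _ (Finset.mem_image_of_mem s he))
        · exact Finset.mem_union_right _ (Finset.mem_image_of_mem t he)
      have h2 := hP.card_inner_le fun z hz hn => hno z hz (hn.trans (by omega))
      -- count the pairs of a vertex of `T` and an end of an edge at it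
      have h3 : 3 * T.card ≤ ∑ v ∈ T, degIn s t F v := by
        rw [mul_comm, ← smul_eq_mul]
        exact Finset.card_nsmul_le_sum _ _ _ fun v hv => (hdeg v).resolve_left (hT v hv)
      have h4 : ∑ v ∈ T, degIn s t F v ≤
          F₁.card + (F.filter fun e => s e ∈ T ∧ t e ∈ T).card := by
        simp only [degIn]
        rw [Finset.sum_comm, hF₁, Finset.card_filter, Finset.card_filter, ← Finset.sum_add_distrib]
        refine Finset.sum_le_sum fun e _ => ?_
        rw [Finset.sum_add_distrib, Finset.sum_ite_eq, Finset.sum_ite_eq]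
        by_cases hs : s e ∈ T <;> by_cases ht : t e ∈ T <;> simp [hs, ht]
      rw [pow_succ]
      omega

/-- A multigraph on fewer than `2 ^ R` vertices without vertices of degree `1` and `2` has a cycle of
length at most `2 R + 1`: otherwise the balls around a vertex double in size with each step. -/
theorem exists_short_cycle {s t : E → V} {F : Finset E} (hF : F.Nonempty) {S : Finset V}
    (hS : ∀ e ∈ F, s e ∈ S ∧ t e ∈ S) {R : ℕ} (hR : S.card < 2 ^ R)
    (hdeg : ∀ v, degIn s t F v = 0 ∨ 3 ≤ degIn s t F v) :
    ∃ z ∈ cyclesIn s t F, z ≠ 0 ∧ hammingNorm z ≤ 2 * R + 1 := by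
  by_contra hno
  push Not at hno
  obtain ⟨e, he⟩ := hF
  have hv₀ : degIn s t F (s e) ≠ 0 := fun h0 => by
    have := (Finset.sum_eq_zero_iff.mp h0) e he
    simp at this
  obtain ⟨T, P, -, hT, hcard⟩ := exists_pathsFrom hv₀ R hdeg (fun z hz hn => by
    by_contra h0
    exact absurd hn (not_le.mpr (hno z hz h0))) R le_rfl
  refine absurd (Finset.card_le_card (s := T) (t := S) fun u hu => ?_) (by omega)
  by_contra hu'
  refine hT u hu (Finset.sum_eq_zero fun e he => ?_)
  have h1 : s e ≠ u := fun h => hu' (h ▸ (hS e he).1)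
  have h2 : t e ≠ u := fun h => hu' (h ▸ (hS e he).2)
  simp [h1, h2]

end Multigraph

/-! ### Families of cycles with low congestion -/

section Multigraph

variable {V E : Type*} [DecidableEq V] [Fintype E] [DecidableEq E]

/-- The number of members of a family of chains that use the edge `e`. -/
def chainCongestion {ι : Type*} [Fintype ι] (c : ι → E → ZMod 2) (e : E) : ℕ :=
  ∑ j, if c j e ≠ 0 then 1 else 0

theorem chainCongestion_eq_zero {ι : Type*} [Fintype ι] {c : ι → E → ZMod 2} {e : E}
    (h : ∀ j, c j e = 0) : chainCongestion c e = 0 := by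
  simp [chainCongestion, h]

theorem edgeBoundary_apply_of_incident {s t : E → V} {F : Finset E}
    (hloop : ∀ e ∈ F, s e ≠ t e) {z : E → ZMod 2} (hz : ∀ e ∉ F, z e = 0) (v : V) :
    edgeBoundary s t z v = ∑ e ∈ F.filter fun e => s e = v ∨ t e = v, z e := by
  rw [edgeBoundary_apply, Finset.sum_filter, ← Finset.sum_subset (Finset.subset_univ F)]
  · refine Finset.sum_congr rfl fun e he => ?_
    have := hloop e he
    by_cases h1 : s e = v <;> by_cases h2 : t e = v <;> simp_all
  · intro e _ he
    rw [hz e he, zero_mul]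

theorem degIn_eq_card {s t : E → V} {F : Finset E} (hloop : ∀ e ∈ F, s e ≠ t e) (v : V) :
    degIn s t F v = (F.filter fun e => s e = v ∨ t e = v).card := by
  rw [degIn, Finset.card_filter]
  refine Finset.sum_congr rfl fun e he => ?_
  have := hloop e he
  by_cases h1 : s e = v <;> by_cases h2 : t e = v <;> simp_all

/-- The boundary after the vertex `v` has been merged into `u`. -/
theorem edgeBoundary_collapse (s t : E → V) (z : E → ZMod 2) {u v : V} (huv : u ≠ v) (x : V) :
    edgeBoundary (fun e => if s e = v then u else s e) (fun e => if t e = v then u else t e) z x =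
      if x = v then 0 else edgeBoundary s t z x + if x = u then edgeBoundary s t z v else 0 := by
  have key : ∀ a : V, (if (if a = v then u else a) = x then (1 : ZMod 2) else 0) =
      if x = v then 0 else (if a = x then 1 else 0) +
        if x = u then (if a = v then 1 else 0) else 0 := by
    intro a
    by_cases h1 : a = v
    · subst h1
      by_cases h2 : x = a
      · subst h2; simp [huv]
      · by_cases h3 : x = u
        · subst h3; simp [h2, Ne.symm h2]
        · simp [h2, h3, Ne.symm h2, Ne.symm h3]
    · by_cases h2 : x = v
      · subst h2; simp [h1]
      · simp [h1, h2]
  simp only [edgeBoundary_apply, key]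
  by_cases h2 : x = v
  · simp [h2]
  · simp only [h2, if_false]
    by_cases h3 : x = u
    · simp only [h3, if_true]
      rw [← Finset.sum_add_distrib]
      exact Finset.sum_congr rfl fun e _ => by ring
    · simp [h3]

/-- The edge of largest weight on a cycle `z` of length at most `L` is removed, and the weights of the
other edges of `z` are multiplied by `1 + 1 / L`; this does not increase the total weight. -/
theorem sum_reweighted_le {F : Finset E} {z : E → ZMod 2} {L : ℕ} (hL : 0 < L)
    (hzL : hammingNorm z ≤ L) {w : E → ℝ} (hw : ∀ e, 0 < w e) {e₀ : E} (he₀ : e₀ ∈ F)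
    (hmax : ∀ e, z e ≠ 0 → w e ≤ w e₀) :
    ∑ e ∈ F.erase e₀, (if z e ≠ 0 then (1 + 1 / (L : ℝ)) * w e else w e) ≤ ∑ e ∈ F, w e := by
  rw [← Finset.add_sum_erase F w he₀, add_comm (w e₀)]
  have hL' : (0 : ℝ) < L := by exact_mod_cast hL
  have h1 : ∀ e, (if z e ≠ 0 then (1 + 1 / (L : ℝ)) * w e else w e) ≤
      w e + if z e ≠ 0 then w e₀ / L else 0 := by
    intro e
    by_cases h : z e = 0
    · simp [h]
    · have := hmax e h
      simp only [ne_eq, h, not_false_eq_true, if_true]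
      have : w e / L ≤ w e₀ / L := by gcongr
      calc (1 + 1 / (L : ℝ)) * w e = w e + w e / L := by ring
        _ ≤ _ := by gcongr
  refine (Finset.sum_le_sum fun e _ => h1 e).trans ?_
  rw [Finset.sum_add_distrib]
  gcongr
  rw [← Finset.sum_filter, Finset.sum_const, nsmul_eq_mul]
  have h2 : (((F.erase e₀).filter fun e => z e ≠ 0).card : ℝ) ≤ L := by
    have : ((F.erase e₀).filter fun e => z e ≠ 0).card ≤ hammingNorm z := by
      refine Finset.card_le_card fun e he => ?_
      simpa using (Finset.mem_filter.mp he).2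
    exact_mod_cast this.trans hzL
  calc (((F.erase e₀).filter fun e => z e ≠ 0).card : ℝ) * (w e₀ / L) ≤ L * (w e₀ / L) := by
        have := (hw e₀).le
        gcongr
    _ = w e₀ := by field_simp

/-- Weighted form of the decongestion lemma. In each step an edge is deleted (the one at a vertex
of degree `1`, or the heaviest one of a short cycle, which is put into the family) or contracted (at a
vertex of degree `2`; the other edge there inherits its weight). -/
theorem exists_spanning_weighted {S : Finset V} {R : ℕ} (hR : S.card < 2 ^ R) (m : ℕ) :
    ∀ (F : Finset E) (s t : E → V) (w : E → ℝ), F.card = m → (∀ e ∈ F, s e ∈ S ∧ t e ∈ S) →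
      (∀ e, 0 < w e) → ∃ (ι : Type) (_ : Fintype ι) (c : ι → E → ZMod 2),
        (∀ j, c j ∈ cyclesIn s t F) ∧ cyclesIn s t F ≤ Submodule.span (ZMod 2) (Set.range c) ∧
        ∀ e ∈ F, w e * (1 + 1 / ((2 * R + 1 : ℕ) : ℝ)) ^ chainCongestion c e ≤
          (1 + 1 / ((2 * R + 1 : ℕ) : ℝ)) * ∑ e ∈ F, w e := by
  set β : ℝ := 1 + 1 / ((2 * R + 1 : ℕ) : ℝ) with hβ
  have hβ1 : 1 ≤ β := by rw [hβ]; have : (0 : ℝ) ≤ 1 / ((2 * R + 1 : ℕ) : ℝ) := by positivity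
                         linarith
  have hβ0 : 0 < β := by linarith
  induction m with
  | zero =>
    intro F s t w hF _ _
    rw [Finset.card_eq_zero] at hF
    subst hF
    refine ⟨Empty, inferInstance, fun j => j.elim, fun j => j.elim, fun z hz => ?_, by simp⟩
    have : z = 0 := funext fun e => (mem_cyclesIn.mp hz).2 e (Finset.notMem_empty e)
    rw [this]; exact Submodule.zero_mem _
  | succ m ih =>
    intro F s t w hF hS hw
    have hFne : F.Nonempty := Finset.card_pos.mp (by omega)
    by_cases hshort : ∃ z ∈ cyclesIn s t F, z ≠ 0 ∧ hammingNorm z ≤ 2 * R + 1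
    · -- a short cycle: delete its heaviest edge
      obtain ⟨z, hz, hz0, hzL⟩ := hshort
      obtain ⟨hz1, hz2⟩ := mem_cyclesIn.mp hz
      have hne : (Finset.univ.filter fun e => z e ≠ 0).Nonempty := by
        obtain ⟨e, he⟩ := Function.ne_iff.mp hz0
        exact ⟨e, by simpa using he⟩
      obtain ⟨e₀, he₀, hmax⟩ := Finset.exists_max_image _ w hne
      have he₀z : z e₀ ≠ 0 := (Finset.mem_filter.mp he₀).2
      have he₀F : e₀ ∈ F := by
        by_contra h; exact he₀z (hz2 e₀ h)
      have hmax' : ∀ e, z e ≠ 0 → w e ≤ w e₀ := fun e he => hmax e (by simpa using he)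
      obtain ⟨ι, _, c, hc, hspan, hcong⟩ := ih (F.erase e₀) s t
        (fun e => if z e ≠ 0 then β * w e else w e) (by rw [Finset.card_erase_of_mem he₀F]; omega)
        (fun e he => hS e (Finset.mem_of_mem_erase he)) (fun e => by
          have := hw e
          by_cases h : z e = 0
          · simpa [h] using this
          · simp only [ne_eq, h, not_false_eq_true, if_true]; positivity)
      have hsum := sum_reweighted_le (by omega) hzL hw he₀F hmax'
      rw [← hβ] at hsum
      refine ⟨Option ι, inferInstance, fun j => j.elim z c, ?_, ?_, ?_⟩
      · rintro (_ | j)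
        · exact hz
        · have := mem_cyclesIn.mp (hc j)
          exact mem_cyclesIn.mpr ⟨this.1, fun e he => this.2 e fun h => he (Finset.mem_of_mem_erase h)⟩
      · have hle : Submodule.span (ZMod 2) (Set.range c) ≤
            Submodule.span (ZMod 2) (Set.range fun j : Option ι => j.elim z c) := by
          refine Submodule.span_mono ?_
          rintro _ ⟨j, rfl⟩
          exact ⟨some j, rfl⟩
        have hzmem : z ∈ Submodule.span (ZMod 2) (Set.range fun j : Option ι => j.elim z c) :=
          Submodule.subset_span ⟨none, rfl⟩
        have hred : ∀ y ∈ cyclesIn s t F, y e₀ = 0 →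
            y ∈ Submodule.span (ZMod 2) (Set.range fun j : Option ι => j.elim z c) := by
          intro y hy hy0
          refine hle (hspan (mem_cyclesIn.mpr ⟨(mem_cyclesIn.mp hy).1, fun e he => ?_⟩))
          by_cases h : e = e₀
          · rw [h, hy0]
          · exact (mem_cyclesIn.mp hy).2 e fun h' => he (Finset.mem_erase.mpr ⟨h, h'⟩)
        intro y hy
        by_cases hy0 : y e₀ = 0
        · exact hred y hy hy0
        · have := hred (y - z) (Submodule.sub_mem _ hy hz) (by
            rw [Pi.sub_apply, ZMod2.eq_one_of_ne_zero hy0, ZMod2.eq_one_of_ne_zero he₀z, sub_self])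
          simpa using Submodule.add_mem _ this hzmem
      · intro e he
        have hcc : chainCongestion (fun j : Option ι => j.elim z c) e =
            (if z e ≠ 0 then 1 else 0) + chainCongestion c e := by
          rw [chainCongestion, Fintype.sum_option]
          rfl
        rw [hcc]
        by_cases h : e = e₀
        · subst h
          rw [chainCongestion_eq_zero fun j =>
            (mem_cyclesIn.mp (hc j)).2 e (Finset.notMem_erase e F), if_pos he₀z, add_zero, pow_one,
            mul_comm]
          gcongr
          exact Finset.single_le_sum (fun e _ => (hw e).le) he
        · have h1 := hcong e (Finset.mem_erase.mpr ⟨h, he⟩)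
          refine le_trans (le_of_eq ?_) (h1.trans (by gcongr))
          by_cases hze : z e = 0
          · simp [hze]
          · simp only [ne_eq, hze, not_false_eq_true, if_true]
            ring
    · have hloop : ∀ e ∈ F, s e ≠ t e := by
        intro e he hst
        refine hshort ⟨Pi.single e 1, mem_cyclesIn.mpr ⟨?_, fun e' he' => ?_⟩, ?_, ?_⟩
        · rw [edgeBoundary_single, hst, ZMod2.fun_add_self]
        · refine Pi.single_eq_of_ne (fun h => he' ?_) 1
          rw [h]; exact he
        · intro h
          have := congrFun h e
          simp at this
        · exact (hammingNorm_single_le e).trans (by omega)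
      have hdeg : ¬ ∀ v, degIn s t F v = 0 ∨ 3 ≤ degIn s t F v := fun hdeg =>
        hshort (exists_short_cycle hFne hS hR hdeg)
      push Not at hdeg
      obtain ⟨v, hv0, hv3⟩ := hdeg
      rw [degIn_eq_card hloop] at hv0 hv3
      have hv12 : (F.filter fun e => s e = v ∨ t e = v).card = 1 ∨
          (F.filter fun e => s e = v ∨ t e = v).card = 2 := by omega
      rcases hv12 with hv1 | hv2
      · -- a vertex of degree `1`: no cycle uses the edge at it
        obtain ⟨e₀, he₀⟩ := Finset.card_eq_one.mp hv1
        have he₀F : e₀ ∈ F := (Finset.mem_filter.mp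
          (he₀ ▸ Finset.mem_singleton_self e₀ : e₀ ∈ F.filter fun e => s e = v ∨ t e = v)).1
        have hZ : cyclesIn s t F ≤ cyclesIn s t (F.erase e₀) := by
          intro z hz
          obtain ⟨hz1, hz2⟩ := mem_cyclesIn.mp hz
          refine mem_cyclesIn.mpr ⟨hz1, fun e he => ?_⟩
          by_cases h : e = e₀
          · have := edgeBoundary_apply_of_incident hloop hz2 v
            rw [hz1, he₀, Finset.sum_singleton, Pi.zero_apply] at this
            rw [h, ← this]
          · exact hz2 e fun h' => he (Finset.mem_erase.mpr ⟨h, h'⟩)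
        obtain ⟨ι, _, c, hc, hspan, hcong⟩ := ih (F.erase e₀) s t w
          (by rw [Finset.card_erase_of_mem he₀F]; omega)
          (fun e he => hS e (Finset.mem_of_mem_erase he)) hw
        have hle : ∑ e ∈ F.erase e₀, w e ≤ ∑ e ∈ F, w e :=
          Finset.sum_le_sum_of_subset_of_nonneg (Finset.erase_subset _ _) fun e _ _ => (hw e).le
        refine ⟨ι, inferInstance, c, fun j => ?_, hZ.trans hspan, fun e he => ?_⟩
        · have := mem_cyclesIn.mp (hc j)
          exact mem_cyclesIn.mpr ⟨this.1, fun e he => this.2 e fun h => he (Finset.mem_of_mem_erase h)⟩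
        · by_cases h : e = e₀
          · subst h
            rw [chainCongestion_eq_zero fun j =>
              (mem_cyclesIn.mp (hc j)).2 e (Finset.notMem_erase e F), pow_zero, mul_one]
            have h1 := Finset.single_le_sum (fun e _ => (hw e).le) he
            have h2 : 0 ≤ ∑ e ∈ F, w e := Finset.sum_nonneg fun e _ => (hw e).le
            nlinarith
          · exact (hcong e (Finset.mem_erase.mpr ⟨h, he⟩)).trans (by gcongr)
      · -- a vertex of degree `2`: contract one of its edges
        obtain ⟨e₀, f₀, hne, hef⟩ := Finset.card_eq_two.mp hv2
        have he₀ := Finset.mem_filter.mp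
          (hef ▸ Finset.mem_insert_self e₀ {f₀} : e₀ ∈ F.filter fun e => s e = v ∨ t e = v)
        have hf₀ := Finset.mem_filter.mp
          (hef ▸ Finset.mem_insert_of_mem (Finset.mem_singleton_self f₀) :
            f₀ ∈ F.filter fun e => s e = v ∨ t e = v)
        have hbv : ∀ z : E → ZMod 2, (∀ e ∉ F, z e = 0) → edgeBoundary s t z v = z e₀ + z f₀ := by
          intro z hz
          rw [edgeBoundary_apply_of_incident hloop hz v, hef, Finset.sum_pair hne]
        obtain ⟨u, huv, huS, hu⟩ : ∃ u, u ≠ v ∧ u ∈ S ∧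
            (Pi.single (s f₀) 1 + Pi.single (t f₀) 1 : V → ZMod 2) =
              Pi.single u 1 + Pi.single v 1 := by
          have := hloop f₀ hf₀.1
          rcases hf₀.2 with h | h
          · exact ⟨t f₀, fun h' => this (h.trans h'.symm), (hS f₀ hf₀.1).2, by rw [h, add_comm]⟩
          · exact ⟨s f₀, fun h' => this (h'.trans h.symm), (hS f₀ hf₀.1).1, by rw [h]⟩
        set s' : E → V := fun e => if s e = v then u else s e with hs'
        set t' : E → V := fun e => if t e = v then u else t e with ht'
        -- the contracted edge is a loop, so it does not matter for the new boundary operator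
        have hbf : edgeBoundary s' t' (Pi.single f₀ 1) = 0 := by
          funext x
          rw [edgeBoundary_collapse s t _ huv, edgeBoundary_single, hu]
          by_cases h1 : x = v
          · simp [h1]
          · by_cases h2 : x = u
            · subst h2
              simp [huv, huv.symm]
              decide
            · simp [h1, h2]
        -- `lift` extends a chain of the contracted graph: `f₀` gets the coefficient of `e₀`
        set lift := LinearMap.funLeft (ZMod 2) (ZMod 2) (Function.update id f₀ e₀) with hlift
        have lift_of_ne : ∀ (z : E → ZMod 2) (e : E), e ≠ f₀ → lift z e = z e := by
          intro z e he
          simp [hlift, LinearMap.funLeft_apply, Function.update_of_ne he]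
        have lift_self : ∀ z : E → ZMod 2, lift z f₀ = z e₀ := by
          intro z
          simp [hlift, LinearMap.funLeft_apply]
        have hup : ∀ (z y : E → ZMod 2), (∀ e, e ≠ f₀ → z e = y e) →
            edgeBoundary s' t' z = edgeBoundary s' t' y := by
          intro z y hzy
          have : z = y + (z f₀ - y f₀) • Pi.single f₀ 1 := by
            funext e
            by_cases he : e = f₀
            · subst he; simp
            · simp [hzy e he, he]
          rw [this, map_add, map_smul, hbf, smul_zero, add_zero]
        obtain ⟨ι, _, c, hc, hspan, hcong⟩ := ih (F.erase f₀) s' t'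
          (fun e => w e + if e = e₀ then w f₀ else 0)
          (by rw [Finset.card_erase_of_mem hf₀.1]; omega)
          (fun e he => by
            have := hS e (Finset.mem_of_mem_erase he)
            constructor
            · simp only [hs']; split_ifs; exacts [huS, this.1]
            · simp only [ht']; split_ifs; exacts [huS, this.2])
          (fun e => by
            have := hw e; have := hw f₀
            split_ifs <;> linarith)
        have hsum : ∑ e ∈ F.erase f₀, (w e + if e = e₀ then w f₀ else 0) = ∑ e ∈ F, w e := by
          rw [Finset.sum_add_distrib, Finset.sum_ite_eq',
            if_pos (Finset.mem_erase.mpr ⟨hne, he₀.1⟩), add_comm, Finset.add_sum_erase F w hf₀.1]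
        rw [hsum] at hcong
        refine ⟨ι, inferInstance, fun j => lift (c j), fun j => ?_, fun z hz => ?_, fun e he => ?_⟩
        · obtain ⟨h1, h2⟩ := mem_cyclesIn.mp (hc j)
          have hsupp : ∀ e ∉ F, lift (c j) e = 0 := fun e he => by
            rw [lift_of_ne _ _ fun h => he (by rw [h]; exact hf₀.1)]
            exact h2 e fun h => he (Finset.mem_of_mem_erase h)
          have hv : edgeBoundary s t (lift (c j)) v = 0 := by
            rw [hbv _ hsupp, lift_self, lift_of_ne _ _ hne]
            exact CharTwo.add_self_eq_zero _
          refine mem_cyclesIn.mpr ⟨funext fun x => ?_, hsupp⟩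
          by_cases hx : x = v
          · rw [hx, hv]; rfl
          · have := congrFun (hup (lift (c j)) (c j) fun e he => lift_of_ne _ _ he) x
            rw [h1, edgeBoundary_collapse s t _ huv, if_neg hx, hv] at this
            simpa using this
        · obtain ⟨h1, h2⟩ := mem_cyclesIn.mp hz
          have hzz : z e₀ = z f₀ := by
            have := hbv z h2
            rw [h1, Pi.zero_apply] at this
            exact (CharTwo.add_eq_zero).mp this.symm
          have hz' : Function.update z f₀ 0 ∈ cyclesIn s' t' (F.erase f₀) := by
            refine mem_cyclesIn.mpr ⟨?_, fun e he => ?_⟩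
            · rw [hup _ z fun e he => Function.update_of_ne he _ _]
              funext x
              rw [edgeBoundary_collapse s t _ huv, h1]
              simp
            · by_cases h : e = f₀
              · subst h; simp
              · rw [Function.update_of_ne h]
                exact h2 e fun h' => he (Finset.mem_erase.mpr ⟨h, h'⟩)
          have hzl : z = lift (Function.update z f₀ 0) := by
            funext e
            by_cases h : e = f₀
            · subst h
              rw [lift_self, Function.update_of_ne hne, hzz]
            · rw [lift_of_ne _ _ h, Function.update_of_ne h]
          rw [hzl]
          have := Submodule.mem_map_of_mem (f := lift) (hspan hz')
          rwa [Submodule.map_span, ← Set.range_comp] at this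
        · by_cases h : e = f₀
          · subst h
            have h1 := hcong e₀ (Finset.mem_erase.mpr ⟨hne, he₀.1⟩)
            have h2 : chainCongestion (fun j => lift (c j)) e = chainCongestion c e₀ := by
              simp [chainCongestion, lift_self]
            rw [h2]
            refine le_trans ?_ h1
            have := (hw e₀).le
            gcongr
            simpa using this
          · have h1 := hcong e (Finset.mem_erase.mpr ⟨h, he⟩)
            have h2 : chainCongestion (fun j => lift (c j)) e = chainCongestion c e := by
              simp [chainCongestion, lift_of_ne _ _ h]
            rw [h2]
            refine le_trans ?_ h1
            have := (hw f₀).le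
            gcongr
            split_ifs <;> simp [this]

end Multigraph

/-! ### Parallel edges -/

section Multigraph

variable {V E : Type*} [DecidableEq V] [Fintype E] [DecidableEq E]

/-- The chain formed by two edges. -/
def pairChain (p : E × E) : E → ZMod 2 := Pi.single p.1 1 + Pi.single p.2 1

/-- Two different edges with the same end points. -/
def IsParallel (s t : E → V) (p : E × E) : Prop :=
  p.1 ≠ p.2 ∧ s(s p.1, t p.1) = s(s p.2, t p.2)

theorem edgeBoundary_pairChain {s t : E → V} {p : E × E} (h : IsParallel s t p) :
    edgeBoundary s t (pairChain p) = 0 := by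
  rw [pairChain, map_add, edgeBoundary_single, edgeBoundary_single]
  rcases Sym2.eq_iff.mp h.2 with ⟨h1, h2⟩ | ⟨h1, h2⟩
  · rw [h1, h2, ZMod2.fun_add_self]
  · rw [h1, h2, add_comm (Pi.single (t p.2) 1), ZMod2.fun_add_self]

/-- The edges of each class of parallel edges of `F` are linked successively by cycles of length `2`, each
edge lying in at most two of them; modulo these cycles, each chain on `F` is a chain on a set `R` of
representatives. -/
theorem exists_parallel_reduction (s t : E → V) (F : Finset E) :
    ∃ (ι : Type) (_ : Fintype ι) (p : ι → E × E) (R : Finset E),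
      R ⊆ F ∧ (∀ j, (p j).1 ∈ F ∧ (p j).2 ∈ F ∧ IsParallel s t (p j)) ∧
      (∀ e ∈ R, ∀ f ∈ R, s(s e, t e) = s(s f, t f) → e = f) ∧
      (∀ e, (∑ j, if e = (p j).1 ∨ e = (p j).2 then 1 else 0) ≤ 2) ∧
      (∀ e ∈ R, (∑ j, if e = (p j).1 ∨ e = (p j).2 then 1 else 0) ≤ 1) ∧
      ∀ z : E → ZMod 2, (∀ e ∉ F, z e = 0) →
        ∃ y ∈ Submodule.span (ZMod 2) (Set.range fun j => pairChain (p j)),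
          ∀ e ∉ R, (z - y) e = 0 := by
  induction F using Finset.induction_on with
  | empty =>
    refine ⟨Empty, inferInstance, fun j => j.elim, ∅, by simp, fun j => j.elim, by simp, by simp,
      by simp, fun z hz => ⟨0, Submodule.zero_mem _, fun e he => ?_⟩⟩
    simpa using hz e he
  | insert e F heF ih =>
    obtain ⟨ι, _, p, R, hRF, hp, hinj, h2, h1, hz⟩ := ih
    have heR : e ∉ R := fun h => heF (hRF h)
    have h0 : ∀ j, ¬ (e = (p j).1 ∨ e = (p j).2) := by
      rintro j (h | h)
      · exact heF (h ▸ (hp j).1)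
      · exact heF (h ▸ (hp j).2.1)
    have hsplit : ∀ z : E → ZMod 2, (∀ f ∉ insert e F, z f = 0) →
        ∃ y ∈ Submodule.span (ZMod 2) (Set.range fun j => pairChain (p j)),
          ∀ f ∉ insert e R, (z - y) f = 0 := by
      intro z hz'
      obtain ⟨y, hy, hy'⟩ := hz (z - z e • Pi.single e 1) (fun f hf => by
        by_cases h : f = e
        · subst h; simp
        · simp [h, hz' f (by simp [h, hf])])
      refine ⟨y, hy, fun f hf => ?_⟩
      rw [Finset.mem_insert, not_or] at hf
      have := hy' f hf.2
      simpa [hf.1] using this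
    by_cases hpar : ∃ r ∈ R, s(s r, t r) = s(s e, t e)
    · obtain ⟨r, hr, hre⟩ := hpar
      have hner : r ≠ e := fun h => heR (h ▸ hr)
      have hsum : ∀ f, (∑ j : Option ι, if f = (j.elim (r, e) p).1 ∨ f = (j.elim (r, e) p).2
          then 1 else 0) = (if f = r ∨ f = e then 1 else 0) +
            ∑ j, if f = (p j).1 ∨ f = (p j).2 then 1 else 0 := by
        intro f
        rw [Fintype.sum_option]
        rfl
      have hse : (∑ j, if e = (p j).1 ∨ e = (p j).2 then 1 else 0) = 0 :=
        Finset.sum_eq_zero fun j _ => if_neg (h0 j)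
      refine ⟨Option ι, inferInstance, fun j => j.elim (r, e) p, insert e (R.erase r), ?_, ?_, ?_, ?_,
        ?_, ?_⟩
      · exact Finset.insert_subset_insert _ ((Finset.erase_subset _ _).trans hRF)
      · rintro (_ | j)
        · exact ⟨Finset.mem_insert_of_mem (hRF hr), Finset.mem_insert_self _ _, hner, hre⟩
        · exact ⟨Finset.mem_insert_of_mem (hp j).1, Finset.mem_insert_of_mem (hp j).2.1, (hp j).2.2⟩
      · intro f hf g hg hfg
        simp only [Finset.mem_insert, Finset.mem_erase] at hf hg
        rcases hf with rfl | ⟨hf, hfR⟩ <;> rcases hg with rfl | ⟨hg, hgR⟩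
        · rfl
        · exact absurd (hinj r hr g hgR (hre.trans hfg)) hg.symm
        · exact absurd (hinj f hfR r hr (hfg.trans hre.symm)) hf
        · exact hinj f hfR g hgR hfg
      · intro f
        rw [hsum]
        by_cases hfe : f = e
        · subst hfe; simp [hse]
        · by_cases hfr : f = r
          · subst hfr
            have := h1 f hr
            simp only [true_or, if_true]
            omega
          · simpa [hfe, hfr] using h2 f
      · intro f hf
        rw [hsum]
        simp only [Finset.mem_insert, Finset.mem_erase] at hf
        rcases hf with rfl | ⟨hf, hfR⟩
        · simp [hse]
        · have hfe : f ≠ e := fun h => heR (h ▸ hfR)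
          simpa [hf, hfe] using h1 f hfR
      · intro z hz'
        obtain ⟨y, hy, hy'⟩ := hsplit z hz'
        have hle : Submodule.span (ZMod 2) (Set.range fun j => pairChain (p j)) ≤
            Submodule.span (ZMod 2) (Set.range fun j : Option ι => pairChain (j.elim (r, e) p)) := by
          refine Submodule.span_mono ?_
          rintro _ ⟨j, rfl⟩
          exact ⟨some j, rfl⟩
        refine ⟨y + (z - y) r • pairChain (r, e), Submodule.add_mem _ (hle hy)
          (Submodule.smul_mem _ _ (Submodule.subset_span ⟨none, rfl⟩)), fun f hf => ?_⟩
        simp only [Finset.mem_insert, Finset.mem_erase, not_or, not_and_or, not_not] at hf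
        rcases hf with ⟨hfe, rfl | hfR⟩
        · simp [pairChain, hfe]
        · have hfr : f ≠ r := fun h => hfR (by rw [h]; exact hr)
          have := hy' f (by simp [hfe, hfR])
          simpa [pairChain, hfe, hfr] using this
    · push Not at hpar
      refine ⟨ι, inferInstance, p, insert e R, Finset.insert_subset_insert _ hRF, fun j =>
        ⟨Finset.mem_insert_of_mem (hp j).1, Finset.mem_insert_of_mem (hp j).2.1, (hp j).2.2⟩, ?_, h2,
        ?_, hsplit⟩
      · intro f hf g hg hfg
        rcases Finset.mem_insert.mp hf with rfl | hf' <;>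
          rcases Finset.mem_insert.mp hg with rfl | hg'
        · rfl
        · exact absurd hfg.symm (hpar g hg')
        · exact absurd hfg (hpar f hf')
        · exact hinj f hf' g hg' hfg
      · intro f hf
        rcases Finset.mem_insert.mp hf with rfl | hf
        · simp [h0]
        · exact h1 f hf

/-- In a multigraph on at most `n` vertices without parallel edges, the cycle space is spanned by a
family of cycles which uses each edge at most `(2 log₂ n + 3) ^ 2` times. -/
theorem exists_spanning_of_no_parallel {s t : E → V} {R : Finset E} {S : Finset V}
    (hS : ∀ e ∈ R, s e ∈ S ∧ t e ∈ S)
    (hinj : ∀ e ∈ R, ∀ f ∈ R, s(s e, t e) = s(s f, t f) → e = f) :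
    R.card ≤ S.card ^ 2 ∧ ∃ (ι : Type) (_ : Fintype ι) (c : ι → E → ZMod 2),
      (∀ j, c j ∈ cyclesIn s t R) ∧ cyclesIn s t R ≤ Submodule.span (ZMod 2) (Set.range c) ∧
      ∀ e, chainCongestion c e ≤ (2 * Nat.log 2 S.card + 3) ^ 2 := by
  have hcard : R.card ≤ S.card ^ 2 := by
    rw [sq, ← Finset.card_product]
    refine Finset.card_le_card_of_injOn (fun e => (s e, t e)) (fun e he => ?_) fun e he f hf h => ?_
    · simpa using hS e he
    · obtain ⟨h1, h2⟩ := Prod.mk.inj h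
      exact hinj e he f hf (by rw [h1, h2])
  refine ⟨hcard, ?_⟩
  set q := Nat.log 2 S.card with hq
  have hlt : S.card < 2 ^ (q + 1) := Nat.lt_pow_succ_log_self (by norm_num) _
  obtain ⟨ι, _, c, hc, hspan, hcong⟩ :=
    exists_spanning_weighted hlt R.card R s t (fun _ => 1) rfl hS fun _ => one_pos
  refine ⟨ι, inferInstance, c, hc, hspan, fun e => ?_⟩
  by_cases he : e ∈ R
  · -- a congestion above `L ^ 2` with `L = 2 q + 3` contradicts the weight bound, as `2 ≤ β ^ L`
    by_contra hlarge
    push Not at hlarge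
    have h1 := hcong e he
    rw [show 2 * (q + 1) + 1 = 2 * q + 3 by ring] at h1
    set L := 2 * q + 3 with hL
    have hLpos : (0 : ℝ) < (L : ℝ) := by rw [hL]; positivity
    simp only [one_mul, Finset.sum_const, nsmul_eq_mul, mul_one] at h1
    set β : ℝ := 1 + 1 / (L : ℝ) with hβ
    have hβ1 : 1 ≤ β := by
      rw [hβ]; have : 0 ≤ 1 / (L : ℝ) := by positivity
      linarith
    have hβ2 : β ≤ 2 := by
      have : 1 / (L : ℝ) ≤ 1 := by
        rw [div_le_one hLpos]
        have : 1 ≤ L := by omega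
        exact_mod_cast this
      linarith
    have hβL : 2 ≤ β ^ L := by
      have := one_add_mul_le_pow (a := 1 / (L : ℝ)) (by
        have : 0 ≤ 1 / (L : ℝ) := by positivity
        linarith) L
      rw [mul_one_div_cancel hLpos.ne'] at this
      linarith
    have h2 : (2 : ℝ) ^ L ≤ β ^ chainCongestion c e := by
      calc (2 : ℝ) ^ L ≤ (β ^ L) ^ L := by gcongr
        _ = β ^ (L ^ 2) := by rw [← pow_mul, sq]
        _ ≤ _ := pow_le_pow_right₀ hβ1 hlarge.le
    have h3 : β * (R.card : ℝ) ≤ 2 * (S.card : ℝ) ^ 2 := by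
      have : (R.card : ℝ) ≤ (S.card : ℝ) ^ 2 := by exact_mod_cast hcard
      gcongr
    have h4 : 2 * S.card ^ 2 < 2 ^ L := by
      have : 2 ^ L = 2 * (2 ^ (q + 1)) ^ 2 := by rw [hL]; ring
      rw [this]
      gcongr
    have h5 : (2 * (S.card : ℝ) ^ 2) < 2 ^ L := by exact_mod_cast h4
    linarith
  · rw [chainCongestion_eq_zero fun j => (mem_cyclesIn.mp (hc j)).2 e he]
    exact Nat.zero_le _

end Multigraph

/-! ### Simple cycles -/

namespace ConeInput

section SimpleCycles

variable {X Q Z : Type*} [Fintype X] [Fintype Q] {A : CSSCode X Q Z} (D : ConeInput A) (i : Fin D.m)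

/-- One of the two ends of an edge of `Gᵢ`. -/
noncomputable def edgeSrc (e : D.Edge i) : D.Vert i := (D.exists_ends i e).choose

/-- The other end of an edge of `Gᵢ`. -/
noncomputable def edgeTgt (e : D.Edge i) : D.Vert i := (D.exists_ends i e).choose_spec.choose

theorem edgeSrc_ne_edgeTgt (e : D.Edge i) : D.edgeSrc i e ≠ D.edgeTgt i e :=
  (D.exists_ends i e).choose_spec.choose_spec.1

theorem edge_eq (e : D.Edge i) : (e.2 : Sym2 Q) = s((D.edgeSrc i e : Q), (D.edgeTgt i e : Q)) :=
  (D.exists_ends i e).choose_spec.choose_spec.2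

variable {D i}

theorem edge_eq_iff {e : D.Edge i} {u v : D.Vert i} :
    (e.2 : Sym2 Q) = s((u : Q), (v : Q)) ↔ s(D.edgeSrc i e, D.edgeTgt i e) = s(u, v) := by
  rw [D.edge_eq i e, Sym2.eq_iff, Sym2.eq_iff]
  simp only [Subtype.ext_iff]

theorem ne_of_edge_eq {e : D.Edge i} {u v : D.Vert i} (h : (e.2 : Sym2 Q) = s((u : Q), (v : Q))) :
    u ≠ v := by
  rintro rfl
  exact D.not_diag i _ _ e.2.2 (by rw [h]; exact Sym2.mk_isDiag_iff.mpr rfl)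

theorem mem_edge_iff {e : D.Edge i} {v : D.Vert i} :
    (v : Q) ∈ (e.2 : Sym2 Q) ↔ D.edgeSrc i e = v ∨ D.edgeTgt i e = v := by
  rw [D.edge_eq i e, Sym2.mem_iff, Subtype.ext_iff, Subtype.ext_iff, eq_comm, @eq_comm _ (v : Q)]

open scoped Classical in
theorem bdry_transpose_mulVec (z : D.Edge i → ZMod 2) :
    (D.bdry i).transpose.mulVec z = edgeBoundary (D.edgeSrc i) (D.edgeTgt i) z := by
  funext v
  rw [edgeBoundary_apply, Matrix.mulVec, dotProduct]
  refine Finset.sum_congr rfl fun e _ => ?_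
  have hne := D.edgeSrc_ne_edgeTgt i e
  simp only [Matrix.transpose_apply, bdry, Matrix.of_apply, mem_edge_iff]
  by_cases h1 : D.edgeSrc i e = v <;> by_cases h2 : D.edgeTgt i e = v
  · exact absurd (h1.trans h2.symm) hne
  all_goals simp [h1, h2]

open scoped Classical in
theorem ker_bdry_transpose :
    LinearMap.ker (D.bdry i).transpose.mulVecLin =
      cyclesIn (D.edgeSrc i) (D.edgeTgt i) Finset.univ := by
  ext z
  rw [LinearMap.mem_ker, Matrix.mulVecLin_apply, bdry_transpose_mulVec, mem_cyclesIn]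
  simp

theorem SimpleCycle.chain_ne_zero_iff (γ : D.SimpleCycle i) (e : D.Edge i) :
    γ.chain e ≠ 0 ↔ ∃ t, γ.edge t = e := by
  simp [SimpleCycle.chain]

open scoped Classical in
theorem single_add_single_of_edge_eq {e : D.Edge i} {u v : D.Vert i}
    (h : (e.2 : Sym2 Q) = s((u : Q), (v : Q))) :
    (Pi.single (D.edgeSrc i e) 1 + Pi.single (D.edgeTgt i e) 1 : D.Vert i → ZMod 2) =
      Pi.single u 1 + Pi.single v 1 := by
  rcases Sym2.eq_iff.mp (edge_eq_iff.mp h) with ⟨h1, h2⟩ | ⟨h1, h2⟩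
  · rw [h1, h2]
  · rw [h1, h2, add_comm]

open scoped Classical in
theorem SimpleCycle.edgeBoundary_chain (γ : D.SimpleCycle i) :
    edgeBoundary (D.edgeSrc i) (D.edgeTgt i) γ.chain = 0 := by
  have hsum : γ.chain = ∑ t, Pi.single (γ.edge t) 1 := by
    funext e
    rw [Finset.sum_apply, SimpleCycle.chain]
    simp only [Pi.single_apply]
    by_cases h : ∃ t, γ.edge t = e
    · obtain ⟨t, rfl⟩ := h
      rw [if_pos ⟨t, rfl⟩, Finset.sum_eq_single t]
      · simp
      · intro b _ hb
        exact if_neg fun h => hb (γ.edge_inj h).symm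
      · simp
    · rw [if_neg h, Finset.sum_eq_zero]
      intro t _
      exact if_neg fun h' => h ⟨t, h'.symm⟩
  rw [hsum, map_sum]
  simp only [edgeBoundary_single]
  rw [Finset.sum_congr rfl fun t _ => single_add_single_of_edge_eq (γ.ends t),
    Finset.sum_add_distrib, Equiv.sum_comp (finRotate γ.len)
      (fun t => (Pi.single (γ.vert t) 1 : D.Vert i → ZMod 2))]
  exact ZMod2.fun_add_self _

/-- A walk without immediate reversals among the edges of a cycle of the cycle space. -/
theorem exists_nonbacktracking_walk {z : D.Edge i → ZMod 2}
    (hz : (D.bdry i).transpose.mulVec z = 0) (hz0 : z ≠ 0) :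
    ∃ (v : ℕ → D.Vert i) (e : ℕ → D.Edge i), ∀ n, z (e n) ≠ 0 ∧
      ((e n).2 : Sym2 Q) = s((v n : Q), (v (n + 1) : Q)) ∧ e (n + 1) ≠ e n := by
  classical
  -- each vertex lies on an even number of edges of `z`, so a walk never gets stuck
  have hnext : ∀ (e : D.Edge i) (v : D.Vert i), z e ≠ 0 → (v : Q) ∈ (e.2 : Sym2 Q) →
      ∃ e', e' ≠ e ∧ z e' ≠ 0 ∧ (v : Q) ∈ (e'.2 : Sym2 Q) := by
    intro e v hze hve
    by_contra hno
    push Not at hno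
    have h := congrFun hz v
    rw [Matrix.mulVec, dotProduct, Finset.sum_eq_single e] at h
    · simp only [Matrix.transpose_apply, bdry, Matrix.of_apply, hve, if_true, one_mul] at h
      exact hze h
    · intro e' _ he'
      by_cases h' : z e' = 0
      · rw [h', mul_zero]
      · simp [bdry, hno e' he' h']
    · simp
  let St := {x : D.Vert i × D.Edge i // z x.2 ≠ 0 ∧ (x.1 : Q) ∈ (x.2.2 : Sym2 Q)}
  have hstep : ∀ x : St, ∃ y : St, (x.1.2.2 : Sym2 Q) = s((x.1.1 : Q), (y.1.1 : Q)) ∧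
      y.1.2 ≠ x.1.2 := by
    rintro ⟨⟨v, e⟩, hze, hv⟩
    dsimp only at hze hv ⊢
    obtain ⟨u, hu⟩ : ∃ u : D.Vert i, (e.2 : Sym2 Q) = s((v : Q), (u : Q)) := by
      rcases mem_edge_iff.mp hv with h | h
      · exact ⟨D.edgeTgt i e, by rw [← h]; exact D.edge_eq i e⟩
      · exact ⟨D.edgeSrc i e, by rw [← h, Sym2.eq_swap]; exact D.edge_eq i e⟩
    obtain ⟨e', h1, h2, h3⟩ := hnext e u hze (by rw [hu]; exact Sym2.mem_mk_right _ _)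
    exact ⟨⟨⟨u, e'⟩, h2, h3⟩, hu, h1⟩
  choose f hf using hstep
  obtain ⟨e₀, he₀⟩ := Function.ne_iff.mp hz0
  let x₀ : St := ⟨⟨D.edgeSrc i e₀, e₀⟩, he₀, mem_edge_iff.mpr (Or.inl rfl)⟩
  refine ⟨fun n => (f^[n] x₀).1.1, fun n => (f^[n] x₀).1.2, fun n => ⟨(f^[n] x₀).2.1, ?_⟩⟩
  dsimp only
  rw [Function.iterate_succ_apply']
  exact hf (f^[n] x₀)

/-- The support of a nonzero element of the cycle space contains a simple cycle: the part of a walk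
without immediate reversals up to its first repeated vertex. -/
theorem exists_simpleCycle {z : D.Edge i → ZMod 2}
    (hz : (D.bdry i).transpose.mulVec z = 0) (hz0 : z ≠ 0) :
    ∃ γ : D.SimpleCycle i, ∀ t, z (γ.edge t) ≠ 0 := by
  classical
  obtain ⟨v, e, hve⟩ := exists_nonbacktracking_walk hz hz0
  have hrep : ∃ b, ∃ a < b, v a = v b := by
    obtain ⟨a, b, hab, h⟩ := Finite.exists_ne_map_eq_of_infinite v
    rcases lt_or_gt_of_ne hab with h' | h'
    · exact ⟨b, a, h', h⟩
    · exact ⟨a, b, h', h.symm⟩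
  obtain ⟨a, hab, hvab⟩ := Nat.find_spec hrep
  set b := Nat.find hrep with hb
  have hinj : ∀ k < b, ∀ l < b, v k = v l → k = l := by
    intro k hk l hl h
    rcases lt_trichotomy k l with h' | h' | h'
    · exact absurd ⟨k, h', h⟩ (Nat.find_min hrep hl)
    · exact h'
    · exact absurd ⟨l, h', h.symm⟩ (Nat.find_min hrep hk)
  have hne : ∀ n, v n ≠ v (n + 1) := fun n => ne_of_edge_eq (hve n).2.1
  have h2 : 2 ≤ b - a := by
    by_contra hlt
    have : b = a + 1 := by omega
    rw [this] at hvab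
    exact hne a hvab
  have hedge : ∀ k l, a ≤ k → k < l → l < b → e k ≠ e l := by
    intro k l hk hkl hl h
    have h1 : s(v k, v (k + 1)) = s(v l, v (l + 1)) :=
      (edge_eq_iff.mp (hve k).2.1).symm.trans (h ▸ edge_eq_iff.mp (hve l).2.1)
    rcases Sym2.eq_iff.mp h1 with ⟨h3, -⟩ | ⟨h3, h4⟩
    · exact absurd (hinj k (by omega) l hl h3) (by omega)
    · have h5 := hinj (k + 1) (by omega) l hl h4
      by_cases hlb : l + 1 < b
      · exact absurd (hinj k (by omega) (l + 1) hlb h3) (by omega)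
      · subst h5
        exact (hve k).2.2 h.symm
  refine ⟨⟨b - a, h2, fun t => v (a + t), fun t => e (a + t), ?_, ?_, ?_⟩, fun t => (hve _).1⟩
  · intro t t' h
    have := hinj _ (by omega) _ (by omega) h
    exact Fin.ext (by omega)
  · intro t t' h
    by_contra hne'
    rcases lt_or_gt_of_ne (fun h' => hne' (Fin.ext h') : (t : ℕ) ≠ t') with h' | h'
    · exact hedge (a + t) (a + t') (by omega) (by omega) (by omega) h
    · exact hedge (a + t') (a + t) (by omega) (by omega) (by omega) h.symm
  · intro t
    rw [(hve (a + t)).2.1]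
    have hrot : v (a + t + 1) = v (a + (finRotate (b - a) t : Fin (b - a))) := by
      obtain ⟨w, hw⟩ : ∃ w, b - a = w + 1 := ⟨b - a - 1, by omega⟩
      have hval : ((finRotate (b - a) t : Fin (b - a)) : ℕ) = if (t : ℕ) + 1 = b - a then 0
          else (t : ℕ) + 1 := by
        generalize b - a = c at t hw
        subst hw
        rw [coe_finRotate]
        simp [Fin.ext_iff]
      rw [hval]
      split_ifs with h
      · rw [add_zero, hvab]
        congr 1
        omega
      · rfl
    rw [hrot]

/-- Each element of the cycle space is a sum of edge-disjoint simple cycles. -/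
theorem exists_disjoint_simpleCycles (n : ℕ) : ∀ z : D.Edge i → ZMod 2,
    (D.bdry i).transpose.mulVec z = 0 → hammingNorm z = n →
    ∃ (ι : Type) (_ : Fintype ι) (γ : ι → D.SimpleCycle i),
      z ∈ Submodule.span (ZMod 2) (Set.range fun j => (γ j).chain) ∧
      ∀ e, chainCongestion (fun j => (γ j).chain) e ≤ if z e ≠ 0 then 1 else 0 := by
  classical
  induction n using Nat.strong_induction_on with
  | _ n ih =>
    intro z hz hn
    by_cases hz0 : z = 0
    · subst hz0
      exact ⟨Empty, inferInstance, fun j => j.elim, Submodule.zero_mem _, fun e => by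
        simp [chainCongestion]⟩
    · obtain ⟨γ, hγ⟩ := exists_simpleCycle hz hz0
      have hsub : ∀ e, γ.chain e ≠ 0 → z e ≠ 0 := fun e he => by
        obtain ⟨t, rfl⟩ := (γ.chain_ne_zero_iff e).mp he
        exact hγ t
      have hz' : ∀ e, (z - γ.chain) e ≠ 0 ↔ z e ≠ 0 ∧ γ.chain e = 0 := by
        intro e
        by_cases h : γ.chain e = 0
        · simp [h]
        · have h1 := hsub e h
          simp [ZMod2.eq_one_of_ne_zero h, ZMod2.eq_one_of_ne_zero h1]
      have hlt : hammingNorm (z - γ.chain) < n := by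
        rw [← hn]
        refine Finset.card_lt_card ?_
        rw [Finset.ssubset_iff_of_subset]
        · refine ⟨γ.edge ⟨0, by have := γ.two_le; omega⟩, by simpa using hγ _, ?_⟩
          rw [Finset.mem_filter, hz']
          rintro ⟨-, -, h⟩
          exact (γ.chain_ne_zero_iff _).mpr ⟨_, rfl⟩ h
        · intro e he
          simp only [Finset.mem_filter, Finset.mem_univ, true_and] at he ⊢
          exact ((hz' e).mp he).1
      obtain ⟨ι, _, γ', hspan, hcong⟩ := ih _ hlt (z - γ.chain) (by
        rw [Matrix.mulVec_sub, hz, bdry_transpose_mulVec, γ.edgeBoundary_chain, sub_zero]) rfl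
      refine ⟨Option ι, inferInstance, fun j => j.elim γ γ', ?_, fun e => ?_⟩
      · have h1 : Submodule.span (ZMod 2) (Set.range fun j => (γ' j).chain) ≤
            Submodule.span (ZMod 2) (Set.range fun j : Option ι => (j.elim γ γ').chain) := by
          refine Submodule.span_mono ?_
          rintro _ ⟨j, rfl⟩
          exact ⟨some j, rfl⟩
        have h2 : γ.chain ∈ Submodule.span (ZMod 2)
            (Set.range fun j : Option ι => (j.elim γ γ').chain) :=
          Submodule.subset_span ⟨none, rfl⟩
        simpa using Submodule.add_mem _ (h1 hspan) h2
      · have hcc : chainCongestion (fun j : Option ι => (j.elim γ γ').chain) e =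
            (if γ.chain e ≠ 0 then 1 else 0) + chainCongestion (fun j => (γ' j).chain) e := by
          rw [chainCongestion, Fintype.sum_option]
          rfl
        have h1 := hcong e
        rw [hcc]
        by_cases h : γ.chain e = 0
        · simp only [hz', h, and_true] at h1
          simpa [h] using h1
        · have h2 := hsub e h
          simp only [hz', h, and_false, if_false] at h1
          simpa [h, h2] using h1

/-- A family of elements of the cycle space can be replaced by a family of simple cycles that spans at
least as much and uses no edge more often. -/
theorem exists_simpleCycles_of_family {ι : Type} [Fintype ι] (c : ι → D.Edge i → ZMod 2)
    (hc : ∀ j, (D.bdry i).transpose.mulVec (c j) = 0) :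
    ∃ (κ : Type) (_ : Fintype κ) (γ : κ → D.SimpleCycle i),
      (∀ j, c j ∈ Submodule.span (ZMod 2) (Set.range fun k => (γ k).chain)) ∧
      ∀ e, chainCongestion (fun k => (γ k).chain) e ≤ chainCongestion c e := by
  choose κ hκ γ hspan hcong using fun j => exists_disjoint_simpleCycles _ (c j) (hc j) rfl
  refine ⟨Σ j, κ j, inferInstance, fun k => γ k.1 k.2, fun j => ?_, fun e => ?_⟩
  · refine Submodule.span_mono ?_ (hspan j)
    rintro _ ⟨k, rfl⟩
    exact ⟨⟨j, k⟩, rfl⟩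
  · rw [chainCongestion, Fintype.sum_sigma]
    exact Finset.sum_le_sum fun j _ => hcong j e

end SimpleCycles

end ConeInput

/-! ### Colorings and the choice of the multiplicity -/

section Coloring

open scoped Classical in
/-- Of the colorings of `J` with `ℓ` colors, at most a fraction `ℓ ^ (-b)` is constant on a given set of
`b + 1` elements. -/
theorem card_constant_on_mul_le {J : Type*} [Fintype J] (ℓ b : ℕ) (T : Finset J)
    (hT : T.card = b + 1) :
    (Finset.univ.filter fun h : J → Fin ℓ => ∀ x ∈ T, ∀ y ∈ T, h x = h y).card * ℓ ^ b ≤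
      ℓ ^ Fintype.card J := by
  obtain ⟨x₀, hx₀⟩ : T.Nonempty := Finset.card_pos.mp (by omega)
  have hcard : (T.erase x₀).card = b := by rw [Finset.card_erase_of_mem hx₀]; omega
  have h1 : Fintype.card (↥(T.erase x₀) → Fin ℓ) = ℓ ^ b := by
    rw [Fintype.card_fun, Fintype.card_coe, hcard, Fintype.card_fin]
  have h2 : Fintype.card (J → Fin ℓ) = ℓ ^ Fintype.card J := by simp
  rw [← h1, ← h2, ← Fintype.card_coe, ← Fintype.card_prod]
  -- recolor `T` without `x₀` arbitrarily; the original coloring can be recovered from `x₀`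
  refine Fintype.card_le_of_injective (fun p : ↥(Finset.univ.filter fun h : J → Fin ℓ =>
    ∀ x ∈ T, ∀ y ∈ T, h x = h y) × (↥(T.erase x₀) → Fin ℓ) =>
      fun x => if hx : x ∈ T.erase x₀ then p.2 ⟨x, hx⟩ else p.1.1 x) ?_
  rintro ⟨⟨h, hh⟩, g⟩ ⟨⟨h', hh'⟩, g'⟩ heq
  have hh := (Finset.mem_filter.mp hh).2
  have hh' := (Finset.mem_filter.mp hh').2
  have hpt : ∀ x, x ∉ T.erase x₀ → h x = h' x := fun x hx => by
    have := congrFun heq x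
    simpa only [hx, dif_neg, not_false_eq_true] using this
  have hx0 := hpt x₀ (Finset.notMem_erase _ _)
  refine Prod.ext (Subtype.ext (funext fun x => ?_)) (funext fun x => ?_)
  · by_cases hx : x ∈ T.erase x₀
    · have hxT := Finset.mem_of_mem_erase hx
      dsimp only
      rw [hh x hxT x₀ hx₀, hx0, hh' x₀ hx₀ x hxT]
    · exact hpt x hx
  · have := congrFun heq x
    simpa only [x.2, dif_pos] using this

open scoped Classical in
/-- A coloring in which no `e ∈ R` is incident with more than `b` elements of the same color exists by the
union bound over the pairs of some `e ∈ R` and `b + 1` elements incident with it. -/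
theorem exists_coloring {J E : Type*} [Fintype J] (R : Finset E) (inc : J → E → Prop) (M b ℓ : ℕ)
    (hM : ∀ e ∈ R, (Finset.univ.filter fun j => inc j e).card ≤ M)
    (hlt : R.card * M ^ (b + 1) < ℓ ^ b) (hℓ : 1 ≤ ℓ) :
    ∃ h : J → Fin ℓ, ∀ e ∈ R, ∀ k, (Finset.univ.filter fun j => inc j e ∧ h j = k).card ≤ b := by
  by_contra hno
  push Not at hno
  have hcover : (Finset.univ : Finset (J → Fin ℓ)) ⊆ R.biUnion fun e =>
      ((Finset.univ.filter fun j => inc j e).powersetCard (b + 1)).biUnion fun T =>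
        Finset.univ.filter fun h : J → Fin ℓ => ∀ x ∈ T, ∀ y ∈ T, h x = h y := by
    intro h _
    obtain ⟨e, he, k, hk⟩ := hno h
    obtain ⟨T, hTs, hT⟩ := Finset.exists_subset_card_eq (Nat.succ_le_of_lt hk)
    refine Finset.mem_biUnion.mpr ⟨e, he, Finset.mem_biUnion.mpr ⟨T, ?_, ?_⟩⟩
    · refine Finset.mem_powersetCard.mpr ⟨fun j hj => ?_, hT⟩
      simpa using (Finset.mem_filter.mp (hTs hj)).2.1
    · refine Finset.mem_filter.mpr ⟨Finset.mem_univ _, fun x hx y hy => ?_⟩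
      rw [(Finset.mem_filter.mp (hTs hx)).2.2, (Finset.mem_filter.mp (hTs hy)).2.2]
  have hle : Fintype.card (J → Fin ℓ) * ℓ ^ b ≤ R.card * M ^ (b + 1) * ℓ ^ Fintype.card J := by
    calc Fintype.card (J → Fin ℓ) * ℓ ^ b
        ≤ (∑ e ∈ R, ∑ T ∈ (Finset.univ.filter fun j => inc j e).powersetCard (b + 1),
            (Finset.univ.filter fun h : J → Fin ℓ => ∀ x ∈ T, ∀ y ∈ T, h x = h y).card) *
              ℓ ^ b := by
          gcongr
          refine (Finset.card_le_card hcover).trans (Finset.card_biUnion_le.trans ?_)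
          exact Finset.sum_le_sum fun e _ => Finset.card_biUnion_le
      _ = ∑ e ∈ R, ∑ T ∈ (Finset.univ.filter fun j => inc j e).powersetCard (b + 1),
            (Finset.univ.filter fun h : J → Fin ℓ => ∀ x ∈ T, ∀ y ∈ T, h x = h y).card *
              ℓ ^ b := by
          rw [Finset.sum_mul]
          exact Finset.sum_congr rfl fun e _ => Finset.sum_mul _ _ _
      _ ≤ ∑ e ∈ R, M ^ (b + 1) * ℓ ^ Fintype.card J := by
          refine Finset.sum_le_sum fun e he => ?_
          refine (Finset.sum_le_card_nsmul _ _ (ℓ ^ Fintype.card J) fun T hT =>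
            card_constant_on_mul_le ℓ b T (Finset.mem_powersetCard.mp hT).2).trans ?_
          rw [smul_eq_mul, Finset.card_powersetCard]
          gcongr
          exact (Nat.choose_le_pow _ _).trans (Nat.pow_le_pow_left (hM e he) _)
      _ = R.card * M ^ (b + 1) * ℓ ^ Fintype.card J := by
          rw [Finset.sum_const, smul_eq_mul, mul_assoc]
  have hpos : 0 < ℓ ^ Fintype.card J := by positivity
  have hJ : Fintype.card (J → Fin ℓ) = ℓ ^ Fintype.card J := by simp
  rw [hJ, mul_comm (ℓ ^ Fintype.card J)] at hle
  exact absurd (Nat.le_of_mul_le_mul_right hle hpos) (not_le.mpr hlt)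

end Coloring

section Numerics

open Filter

/-- The exact constant is `5 / log 2`, attained at `n = 2`. -/
theorem log_two_mul_log_le {n : ℕ} (hn : 2 ≤ n) :
    ((2 * Nat.log 2 n + 3 : ℕ) : ℝ) ≤ 7.5 * Real.log n := by
  have h2 : 0.6931471803 < Real.log 2 := Real.log_two_gt_d9
  have h1 : (Nat.log 2 n : ℝ) * Real.log 2 ≤ Real.log n := by
    rw [← Real.log_pow]
    refine Real.log_le_log (by positivity) ?_
    exact_mod_cast Nat.pow_log_le_self 2 (by omega)
  have h3 : Real.log 2 ≤ Real.log n := Real.log_le_log (by norm_num) (by exact_mod_cast hn)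
  have h4 : (0 : ℝ) ≤ Nat.log 2 n := by positivity
  push_cast
  nlinarith

/-- The bound on the congestion; `64` exceeds `7.5 ^ 2 + 2 / (log 2) ^ 2`. -/
theorem sq_log_le {n : ℕ} (hn : 2 ≤ n) :
    (((2 * Nat.log 2 n + 3) ^ 2 + 2 : ℕ) : ℝ) ≤ 64 * Real.log n ^ 2 := by
  have h1 := log_two_mul_log_le hn
  have h2 : 0.6931471803 < Real.log 2 := Real.log_two_gt_d9
  have h3 : Real.log 2 ≤ Real.log n := Real.log_le_log (by norm_num) (by exact_mod_cast hn)
  have h0 : (0 : ℝ) ≤ ((2 * Nat.log 2 n + 3 : ℕ) : ℝ) := by positivity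
  have h4 : ((2 * Nat.log 2 n + 3 : ℕ) : ℝ) ^ 2 ≤ (7.5 * Real.log n) ^ 2 := by gcongr
  rw [Nat.cast_add, Nat.cast_pow]
  push_cast at h4 ⊢
  nlinarith

/-- The largest multiplicity `b` that is needed: for small `w` it exceeds the total congestion, for large
`w` it makes the union bound of `exists_coloring` work, for graphs on `n ≤ w` vertices. -/
theorem exists_multiplicity_bound {ε a : ℝ} (hε : 0 < ε) (ha : 0 < a) :
    ∃ b : ℕ, ∀ w n ℓ : ℕ, 2 ≤ n → n ≤ w → 1 ≤ ℓ →
      a * Real.log (w : ℝ) ^ (2 + 2 * ε) * (w : ℝ) ^ ε ≤ (ℓ : ℝ) →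
      (2 * Nat.log 2 n + 3) ^ 2 + 2 ≤ b ∨
      ∃ b₀, b₀ + 2 ≤ b ∧ n ^ 2 * ((2 * Nat.log 2 n + 3) ^ 2) ^ (b₀ + 1) < ℓ ^ b₀ := by
  -- with `M w ^ (ε / 2) ≤ ℓ`, the power `ℓ ^ b₀` exceeds `M ^ b₀` by a factor of at least `w ^ 4`
  obtain ⟨b₀, hb₀⟩ := exists_nat_ge (8 / ε)
  have hb₀' : 8 ≤ ε * b₀ := by rw [div_le_iff₀ hε] at hb₀; linarith
  have hlarge : ∀ᶠ w : ℕ in atTop, 64 ≤ a * (w : ℝ) ^ (ε / 2) ∧ 64 * Real.log w ^ 2 ≤ w ∧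
      3 ≤ w := by
    have t1 : Tendsto (fun w : ℕ => a * (w : ℝ) ^ (ε / 2)) atTop atTop :=
      ((tendsto_rpow_atTop (by positivity)).comp tendsto_natCast_atTop_atTop).const_mul_atTop ha
    have t2 : ∀ᶠ x : ℝ in atTop, 64 * Real.log x ^ 2 ≤ x := by
      have := (Real.isLittleO_pow_log_id_atTop (n := 2)).bound (c := 1 / 64) (by norm_num)
      filter_upwards [this, eventually_ge_atTop (0 : ℝ)] with x hx hx0
      rw [Real.norm_of_nonneg (by positivity), id, Real.norm_of_nonneg hx0] at hx
      linarith
    filter_upwards [t1.eventually_ge_atTop 64, tendsto_natCast_atTop_atTop.eventually t2,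
      eventually_ge_atTop 3] with w h1 h2 h3
    exact ⟨h1, h2, h3⟩
  obtain ⟨w₀, hw₀⟩ := eventually_atTop.mp hlarge
  refine ⟨max ((2 * Nat.log 2 w₀ + 3) ^ 2 + 2) (b₀ + 2), fun w n ℓ hn hnw hℓ hℓa => ?_⟩
  by_cases hw : w₀ ≤ w
  · right
    refine ⟨b₀, le_max_right _ _, ?_⟩
    obtain ⟨h1, h2, h3⟩ := hw₀ w hw
    have hw1 : (1 : ℝ) < w := by exact_mod_cast (by omega : 1 < w)
    have hlog1 : 1 ≤ Real.log w := by
      rw [Real.le_log_iff_exp_le (by linarith)]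
      have := Real.exp_one_lt_d9
      have h3' : (3 : ℝ) ≤ w := by exact_mod_cast h3
      linarith
    set M : ℝ := (((2 * Nat.log 2 n + 3) ^ 2 : ℕ) : ℝ) with hM
    have hM0 : 0 < M := by rw [hM]; positivity
    have hMlog : M ≤ 64 * Real.log w ^ 2 := by
      have h4 := sq_log_le hn
      rw [Nat.cast_add] at h4
      have h5 : Real.log n ≤ Real.log w :=
        Real.log_le_log (by exact_mod_cast (by omega : 0 < n)) (by exact_mod_cast hnw)
      have h6 : 0 ≤ Real.log n := Real.log_natCast_nonneg n
      have h7 : Real.log n ^ 2 ≤ Real.log w ^ 2 := by gcongr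
      push_cast at h4
      rw [hM]; push_cast
      linarith
    -- `M w ^ (ε / 2) ≤ ℓ`
    have hMℓ : M * (w : ℝ) ^ (ε / 2) ≤ ℓ := by
      refine le_trans ?_ hℓa
      have e1 : Real.log (w : ℝ) ^ (2 + 2 * ε) = Real.log w ^ 2 * Real.log w ^ (2 * ε) := by
        rw [Real.rpow_add (by linarith)]; norm_num
      have e2 : (w : ℝ) ^ ε = (w : ℝ) ^ (ε / 2) * (w : ℝ) ^ (ε / 2) := by
        rw [← Real.rpow_add (by linarith)]; ring_nf
      have e3 : 1 ≤ Real.log (w : ℝ) ^ (2 * ε) := Real.one_le_rpow hlog1 (by positivity)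
      rw [e1, e2]
      calc M * (w : ℝ) ^ (ε / 2) ≤ 64 * Real.log w ^ 2 * (w : ℝ) ^ (ε / 2) := by gcongr
        _ ≤ (a * (w : ℝ) ^ (ε / 2)) * Real.log w ^ 2 * (w : ℝ) ^ (ε / 2) := by gcongr
        _ = a * (Real.log w ^ 2 * 1) * ((w : ℝ) ^ (ε / 2) * (w : ℝ) ^ (ε / 2)) := by ring
        _ ≤ _ := by gcongr
    have hpow : M ^ b₀ * (w : ℝ) ^ (4 : ℕ) ≤ (ℓ : ℝ) ^ b₀ := by
      calc M ^ b₀ * (w : ℝ) ^ (4 : ℕ) ≤ M ^ b₀ * ((w : ℝ) ^ (ε / 2)) ^ b₀ := by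
            gcongr
            rw [← Real.rpow_natCast, ← Real.rpow_natCast, ← Real.rpow_mul (by linarith)]
            refine Real.rpow_le_rpow_of_exponent_le hw1.le ?_
            push_cast
            linarith
        _ = (M * (w : ℝ) ^ (ε / 2)) ^ b₀ := by rw [mul_pow]
        _ ≤ _ := by gcongr
    have hMw : M ≤ w := hMlog.trans h2
    have hfin : (n : ℝ) ^ 2 * M ^ (b₀ + 1) < (ℓ : ℝ) ^ b₀ := by
      refine lt_of_lt_of_le ?_ hpow
      have hnw' : (n : ℝ) ≤ w := by exact_mod_cast hnw
      calc (n : ℝ) ^ 2 * M ^ (b₀ + 1) ≤ (w : ℝ) ^ 2 * (M ^ b₀ * w) := by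
            rw [pow_succ M]; gcongr
        _ = M ^ b₀ * (w : ℝ) ^ 3 := by ring
        _ < M ^ b₀ * (w : ℝ) ^ 4 := by
            have : (w : ℝ) ^ 3 < (w : ℝ) ^ 4 := pow_lt_pow_right₀ hw1 (by norm_num)
            have : 0 < M ^ b₀ := by positivity
            gcongr
    rw [hM] at hfin
    exact_mod_cast hfin
  · left
    refine le_trans ?_ (le_max_left _ _)
    have : Nat.log 2 n ≤ Nat.log 2 w₀ := Nat.log_mono_right (by omega)
    gcongr

end Numerics

/-! ### Existence of cycle bases and heights -/

namespace ConeInput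

section Existence

variable {X Q Z : Type*} [Fintype X] [Fintype Q] {A : CSSCode X Q Z} (D : ConeInput A)

theorem adj_edgeSrc_edgeTgt (i : Fin D.m) (e : D.Edge i) :
    (D.graph i).Adj (D.edgeSrc i e) (D.edgeTgt i e) := by
  rw [graph, SimpleGraph.fromRel_adj]
  exact ⟨D.edgeSrc_ne_edgeTgt i e, Or.inl ⟨e, D.edge_eq i e⟩⟩

/-- The connected component in which an edge lies. -/
noncomputable def edgeComp (i : Fin D.m) (e : D.Edge i) : D.Comp i :=
  (D.graph i).connectedComponentMk (D.edgeSrc i e)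

theorem edgeComp_eq_tgt (i : Fin D.m) (e : D.Edge i) :
    (D.graph i).connectedComponentMk (D.edgeTgt i e) = D.edgeComp i e :=
  (SimpleGraph.ConnectedComponent.sound (D.adj_edgeSrc_edgeTgt i e).reachable).symm

open scoped Classical in
/-- The vertices of a connected component. -/
noncomputable def compVerts (i : Fin D.m) (c : D.Comp i) : Finset (D.Vert i) :=
  Finset.univ.filter fun v => (D.graph i).connectedComponentMk v = c

open scoped Classical in
/-- The edges of a connected component. -/
noncomputable def compEdges (i : Fin D.m) (c : D.Comp i) : Finset (D.Edge i) :=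
  Finset.univ.filter fun e => D.edgeComp i e = c

theorem mem_compEdges {i : Fin D.m} {c : D.Comp i} {e : D.Edge i} :
    e ∈ D.compEdges i c ↔ D.edgeComp i e = c := by
  simp [compEdges]

theorem ends_mem_compVerts {i : Fin D.m} {c : D.Comp i} {e : D.Edge i} (he : e ∈ D.compEdges i c) :
    D.edgeSrc i e ∈ D.compVerts i c ∧ D.edgeTgt i e ∈ D.compVerts i c := by
  rw [mem_compEdges] at he
  simp only [compVerts, Finset.mem_filter, Finset.mem_univ, true_and]
  exact ⟨he, (D.edgeComp_eq_tgt i e).trans he⟩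

theorem two_le_card_compVerts {i : Fin D.m} {c : D.Comp i} {e : D.Edge i}
    (he : e ∈ D.compEdges i c) : 2 ≤ (D.compVerts i c).card := by
  obtain ⟨h1, h2⟩ := D.ends_mem_compVerts he
  exact Finset.one_lt_card.mpr ⟨_, h1, _, h2, D.edgeSrc_ne_edgeTgt i e⟩

theorem card_compVerts_le (i : Fin D.m) (c : D.Comp i) :
    (D.compVerts i c).card ≤ (D.Qset i).card := by
  rw [← Fintype.card_coe (D.Qset i)]
  exact Finset.card_le_univ _

open scoped Classical in
theorem f1_mul_compInd_apply (q : Q) (i : Fin D.m) (c : D.Comp i) :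
    (D.f1 * D.compInd) q ⟨i, c⟩ =
      if ∃ h : q ∈ D.Qset i, (D.graph i).connectedComponentMk ⟨q, h⟩ = c then 1 else 0 := by
  have h0 : (D.f1 * D.compInd) q ⟨i, c⟩ = ∑ v : D.Vert i,
      (if q = (v : Q) then (1 : ZMod 2) else 0) *
        if (D.graph i).connectedComponentMk v = c then 1 else 0 := by
    rw [Matrix.mul_apply, Fintype.sum_sigma, Finset.sum_eq_single i]
    · simp [f1, compInd]
    · intro j _ hj
      refine Finset.sum_eq_zero fun v _ => ?_
      rw [compInd, Matrix.blockDiagonal'_apply_ne _ _ _ hj, mul_zero]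
    · simp
  rw [h0]
  by_cases hq : q ∈ D.Qset i
  · rw [Finset.sum_eq_single ⟨q, hq⟩]
    · simp [hq]
    · rintro v - hv
      rw [if_neg fun h => hv (Subtype.ext h.symm), zero_mul]
    · simp
  · rw [if_neg fun ⟨h, _⟩ => hq h]
    refine Finset.sum_eq_zero fun v _ => ?_
    rw [if_neg fun h => hq (by rw [h]; exact v.2), zero_mul]

/-- The vertices of a component are the support of an induced `Z`-stabilizer. -/
theorem card_compVerts_le_wZ [Fintype Z] (i : Fin D.m) (c : D.Comp i) :
    (D.compVerts i c).card ≤ D.inducedCode.wZ := by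
  classical
  refine le_trans ?_ (Finset.le_sup (Finset.mem_univ (Sum.inr ⟨i, c⟩ : Z ⊕ Σ i, D.Comp i)))
  refine Finset.card_le_card_of_injOn Subtype.val (fun v hv => ?_) Subtype.val_injective.injOn
  have hv' : (D.graph i).connectedComponentMk v = c := by simpa [compVerts] using hv
  simp only [inducedCode, Matrix.fromCols_apply_inr, f1_mul_compInd_apply, Finset.coe_filter,
    Finset.mem_univ, true_and, Set.mem_ofPred_eq]
  rw [if_pos ⟨v.2, hv'⟩]
  exact one_ne_zero

variable {D}

open scoped Classical in
/-- For a component: simple cycles that span its cycle space, with low congestion, and heights for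
them with low multiplicity. The cycles of length `2` made of parallel edges may have any height. -/
theorem exists_component_cycles (i : Fin D.m) (c : D.Comp i) {b ℓ : ℕ} (hℓ : 1 ≤ ℓ)
    (hb : 2 ≤ (D.compVerts i c).card → (2 * Nat.log 2 (D.compVerts i c).card + 3) ^ 2 + 2 ≤ b ∨
      ∃ b₀, b₀ + 2 ≤ b ∧ (D.compVerts i c).card ^ 2 *
        ((2 * Nat.log 2 (D.compVerts i c).card + 3) ^ 2) ^ (b₀ + 1) < ℓ ^ b₀) :
    ∃ (κ : Type) (_ : Fintype κ) (γ : κ → D.SimpleCycle i) (h : κ → Fin ℓ),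
      cyclesIn (D.edgeSrc i) (D.edgeTgt i) (D.compEdges i c) ≤
        Submodule.span (ZMod 2) (Set.range fun k => (γ k).chain) ∧
      (∀ e ∉ D.compEdges i c, ∀ k, (γ k).chain e = 0) ∧
      (∀ e, chainCongestion (fun k => (γ k).chain) e ≤
        (2 * Nat.log 2 (D.compVerts i c).card + 3) ^ 2 + 2) ∧
      ∀ e ∈ D.compEdges i c, ∀ a,
        (Finset.univ.filter fun k => (γ k).chain e ≠ 0 ∧ h k = a).card ≤ b := by
  have hcard : ∀ {κ : Type} [Fintype κ] (g : κ → D.Edge i → ZMod 2) (e : D.Edge i),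
      (Finset.univ.filter fun k => g k e ≠ 0).card = chainCongestion g e := fun g e => by
    rw [chainCongestion, Finset.card_filter]
  have hcong0 : ∀ {κ : Type} [Fintype κ] (g : κ → D.Edge i → ZMod 2) (e : D.Edge i),
      chainCongestion g e = 0 → ∀ k, g k e = 0 := fun g e h k => by
    by_contra hk
    have := Finset.sum_eq_zero_iff.mp h k (Finset.mem_univ k)
    rw [if_pos hk] at this
    exact one_ne_zero this
  obtain ⟨ι₁, _, p, R, hRF, hp, hinj, h2, -, hred⟩ :=
    exists_parallel_reduction (D.edgeSrc i) (D.edgeTgt i) (D.compEdges i c)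
  obtain ⟨hRcard, ι₂, _, g, hg, hgspan, hgcong⟩ := exists_spanning_of_no_parallel
    (fun e he => D.ends_mem_compVerts (hRF he)) hinj
  obtain ⟨κ₁, _, γ₁, hspan₁, hcong₁⟩ := exists_simpleCycles_of_family
    (fun j => pairChain (p j) : ι₁ → D.Edge i → ZMod 2) fun j => by
      rw [bdry_transpose_mulVec, edgeBoundary_pairChain (hp j).2.2]
  obtain ⟨κ₂, _, γ₂, hspan₂, hcong₂⟩ := exists_simpleCycles_of_family g fun j => by
      rw [bdry_transpose_mulVec, (mem_cyclesIn.mp (hg j)).1]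
  have hpc : ∀ e, chainCongestion (fun j => pairChain (p j)) e ≤
      ∑ j, if e = (p j).1 ∨ e = (p j).2 then 1 else 0 := fun e => by
    refine Finset.sum_le_sum fun j _ => ?_
    by_cases h : e = (p j).1 ∨ e = (p j).2
    · rw [if_pos h]; split_ifs <;> simp
    · rw [not_or] at h
      simp [pairChain, h.1, h.2]
  have hc1 : ∀ e, chainCongestion (fun k => (γ₁ k).chain) e ≤ 2 := fun e =>
    (hcong₁ e).trans ((hpc e).trans (h2 e))
  have hc2 : ∀ e, chainCongestion (fun k => (γ₂ k).chain) e ≤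
      (2 * Nat.log 2 (D.compVerts i c).card + 3) ^ 2 := fun e => (hcong₂ e).trans (hgcong e)
  have hz1 : ∀ e ∉ D.compEdges i c, ∀ k, (γ₁ k).chain e = 0 := fun e he => by
    refine hcong0 (fun k => (γ₁ k).chain) e (Nat.le_zero.mp ((hcong₁ e).trans ((hpc e).trans ?_)))
    refine le_of_eq (Finset.sum_eq_zero fun j _ => if_neg ?_)
    rintro (h | h)
    · exact he (h ▸ (hp j).1)
    · exact he (h ▸ (hp j).2.1)
  have hz2 : ∀ e ∉ R, ∀ k, (γ₂ k).chain e = 0 := fun e he => by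
    refine hcong0 (fun k => (γ₂ k).chain) e (Nat.le_zero.mp ((hcong₂ e).trans (le_of_eq ?_)))
    exact chainCongestion_eq_zero fun j => (mem_cyclesIn.mp (hg j)).2 e he
  obtain ⟨h₂, hh₂⟩ : ∃ h₂ : κ₂ → Fin ℓ, ∀ e ∈ D.compEdges i c, ∀ a,
      (Finset.univ.filter fun k => (γ₂ k).chain e ≠ 0 ∧ h₂ k = a).card + 2 ≤ b := by
    by_cases hn : 2 ≤ (D.compVerts i c).card
    · rcases hb hn with hb | ⟨b₀, hb₀, hlt⟩
      · refine ⟨fun _ => ⟨0, hℓ⟩, fun e _ a => le_trans ?_ hb⟩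
        gcongr
        refine le_trans (Finset.card_le_card ?_) ((hcard _ _).trans_le (hc2 e))
        exact Finset.monotone_filter_right _ fun k _ hk => hk.1
      · obtain ⟨h₂, hh₂⟩ := exists_coloring R (fun k e => (γ₂ k).chain e ≠ 0)
          ((2 * Nat.log 2 (D.compVerts i c).card + 3) ^ 2) b₀ ℓ
          (fun e _ => by convert (hcard _ _).trans_le (hc2 e)) (lt_of_le_of_lt (by gcongr) hlt) hℓ
        refine ⟨h₂, fun e _ a => le_trans ?_ hb₀⟩
        gcongr
        by_cases heR : e ∈ R
        · exact (le_of_eq (by congr)).trans (hh₂ e heR a)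
        · simp [hz2 e heR]
    · exact ⟨fun _ => ⟨0, hℓ⟩, fun e he => absurd (D.two_le_card_compVerts he) hn⟩
  refine ⟨κ₁ ⊕ κ₂, inferInstance, Sum.elim γ₁ γ₂, Sum.elim (fun _ => ⟨0, hℓ⟩) h₂, ?_, ?_, ?_, ?_⟩
  · have hle₁ : Submodule.span (ZMod 2) (Set.range fun k => (γ₁ k).chain) ≤
        Submodule.span (ZMod 2) (Set.range fun k => (Sum.elim γ₁ γ₂ k).chain) := by
      refine Submodule.span_mono ?_
      rintro _ ⟨k, rfl⟩
      exact ⟨Sum.inl k, rfl⟩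
    have hle₂ : Submodule.span (ZMod 2) (Set.range fun k => (γ₂ k).chain) ≤
        Submodule.span (ZMod 2) (Set.range fun k => (Sum.elim γ₁ γ₂ k).chain) := by
      refine Submodule.span_mono ?_
      rintro _ ⟨k, rfl⟩
      exact ⟨Sum.inr k, rfl⟩
    intro z hz
    obtain ⟨hzb, hzF⟩ := mem_cyclesIn.mp hz
    obtain ⟨y, hy, hyR⟩ := hred z hzF
    have hyb : edgeBoundary (D.edgeSrc i) (D.edgeTgt i) y = 0 := by
      have : Submodule.span (ZMod 2) (Set.range fun j => pairChain (p j)) ≤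
          LinearMap.ker (edgeBoundary (D.edgeSrc i) (D.edgeTgt i)) := by
        rw [Submodule.span_le]
        rintro _ ⟨j, rfl⟩
        exact edgeBoundary_pairChain (hp j).2.2
      exact this hy
    have hyspan : y ∈ Submodule.span (ZMod 2) (Set.range fun k => (γ₁ k).chain) := by
      refine Submodule.span_le.mpr ?_ hy
      rintro _ ⟨j, rfl⟩
      exact hspan₁ j
    have hzy : z - y ∈ Submodule.span (ZMod 2) (Set.range fun k => (γ₂ k).chain) := by
      have : z - y ∈ cyclesIn (D.edgeSrc i) (D.edgeTgt i) R :=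
        mem_cyclesIn.mpr ⟨by rw [map_sub, hzb, hyb, sub_zero], hyR⟩
      refine Submodule.span_le.mpr ?_ (hgspan this)
      rintro _ ⟨j, rfl⟩
      exact hspan₂ j
    simpa using Submodule.add_mem _ (hle₂ hzy) (hle₁ hyspan)
  · rintro e he (k | k)
    · exact hz1 e he k
    · exact hz2 e (fun h => he (hRF h)) k
  · intro e
    have : chainCongestion (fun k => (Sum.elim γ₁ γ₂ k).chain) e =
        chainCongestion (fun k => (γ₁ k).chain) e + chainCongestion (fun k => (γ₂ k).chain) e := by
      rw [chainCongestion, Fintype.sum_sum_type]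
      rfl
    rw [this]
    have := hc1 e
    have := hc2 e
    omega
  · intro e he a
    refine le_trans ?_ (hh₂ e he a)
    rw [Finset.card_filter, Fintype.sum_sum_type, add_comm]
    refine add_le_add (le_of_eq (Finset.card_filter _ _).symm) ?_
    rw [← Finset.card_filter]
    refine le_trans (Finset.card_le_card ?_) ((hcard _ _).trans_le (hc1 e))
    exact Finset.monotone_filter_right _ fun k _ hk => hk.1

open scoped Classical in
theorem cyclesIn_univ_le_iSup_compEdges (i : Fin D.m) :
    cyclesIn (D.edgeSrc i) (D.edgeTgt i) Finset.univ ≤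
      ⨆ c, cyclesIn (D.edgeSrc i) (D.edgeTgt i) (D.compEdges i c) := by
  intro z hz
  have hzb := (mem_cyclesIn.mp hz).1
  have hsum : z = ∑ c, fun e => if D.edgeComp i e = c then z e else 0 := by
    funext e
    simp [Finset.sum_apply]
  rw [hsum]
  refine Submodule.sum_mem _ fun c _ => Submodule.mem_iSup_of_mem c (mem_cyclesIn.mpr
    ⟨funext fun v => ?_, fun e he => if_neg fun h => he (D.mem_compEdges.mpr h)⟩)
  have hv := congrFun hzb v
  rw [edgeBoundary_apply] at hv ⊢
  by_cases hvc : (D.graph i).connectedComponentMk v = c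
  · refine Eq.trans (Finset.sum_congr rfl fun e _ => ?_) hv
    by_cases hec : D.edgeComp i e = c
    · rw [if_pos hec]
    · have h1 : D.edgeSrc i e ≠ v := fun h => hec (by rw [edgeComp, h, hvc])
      have h2 : D.edgeTgt i e ≠ v := fun h => hec (by rw [← edgeComp_eq_tgt, h, hvc])
      simp [h1, h2]
  · refine Finset.sum_eq_zero fun e _ => ?_
    by_cases hec : D.edgeComp i e = c
    · have h1 : D.edgeSrc i e ≠ v := fun h => hvc (by rw [← hec, edgeComp, h])
      have h2 : D.edgeTgt i e ≠ v := fun h => hvc (by rw [← hec, ← edgeComp_eq_tgt, h])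
      simp [h1, h2]
    · rw [if_neg hec, zero_mul]

open scoped Classical in
/-- A cycle basis of `Gᵢ` with heights, assembled from its components. -/
theorem exists_cycle_basis_with_heights (i : Fin D.m) {b ℓ : ℕ} (hℓ : 1 ≤ ℓ)
    (hb : ∀ c : D.Comp i,
      2 ≤ (D.compVerts i c).card → (2 * Nat.log 2 (D.compVerts i c).card + 3) ^ 2 + 2 ≤ b ∨
      ∃ b₀, b₀ + 2 ≤ b ∧ (D.compVerts i c).card ^ 2 *
        ((2 * Nat.log 2 (D.compVerts i c).card + 3) ^ 2) ^ (b₀ + 1) < ℓ ^ b₀) :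
    ∃ (n : ℕ) (cyc : Fin n → D.SimpleCycle i) (h : Fin n → Fin ℓ),
      LinearIndependent (ZMod 2) (fun c => (cyc c).chain) ∧
      Submodule.span (ZMod 2) (Set.range fun c => (cyc c).chain) =
        LinearMap.ker (D.bdry i).transpose.mulVecLin ∧
      (∀ e, (Set.ncard {c | ∃ t, (cyc c).edge t = e} : ℝ) ≤
        64 * Real.log ((D.Qset i).card : ℝ) ^ 2) ∧
      ∀ e a, Set.ncard {c | (∃ t, (cyc c).edge t = e) ∧ h c = a} ≤ b := by
  choose κ hκ γ h hspan hsupp hcong hmult using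
    fun c : D.Comp i => exists_component_cycles i c hℓ (hb c)
  let Γ : (Σ c, κ c) → D.SimpleCycle i := fun k => γ k.1 k.2
  obtain ⟨ι, α, hα, hαspan, hαind⟩ :=
    exists_linearIndependent' (ZMod 2) fun k => (Γ k).chain
  have : Finite ι := Finite.of_injective α hα
  let _ := Fintype.ofFinite ι
  let eqv := Fintype.equivFin ι
  let β : Fin (Fintype.card ι) → Σ c, κ c := fun c => α (eqv.symm c)
  have hβ : Function.Injective β := hα.comp eqv.symm.injective
  -- an edge is used by cycles of its own component only
  have hcount : ∀ (P : (Σ c, κ c) → Prop) (e : D.Edge i),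
      Set.ncard {c | (∃ t, (Γ (β c)).edge t = e) ∧ P (β c)} ≤
        (Finset.univ.filter fun k => (γ (D.edgeComp i e) k).chain e ≠ 0 ∧
          P ⟨D.edgeComp i e, k⟩).card := by
    intro P e
    rw [← Set.ncard_coe_finset, ← Set.ncard_image_of_injective _ hβ,
      ← Set.ncard_image_of_injective (f := fun k => (⟨D.edgeComp i e, k⟩ : Σ c, κ c)) _
        sigma_mk_injective]
    refine Set.ncard_le_ncard ?_ (Set.toFinite _)
    rintro _ ⟨c, ⟨hce, hcP⟩, rfl⟩
    have hne : (Γ (β c)).chain e ≠ 0 := ((Γ (β c)).chain_ne_zero_iff e).mpr hce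
    generalize β c = k at hne hcP
    obtain ⟨c', k⟩ := k
    have hcc : D.edgeComp i e = c' := by
      by_contra hcc
      exact hne (hsupp c' e (fun h' => hcc (D.mem_compEdges.mp h')) k)
    subst hcc
    exact ⟨k, by simpa using ⟨hne, hcP⟩, rfl⟩
  refine ⟨Fintype.card ι, fun c => Γ (β c), fun c => h (β c).1 (β c).2, ?_, ?_, ?_, ?_⟩
  · exact hαind.comp _ eqv.symm.injective
  · have h1 : (Set.range fun c => (Γ (β c)).chain) = Set.range ((fun k => (Γ k).chain) ∘ α) :=
      eqv.symm.surjective.range_comp ((fun k => (Γ k).chain) ∘ α)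
    rw [h1, hαspan, ker_bdry_transpose]
    apply le_antisymm
    · rw [Submodule.span_le]
      rintro _ ⟨k, rfl⟩
      exact mem_cyclesIn.mpr ⟨(Γ k).edgeBoundary_chain, by simp⟩
    · refine (cyclesIn_univ_le_iSup_compEdges i).trans (iSup_le fun c => (hspan c).trans ?_)
      refine Submodule.span_mono ?_
      rintro _ ⟨k, rfl⟩
      exact ⟨⟨c, k⟩, rfl⟩
  · intro e
    have h1 := hcount (fun _ => True) e
    simp only [and_true] at h1
    have he : e ∈ D.compEdges i (D.edgeComp i e) := D.mem_compEdges.mpr rfl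
    have h2 := D.two_le_card_compVerts he
    have h3 : (Finset.univ.filter fun k => (γ (D.edgeComp i e) k).chain e ≠ 0).card =
        chainCongestion (fun k => (γ (D.edgeComp i e) k).chain) e := by
      rw [chainCongestion, Finset.card_filter]
    have h4 := (h1.trans_eq h3).trans (hcong (D.edgeComp i e) e)
    calc (Set.ncard {c | ∃ t, (Γ (β c)).edge t = e} : ℝ)
        ≤ (((2 * Nat.log 2 (D.compVerts i (D.edgeComp i e)).card + 3) ^ 2 + 2 : ℕ) : ℝ) := by
          exact_mod_cast h4
      _ ≤ 64 * Real.log ((D.compVerts i (D.edgeComp i e)).card : ℝ) ^ 2 := sq_log_le h2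
      _ ≤ _ := by
          have h5 := D.card_compVerts_le i (D.edgeComp i e)
          have h6 : Real.log ((D.compVerts i (D.edgeComp i e)).card : ℝ) ≤
              Real.log ((D.Qset i).card : ℝ) :=
            Real.log_le_log (by exact_mod_cast (by omega)) (by exact_mod_cast h5)
          have h7 := Real.log_natCast_nonneg (D.compVerts i (D.edgeComp i e)).card
          gcongr
  · intro e a
    refine (hcount (fun k => h k.1 k.2 = a) e).trans ?_
    exact (le_of_eq (by congr)).trans (hmult _ e (D.mem_compEdges.mpr rfl) a)

theorem exists_cycleBasis_heights [Fintype Z] {b ℓ : ℕ} (hℓ : 1 ≤ ℓ)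
    (hb : ∀ n, 2 ≤ n → n ≤ D.inducedCode.wZ → (2 * Nat.log 2 n + 3) ^ 2 + 2 ≤ b ∨
      ∃ b₀, b₀ + 2 ≤ b ∧ n ^ 2 * ((2 * Nat.log 2 n + 3) ^ 2) ^ (b₀ + 1) < ℓ ^ b₀) :
    ∃ (B : D.CycleBasis) (h : X ⊕ B.Cyc → Fin ℓ),
      (∀ i e, (B.congestion i e : ℝ) ≤ 64 * Real.log ((D.Qset i).card : ℝ) ^ 2) ∧
      (∀ i e k, B.multiplicity h i e k ≤ b) := by
  choose n cyc h hind hspan hcong hmult using fun i => exists_cycle_basis_with_heights (D := D) i hℓ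
    fun c hc => hb _ hc (D.card_compVerts_le_wZ i c)
  exact ⟨⟨n, cyc, hind, hspan⟩, Sum.elim (fun _ => ⟨0, hℓ⟩) fun c => h c.1 c.2, hcong, hmult⟩

end Existence

end ConeInput

/-! ### The operators of the reduced cone code -/

section LinearAlgebra

theorem Matrix.mem_range_mulVecLin_iff {m n K : Type*} [Fintype m] [Fintype n] [Field K]
    (M : Matrix m n K) (x : m → K) :
    x ∈ LinearMap.range M.mulVecLin ↔ ∀ y, M.transpose.mulVec y = 0 → y ⬝ᵥ x = 0 := by
  classical
  constructor
  · rintro ⟨a, rfl⟩ y hy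
    rw [Matrix.mulVecLin_apply, Matrix.dotProduct_mulVec, ← Matrix.mulVec_transpose, hy,
      zero_dotProduct]
  · intro h
    by_contra hx
    obtain ⟨f, hfx, hf⟩ := Submodule.exists_le_ker_of_notMem hx
    have hdot : ∀ w, f w = (fun j => f (Pi.single j 1)) ⬝ᵥ w := by
      intro w
      conv_lhs => rw [← Finset.univ_sum_single w, map_sum]
      refine Finset.sum_congr rfl fun j _ => ?_
      have : (Pi.single j (w j) : m → K) = w j • Pi.single j 1 := by
        rw [← Pi.single_smul, smul_eq_mul, mul_one]
      rw [this, map_smul, smul_eq_mul, mul_comm]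
    refine hfx ?_
    rw [hdot]
    refine h _ (funext fun j => ?_)
    have h1 : f (M.mulVecLin (Pi.single j 1)) = 0 := hf ⟨_, rfl⟩
    rw [hdot] at h1
    rw [Matrix.mulVecLin_apply, Matrix.dotProduct_mulVec, ← Matrix.mulVec_transpose] at h1
    simpa using h1

theorem Matrix.blockDiagonal'_mulVec {o R : Type*} [Fintype o] [DecidableEq o] {m n : o → Type*}
    [∀ i, Fintype (n i)] [NonUnitalNonAssocSemiring R] (M : ∀ i, Matrix (m i) (n i) R)
    (v : (Σ i, n i) → R) (i : o) (x : m i) :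
    (Matrix.blockDiagonal' M).mulVec v ⟨i, x⟩ = (M i).mulVec (fun y => v ⟨i, y⟩) x := by
  rw [Matrix.mulVec, dotProduct, Fintype.sum_sigma, Finset.sum_eq_single i]
  · simp [Matrix.mulVec, dotProduct]
  · intro j _ hj
    refine Finset.sum_eq_zero fun y _ => ?_
    rw [Matrix.blockDiagonal'_apply_ne _ _ _ hj.symm, zero_mul]
  · simp

end LinearAlgebra

/-- The lower end point of a segment of the interval with `ℓ` points. -/
def segLo {ℓ : ℕ} (j : Fin (ℓ - 1)) : Fin ℓ := ⟨j, by omega⟩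

/-- The upper end point of a segment of the interval with `ℓ` points. -/
def segHi {ℓ : ℕ} (j : Fin (ℓ - 1)) : Fin ℓ := ⟨j + 1, by omega⟩

theorem sum_intervalBoundary_mul {ℓ : ℕ} (j : Fin (ℓ - 1)) (g : Fin ℓ → ZMod 2) :
    ∑ k, intervalBoundary ℓ k j * g k = g (segLo j) + g (segHi j) := by
  have : ∀ k : Fin ℓ, intervalBoundary ℓ k j * g k =
      (if k = segLo j then g k else 0) + if k = segHi j then g k else 0 := by
    intro k
    simp only [intervalBoundary, Matrix.of_apply, segLo, segHi, Fin.ext_iff]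
    by_cases h1 : (k : ℕ) = j
    · have h2 : ¬ (k : ℕ) = j + 1 := by omega
      simp [h1]
    · by_cases h2 : (k : ℕ) = j + 1 <;> simp [h1, h2]
  simp [this, Finset.sum_add_distrib]

/-- A function on the points of the interval that does not change along segments is constant. -/
theorem eq_of_segLo_eq_segHi {ℓ : ℕ} {α : Type*} {g : Fin ℓ → α}
    (hg : ∀ j, g (segLo j) = g (segHi j)) (k k' : Fin ℓ) : g k = g k' := by
  have h0 : ∀ n (hn : n < ℓ), g ⟨n, hn⟩ = g ⟨0, by omega⟩ := by
    intro n
    induction n with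
    | zero => intro _; rfl
    | succ n ih =>
      intro hn
      rw [← ih (by omega)]
      exact (hg ⟨n, by omega⟩).symm
  exact (h0 k k.2).trans (h0 k' k'.2).symm

namespace ConeInput

namespace CycleBasis

variable {X Q Z : Type*} [Fintype X] [Fintype Q] [Fintype Z] {A : CSSCode X Q Z} {D : ConeInput A}
  (B : CycleBasis D) {ℓ : ℕ} (h : X ⊕ B.Cyc → Fin ℓ)

/-- The chains of qubits of the reduced cone code. -/
abbrev RChain (ℓ : ℕ) : Type _ :=
  (((Q ⊕ Σ i, D.Edge i) × Fin ℓ ⊕ (Z ⊕ Σ i, D.Vert i) × Fin (ℓ - 1)) ⊕ B.Chord) → ZMod 2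

variable {B}

/-- The part of a chain of the reduced cone code at the height `k`, a `1`-chain of the cone code. -/
def slice (u : B.RChain ℓ) (k : Fin ℓ) : (Q ⊕ Σ i, D.Edge i) → ZMod 2 :=
  fun y => u (.inl (.inl (y, k)))

/-- The part of a chain of the reduced cone code on the segment `j`, a `2`-chain of the cone code. -/
def segs (u : B.RChain ℓ) (j : Fin (ℓ - 1)) : (Z ⊕ Σ i, D.Vert i) → ZMod 2 :=
  fun z => u (.inl (.inr (z, j)))

theorem rchain_ext {u u' : B.RChain ℓ} (h1 : ∀ k, slice u k = slice u' k)
    (h2 : ∀ j, segs u j = segs u' j) (h3 : ∀ s, u (.inr s) = u' (.inr s)) : u = u' := by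
  funext q
  rcases q with (⟨y, k⟩ | ⟨z, j⟩) | s
  · exact congrFun (h1 k) y
  · exact congrFun (h2 j) z
  · exact h3 s

theorem reducedD1_mulVec_stab (u : B.RChain ℓ) (x : X) :
    (B.reducedD1 ℓ h).mulVec u (.inl (.inl x)) =
      B.coneCode.d1.mulVec (slice u (h (.inl x))) (.inl x) := by
  classical
  rw [Matrix.mulVec, dotProduct, Fintype.sum_sum_type]
  simp only [reducedD1, Matrix.of_apply, zero_mul, Finset.sum_const_zero, add_zero,
    CSSCode.thicken, CSSCode.thickenD1, Fintype.sum_sum_type (α₁ := (_ × _)),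
    Fintype.sum_prod_type, ite_mul, Finset.sum_ite_eq', Finset.mem_univ, if_true]
  rfl

open scoped Classical in
theorem reducedD1_mulVec_face (u : B.RChain ℓ) (φ : B.Face) :
    (B.reducedD1 ℓ h).mulVec u (.inl (.inr φ)) =
      (∑ e, if B.faceEdge φ e then slice u (h (.inr φ.1)) (.inr e) else 0) +
      ∑ s : Fin (((B.get φ.1).len - 1) / 2),
        if (s : ℕ) = φ.2 ∨ (s : ℕ) + 1 = φ.2 then u (.inr ⟨φ.1, s⟩) else 0 := by
  rw [Matrix.mulVec, dotProduct, Fintype.sum_sum_type]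
  congr 1
  · simp only [reducedD1, Matrix.of_apply, Fintype.sum_sum_type, Fintype.sum_prod_type, zero_mul,
      Finset.sum_const_zero, zero_add, add_zero, ite_mul, one_mul]
    refine Finset.sum_congr rfl fun e _ => ?_
    rw [Finset.sum_eq_single (h (.inr φ.1))]
    · simp [slice]
    · intro k _ hk; simp [hk]
    · simp
  · rw [Fintype.sum_sigma, Finset.sum_eq_single φ.1]
    · refine Finset.sum_congr rfl fun s _ => ?_
      simp [reducedD1, faceChord]
    · intro c _ hc
      refine Finset.sum_eq_zero fun s _ => ?_
      simp [reducedD1, faceChord, hc.symm]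
    · simp

theorem reducedD1_mulVec_seg (u : B.RChain ℓ) (y : Q ⊕ Σ i, D.Edge i) (j : Fin (ℓ - 1)) :
    (B.reducedD1 ℓ h).mulVec u (.inr (y, j)) =
      slice u (segLo j) y + slice u (segHi j) y + B.coneCode.d2.mulVec (segs u j) y := by
  classical
  rw [Matrix.mulVec, dotProduct, Fintype.sum_sum_type]
  simp only [reducedD1, Matrix.of_apply, zero_mul, Finset.sum_const_zero, add_zero,
    CSSCode.thicken, CSSCode.thickenD1]
  rw [Fintype.sum_sum_type, Fintype.sum_prod_type, Fintype.sum_prod_type]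
  congr 1
  · rw [Finset.sum_eq_single y, ← sum_intervalBoundary_mul j (fun k => slice u k y)]
    · simp [slice]
    · intro y' _ hy
      simp [hy.symm]
    · simp
  · refine Finset.sum_congr rfl fun z _ => ?_
    rw [Finset.sum_eq_single j]
    · simp [segs]
    · intro j' _ hj
      simp [hj.symm]
    · simp

theorem slice_reducedD2_mulVec (a : (Z ⊕ Σ i, D.Vert i) × Fin ℓ → ZMod 2) (k : Fin ℓ) :
    slice ((B.reducedD2 ℓ h).mulVec a) k = B.coneCode.d2.mulVec fun z => a (z, k) := by
  classical
  funext y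
  simp only [slice, Matrix.mulVec, dotProduct, reducedD2, Matrix.of_apply, thicken_d2_inl,
    Fintype.sum_prod_type, ite_mul, zero_mul, Finset.sum_ite_eq, Finset.mem_univ, if_true]

theorem segs_reducedD2_mulVec (a : (Z ⊕ Σ i, D.Vert i) × Fin ℓ → ZMod 2) (j : Fin (ℓ - 1)) :
    segs ((B.reducedD2 ℓ h).mulVec a) j = fun z => a (z, segLo j) + a (z, segHi j) := by
  classical
  funext z
  simp only [segs, Matrix.mulVec, dotProduct, reducedD2, Matrix.of_apply, CSSCode.thicken,
    CSSCode.thickenD2, Fintype.sum_prod_type]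
  rw [Finset.sum_eq_single z, ← sum_intervalBoundary_mul j fun k => a (z, k)]
  · simp
  · intro z' _ hz
    simp [hz.symm]
  · simp

open scoped Classical in
theorem reducedD2_mulVec_chord (a : (Z ⊕ Σ i, D.Vert i) × Fin ℓ → ZMod 2) (s : B.Chord) :
    (B.reducedD2 ℓ h).mulVec a (.inr s) =
      ∑ v, if B.chordVert s v then a (.inr v, h (.inr s.1)) else 0 := by
  simp only [Matrix.mulVec, dotProduct, reducedD2, Matrix.of_apply, Fintype.sum_prod_type,
    Fintype.sum_sum_type, zero_mul, Finset.sum_const_zero, zero_add, ite_mul, one_mul]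
  refine Finset.sum_congr rfl fun v _ => ?_
  rw [Finset.sum_eq_single (h (.inr s.1))]
  · simp
  · intro k _ hk; simp [hk]
  · simp

theorem coneCode_d2_mulVec_inl (a : (Z ⊕ Σ i, D.Vert i) → ZMod 2) (q : Q) :
    B.coneCode.d2.mulVec a (.inl q) =
      A.d2.mulVec (a ∘ .inl) q + D.f1.mulVec (a ∘ .inr) q := by
  rw [coneCode, Matrix.fromBlocks_mulVec]; rfl

theorem coneCode_d2_mulVec_inr (a : (Z ⊕ Σ i, D.Vert i) → ZMod 2) (e : Σ i, D.Edge i) :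
    B.coneCode.d2.mulVec a (.inr e) = D.bdrySum.mulVec (a ∘ .inr) e := by
  rw [coneCode, Matrix.fromBlocks_mulVec]; simp

theorem coneCode_d1_mulVec_inl (u : (Q ⊕ Σ i, D.Edge i) → ZMod 2) (x : X) :
    B.coneCode.d1.mulVec u (.inl x) = A.d1.mulVec (u ∘ .inl) x + D.f0.mulVec (u ∘ .inr) x := by
  rw [coneCode, Matrix.fromBlocks_mulVec]; rfl

theorem coneCode_d1_mulVec_inr (u : (Q ⊕ Σ i, D.Edge i) → ZMod 2) (c : B.Cyc) :
    B.coneCode.d1.mulVec u (.inr c) = B.bdry0Sum.mulVec (u ∘ .inr) c := by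
  rw [coneCode, Matrix.fromBlocks_mulVec]; simp

end CycleBasis

end ConeInput

/-! ### Cycles of the reduced cone code -/

/-- Each edge `r` of a cycle of length `w` lies in exactly one face `t` of its cellulated disc. -/
theorem sum_faces_of_edge {w : ℕ} (r : ℕ) (hr : r < w) {R : Type*} [AddCommMonoid R] (g : R) :
    ∑ t : Fin ((w - 1) / 2 + 1), (if r = t ∨ r + t + 1 = w then g else 0) = g := by
  rw [Finset.sum_eq_single (⟨min r (w - 1 - r), by omega⟩ : Fin ((w - 1) / 2 + 1))]
  · rw [if_pos]
    dsimp only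
    omega
  · intro t _ ht
    refine if_neg fun h => ht (Fin.ext ?_)
    have := t.2
    dsimp only
    omega
  · simp

namespace ConeInput

variable {X Q Z : Type*} [Fintype X] [Fintype Q] {A : CSSCode X Q Z} {D : ConeInput A}

theorem bdrySum_mulVec_apply (v : (Σ i, D.Vert i) → ZMod 2) (i : Fin D.m) (e : D.Edge i) :
    D.bdrySum.mulVec v ⟨i, e⟩ = (D.bdry i).mulVec (fun x => v ⟨i, x⟩) e :=
  Matrix.blockDiagonal'_mulVec _ _ _ _

open scoped Classical in
theorem f1_mulVec_apply (v : (Σ i, D.Vert i) → ZMod 2) (q : Q) :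
    D.f1.mulVec v q = ∑ i, if hq : q ∈ D.Qset i then v ⟨i, ⟨q, hq⟩⟩ else 0 := by
  rw [Matrix.mulVec, dotProduct, Fintype.sum_sigma]
  refine Finset.sum_congr rfl fun i _ => ?_
  split_ifs with hq
  · rw [Finset.sum_eq_single ⟨q, hq⟩]
    · simp [f1]
    · intro x _ hx
      have : q ≠ (x : Q) := fun h => hx (Subtype.ext h.symm)
      simp [f1, this]
    · simp
  · refine Finset.sum_eq_zero fun x _ => ?_
    have : q ≠ (x : Q) := fun h => hq (by rw [h]; exact x.2)
    simp [f1, this]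

/-- A chain of vertices without boundary is constant on each connected component. -/
theorem eq_of_bdry_eq_zero {i : Fin D.m} {v : D.Vert i → ZMod 2} (hv : (D.bdry i).mulVec v = 0)
    {x y : D.Vert i} (hxy : (D.graph i).connectedComponentMk x =
      (D.graph i).connectedComponentMk y) : v x = v y := by
  classical
  have hadj : ∀ x y, (D.graph i).Adj x y → v x = v y := by
    intro x y hxy
    have hedge : ∃ e : D.Edge i, (e.2 : Sym2 Q) = s((x : Q), (y : Q)) := by
      rw [graph, SimpleGraph.fromRel_adj] at hxy
      rcases hxy.2 with ⟨e, he⟩ | ⟨e, he⟩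
      · exact ⟨e, he⟩
      · exact ⟨e, he.trans Sym2.eq_swap⟩
    obtain ⟨e, he⟩ := hedge
    have := D.bdry_sum i e x y hxy.ne he v
    have h0 := congrFun hv e
    rw [Matrix.mulVec, dotProduct, this] at h0
    exact CharTwo.add_eq_zero.mp h0
  obtain ⟨p⟩ := SimpleGraph.ConnectedComponent.exact hxy
  induction p with
  | nil => rfl
  | cons hab _ ih => exact (hadj _ _ hab).trans (ih (SimpleGraph.ConnectedComponent.sound ⟨‹_›⟩))

theorem mem_range_compInd {v : (Σ i, D.Vert i) → ZMod 2} (hv : D.bdrySum.mulVec v = 0) :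
    ∃ a, D.compInd.mulVec a = v := by
  classical
  have hv' : ∀ i, (D.bdry i).mulVec (fun x => v ⟨i, x⟩) = 0 := fun i => funext fun e => by
    rw [← bdrySum_mulVec_apply, hv]; rfl
  refine ⟨fun c => v ⟨c.1, c.2.exists_rep.choose⟩, funext fun ⟨i, x⟩ => ?_⟩
  rw [compInd, Matrix.blockDiagonal'_mulVec, Matrix.mulVec, dotProduct,
    Finset.sum_eq_single ((D.graph i).connectedComponentMk x)]
  · simp only [Matrix.of_apply, if_true, one_mul]
    exact eq_of_bdry_eq_zero (hv' i)
      (Quot.exists_rep ((D.graph i).connectedComponentMk x)).choose_spec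
  · intro c _ hc
    simp [hc.symm]
  · simp

namespace CycleBasis

/-- Closed `0`-chains are boundaries: the zeroth homology of the extended complex vanishes, as its dual,
the cycle space modulo the span of the basis cycles, does. -/
theorem exists_bdry_eq (B : CycleBasis D) {i : Fin D.m} {r : D.Edge i → ZMod 2}
    (hr : (B.bdry0 i).mulVec r = 0) : ∃ v, (D.bdry i).mulVec v = r := by
  refine ((D.bdry i).mem_range_mulVecLin_iff r).mpr fun y hy => ?_
  have hy' : y ∈ Submodule.span (ZMod 2) (Set.range fun c => (B.cyc i c).chain) := by
    rw [B.span i]; exact hy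
  induction hy' using Submodule.span_induction with
  | mem _ hx =>
    obtain ⟨c, rfl⟩ := hx
    exact congrFun hr c
  | zero => exact zero_dotProduct _
  | add a b ha hb iha ihb =>
    have ker_mem : ∀ a ∈ Submodule.span (ZMod 2) (Set.range fun c => (B.cyc i c).chain),
        (D.bdry i).transpose.mulVec a = 0 := fun a ha => by
      rw [B.span i] at ha; exact ha
    rw [add_dotProduct, iha (ker_mem a ha), ihb (ker_mem b hb), add_zero]
  | smul t a ha iha =>
    have : (D.bdry i).transpose.mulVec a = 0 := by rw [B.span i] at ha; exact ha
    rw [smul_dotProduct, iha this, smul_zero]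

theorem bdry0Sum_mulVec_apply (B : CycleBasis D) (r : (Σ i, D.Edge i) → ZMod 2) (i : Fin D.m)
    (c : Fin (B.num i)) : B.bdry0Sum.mulVec r ⟨i, c⟩ = (B.bdry0 i).mulVec (fun e => r ⟨i, e⟩) c :=
  Matrix.blockDiagonal'_mulVec _ _ _ _

theorem bdry0_mulVec_apply (B : CycleBasis D) (i : Fin D.m) (r : D.Edge i → ZMod 2)
    (c : Fin (B.num i)) : (B.bdry0 i).mulVec r c = ∑ t, r ((B.cyc i c).edge t) := by
  classical
  rw [Matrix.mulVec, dotProduct, ← Finset.sum_image (s := Finset.univ) (f := r)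
    ((B.cyc i c).edge_inj.injOn), ← Finset.sum_subset (Finset.subset_univ
      (Finset.univ.image (B.cyc i c).edge))]
  · refine Finset.sum_congr rfl fun e he => ?_
    obtain ⟨t, -, rfl⟩ := Finset.mem_image.mp he
    have : (B.cyc i c).chain ((B.cyc i c).edge t) = 1 :=
      ZMod2.eq_one_of_ne_zero (((B.cyc i c).chain_ne_zero_iff _).mpr ⟨t, rfl⟩)
    rw [bdry0, Matrix.of_apply, this, one_mul]
  · intro e _ he
    have : (B.cyc i c).chain e = 0 := by
      by_contra hne
      obtain ⟨t, rfl⟩ := ((B.cyc i c).chain_ne_zero_iff _).mp hne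
      exact he (Finset.mem_image_of_mem _ (Finset.mem_univ t))
    rw [bdry0, Matrix.of_apply, this, zero_mul]

variable [Fintype Z] {B : CycleBasis D} {ℓ : ℕ} (h : X ⊕ B.Cyc → Fin ℓ)

/-- The faces of a disc add up to its boundary cycle. -/
theorem bdry0Sum_mulVec_eq_sum_faces (u : B.RChain ℓ) (c : B.Cyc) :
    B.bdry0Sum.mulVec (slice u (h (.inr c)) ∘ .inr) c =
      ∑ t, (B.reducedD1 ℓ h).mulVec u (.inl (.inr ⟨c, t⟩)) := by
  classical
  have h1 : ∀ t, (B.reducedD1 ℓ h).mulVec u (.inl (.inr ⟨c, t⟩)) =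
      (∑ r : Fin (B.get c).len, if (r : ℕ) = t ∨ (r : ℕ) + t + 1 = (B.get c).len then
        slice u (h (.inr c)) (.inr ⟨c.1, (B.get c).edge r⟩) else 0) +
      ∑ s : Fin (((B.get c).len - 1) / 2),
        if (s : ℕ) = t ∨ (s : ℕ) + 1 = t then u (.inr ⟨c, s⟩) else 0 := fun t => by
    rw [reducedD1_mulVec_face, B.face_edge_sum]
  rw [Finset.sum_congr rfl fun t _ => h1 t, Finset.sum_add_distrib, Finset.sum_comm]
  have h2 : (∑ t : Fin (((B.get c).len - 1) / 2 + 1), ∑ s : Fin (((B.get c).len - 1) / 2),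
      if (s : ℕ) = t ∨ (s : ℕ) + 1 = t then u (.inr ⟨c, s⟩) else 0) = 0 := by
    rw [Finset.sum_comm]
    refine Finset.sum_eq_zero fun s _ => ?_
    have hsplit : ∀ t : Fin (((B.get c).len - 1) / 2 + 1),
        (if (s : ℕ) = t ∨ (s : ℕ) + 1 = t then u (.inr ⟨c, s⟩) else 0) =
        (if t = s.castSucc then u (.inr ⟨c, s⟩) else 0) +
          if t = s.succ then u (.inr ⟨c, s⟩) else 0 := by
      intro t
      simp only [Fin.ext_iff, Fin.val_castSucc, Fin.val_succ]
      split_ifs <;> first | (exfalso; omega) | simp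
    simp only [hsplit, Finset.sum_add_distrib, Finset.sum_ite_eq', Finset.mem_univ, if_true]
    exact CharTwo.add_self_eq_zero _
  rw [h2, add_zero]
  obtain ⟨i, c⟩ := c
  rw [bdry0Sum_mulVec_apply, bdry0_mulVec_apply]
  refine Finset.sum_congr rfl fun r _ => ?_
  rw [sum_faces_of_edge (r : ℕ) r.2]
  rfl

/-- The slices of a cycle of the reduced cone code are cycles of the cone code: they are homologous to
each other, and each stabilizer of the cone code is satisfied at its chosen height. -/
theorem coneCode_d1_mulVec_slice {u : B.RChain ℓ} (hu : (B.reducedD1 ℓ h).mulVec u = 0)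
    (k : Fin ℓ) : B.coneCode.d1.mulVec (slice u k) = 0 := by
  have hconst : ∀ k k', B.coneCode.d1.mulVec (slice u k) = B.coneCode.d1.mulVec (slice u k') := by
    refine eq_of_segLo_eq_segHi fun j => ?_
    have hj : slice u (segLo j) + slice u (segHi j) = B.coneCode.d2.mulVec (segs u j) := by
      funext y
      have := congrFun hu (.inr (y, j))
      rw [reducedD1_mulVec_seg] at this
      exact CharTwo.add_eq_zero.mp this
    have := congrArg B.coneCode.d1.mulVec hj
    rw [Matrix.mulVec_mulVec, B.coneCode.comm, Matrix.zero_mulVec, Matrix.mulVec_add] at this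
    rw [← sub_eq_zero, sub_eq_add_neg, ZMod2.fun_neg]
    exact this
  funext x
  rcases x with x | c
  · rw [hconst k (h (.inl x)), ← reducedD1_mulVec_stab, hu]; rfl
  · rw [hconst k (h (.inr c)), coneCode_d1_mulVec_inr, bdry0Sum_mulVec_eq_sum_faces, hu]
    exact Finset.sum_eq_zero fun _ _ => rfl

variable (B ℓ)

/-- The chain `p` of qubits of `A`, repeated at all heights. -/
def constChain : (Q → ZMod 2) →ₗ[ZMod 2] B.RChain ℓ where
  toFun p
    | .inl (.inl (.inl q, _)) => p q
    | .inl (.inl (.inr _, _)) => 0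
    | .inl (.inr _) => 0
    | .inr _ => 0
  map_add' p p' := by
    funext y
    rcases y with (⟨_ | _, _⟩ | _) | _ <;> simp
  map_smul' a p := by
    funext y
    rcases y with (⟨_ | _, _⟩ | _) | _ <;> simp

variable {B ℓ}

theorem slice_constChain (p : Q → ZMod 2) (k : Fin ℓ) :
    slice (B.constChain ℓ p) k = Sum.elim p 0 := by
  funext y; rcases y with q | e <;> rfl

theorem segs_constChain (p : Q → ZMod 2) (j : Fin (ℓ - 1)) : segs (B.constChain ℓ p) j = 0 := rfl

theorem constChain_mem_ker {p : Q → ZMod 2} (hp : A.d1.mulVec p = 0) :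
    (B.reducedD1 ℓ h).mulVec (B.constChain ℓ p) = 0 := by
  classical
  funext y
  rcases y with (x | φ) | ⟨y, j⟩
  · rw [reducedD1_mulVec_stab, coneCode_d1_mulVec_inl, slice_constChain]
    have h1 : (Sum.elim p 0 : (Q ⊕ Σ i, D.Edge i) → ZMod 2) ∘ Sum.inl = p := rfl
    have h2 : (Sum.elim p 0 : (Q ⊕ Σ i, D.Edge i) → ZMod 2) ∘ Sum.inr = 0 := rfl
    rw [h1, h2, hp, Matrix.mulVec_zero]
    simp
  · rw [reducedD1_mulVec_face, slice_constChain]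
    have : ∀ s, B.constChain ℓ p (.inr s) = 0 := fun _ => rfl
    simp [this]
  · rw [reducedD1_mulVec_seg, slice_constChain, slice_constChain, segs_constChain,
      Matrix.mulVec_zero]
    simpa using CharTwo.add_self_eq_zero _

/-- The position in its cycle of the first end point of a chord. -/
def chordFst (s : B.Chord) : Fin (B.get s.1).len := ⟨s.2 + 1, by have := s.2.2; omega⟩

/-- The position in its cycle of the second end point of a chord. -/
def chordSnd (s : B.Chord) : Fin (B.get s.1).len :=
  ⟨(B.get s.1).len - 1 - s.2, by have := s.2.2; omega⟩

theorem chordFst_ne_chordSnd (s : B.Chord) : chordFst s ≠ chordSnd s := by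
  intro h
  have := Fin.ext_iff.mp h
  have := s.2.2
  simp only [chordFst, chordSnd] at *
  omega

theorem chordVert_iff (s : B.Chord) (v : Σ i, D.Vert i) : B.chordVert s v ↔
    v = ⟨s.1.1, (B.get s.1).vert (chordFst s)⟩ ∨ v = ⟨s.1.1, (B.get s.1).vert (chordSnd s)⟩ := by
  constructor
  · rintro ⟨r, rfl, hr⟩
    have hr' : r = chordFst s ∨ r = chordSnd s := by
      have := r.2
      rw [Fin.ext_iff, Fin.ext_iff]
      simp only [chordFst, chordSnd]
      omega
    rcases hr' with rfl | rfl
    · exact Or.inl rfl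
    · exact Or.inr rfl
  · have := s.2.2
    rintro (rfl | rfl)
    · exact ⟨chordFst s, rfl, Or.inl rfl⟩
    · refine ⟨chordSnd s, rfl, Or.inr ?_⟩
      simp only [chordSnd]
      omega

/-- A chord has two end points, in the same component, so the product of the vertex stabilizers over
a component does not act on the chords. -/
theorem sum_chordVert_compInd (a : (Σ i, D.Comp i) → ZMod 2) (s : B.Chord) :
    open scoped Classical in
    (∑ v, if B.chordVert s v then D.compInd.mulVec a v else 0) = 0 := by
  classical
  set γ := B.get s.1 with hγ
  have hv : (⟨s.1.1, γ.vert (chordFst s)⟩ : Σ i, D.Vert i) ≠ ⟨s.1.1, γ.vert (chordSnd s)⟩ := fun h =>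
    chordFst_ne_chordSnd s (γ.vert_inj (eq_of_heq (Sigma.mk.inj h).2))
  have hb0 : D.bdrySum.mulVec (D.compInd.mulVec a) = 0 := by
    rw [Matrix.mulVec_mulVec, D.bdrySum_compInd, Matrix.zero_mulVec]
  have hrot : ∀ r : Fin γ.len, D.compInd.mulVec a ⟨s.1.1, γ.vert r⟩ =
      D.compInd.mulVec a ⟨s.1.1, γ.vert (finRotate γ.len r)⟩ := by
    intro r
    have h1 := congrFun hb0 ⟨s.1.1, γ.edge r⟩
    rw [bdrySum_mulVec_apply, Matrix.mulVec, dotProduct,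
      D.bdry_sum s.1.1 (γ.edge r) _ _ (ne_of_edge_eq (γ.ends r)) (γ.ends r)] at h1
    exact CharTwo.add_eq_zero.mp h1
  have hall : ∀ n (hn : n < γ.len), D.compInd.mulVec a ⟨s.1.1, γ.vert ⟨n, hn⟩⟩ =
      D.compInd.mulVec a ⟨s.1.1, γ.vert ⟨0, by omega⟩⟩ := by
    intro n
    induction n with
    | zero => intro _; rfl
    | succ n ih =>
      intro hn
      rw [← ih (by omega), hrot ⟨n, by omega⟩]
      congr 3
      have := finRotate_symm_val γ.two_le (⟨n + 1, hn⟩ : Fin γ.len)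
      rw [← Equiv.symm_apply_eq]
      exact Fin.ext (by rw [this]; simp)
  have hsplit : ∀ v : Σ i, D.Vert i, (if B.chordVert s v then D.compInd.mulVec a v else 0) =
      (if v = ⟨s.1.1, γ.vert (chordFst s)⟩ then D.compInd.mulVec a v else 0) +
        if v = ⟨s.1.1, γ.vert (chordSnd s)⟩ then D.compInd.mulVec a v else 0 := by
    intro v
    simp only [chordVert_iff]
    change (if v = ⟨s.1.1, γ.vert (chordFst s)⟩ ∨ v = ⟨s.1.1, γ.vert (chordSnd s)⟩ then
      D.compInd.mulVec a v else 0) = _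
    by_cases h1 : v = ⟨s.1.1, γ.vert (chordFst s)⟩
    · have h2 : v ≠ ⟨s.1.1, γ.vert (chordSnd s)⟩ := fun h => hv (h1.symm.trans h)
      rw [if_pos (Or.inl h1), if_pos h1, if_neg h2, add_zero]
    · simp [h1]
  rw [Finset.sum_congr rfl fun v _ => hsplit v, Finset.sum_add_distrib, Finset.sum_ite_eq',
    Finset.sum_ite_eq', if_pos (Finset.mem_univ _), if_pos (Finset.mem_univ _),
    hall _ (chordFst s).2, hall _ (chordSnd s).2]
  exact CharTwo.add_self_eq_zero _

theorem constChain_mem_range {p : Q → ZMod 2}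
    (hp : p ∈ LinearMap.range D.inducedCode.d2.mulVecLin) :
    B.constChain ℓ p ∈ LinearMap.range (B.reducedD2 ℓ h).mulVecLin := by
  classical
  obtain ⟨w, rfl⟩ := hp
  refine ⟨fun z => Sum.elim (w ∘ .inl) (D.compInd.mulVec (w ∘ .inr)) z.1, ?_⟩
  rw [Matrix.mulVecLin_apply, Matrix.mulVecLin_apply]
  refine rchain_ext (fun k => ?_) (fun j => ?_) fun s => ?_
  · rw [slice_reducedD2_mulVec, slice_constChain]
    funext y
    rcases y with q | e
    · rw [coneCode_d2_mulVec_inl, inducedCode, Matrix.fromCols_mulVec, ← Matrix.mulVec_mulVec]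
      rfl
    · rw [coneCode_d2_mulVec_inr]
      change D.bdrySum.mulVec (D.compInd.mulVec (w ∘ .inr)) e = 0
      rw [Matrix.mulVec_mulVec, D.bdrySum_compInd, Matrix.zero_mulVec]; rfl
  · rw [segs_reducedD2_mulVec, segs_constChain]
    exact funext fun z => CharTwo.add_self_eq_zero _
  · rw [reducedD2_mulVec_chord]
    exact sum_chordVert_compInd (w ∘ .inr) s

theorem mem_range_of_constChain_mem_range (hℓ : 1 ≤ ℓ) {p : Q → ZMod 2}
    (hp : B.constChain ℓ p ∈ LinearMap.range (B.reducedD2 ℓ h).mulVecLin) :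
    p ∈ LinearMap.range D.inducedCode.d2.mulVecLin := by
  obtain ⟨a, ha⟩ := hp
  rw [Matrix.mulVecLin_apply] at ha
  have h1 := slice_reducedD2_mulVec h a ⟨0, hℓ⟩
  rw [ha, slice_constChain] at h1
  set α := fun z => a (z, ⟨0, hℓ⟩) with hα
  have hb : D.bdrySum.mulVec (α ∘ .inr) = 0 := funext fun e => by
    rw [← coneCode_d2_mulVec_inr (B := B), ← h1]; rfl
  obtain ⟨w, hw⟩ := mem_range_compInd hb
  refine ⟨Sum.elim (α ∘ .inl) w, ?_⟩
  rw [Matrix.mulVecLin_apply, inducedCode, Matrix.fromCols_mulVec]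
  funext q
  have h2 := congrFun h1 (.inl q)
  rw [coneCode_d2_mulVec_inl, ← hw, Matrix.mulVec_mulVec] at h2
  exact h2.symm

/-- Each cycle of the reduced cone code is homologous to a chain `p` of qubits of `A` repeated at all
heights. Stabilizers `(z, k)` first clear the segments, then the vertex stabilizers clear the edges; the
faces force the chords to vanish then. -/
theorem add_constChain_mem_range {u : B.RChain ℓ} (hu : (B.reducedD1 ℓ h).mulVec u = 0)
    (k₀ : Fin ℓ) {v : (Σ i, D.Vert i) → ZMod 2} (hv : D.bdrySum.mulVec v = slice u k₀ ∘ .inr) :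
    u + B.constChain ℓ (slice u k₀ ∘ .inl + D.f1.mulVec v) ∈
      LinearMap.range (B.reducedD2 ℓ h).mulVecLin := by
  classical
  -- partial sums of the segments below a height
  let σ : ℕ → (Z ⊕ Σ i, D.Vert i) → ZMod 2 := fun n =>
    ∑ j : Fin (ℓ - 1), if (j : ℕ) < n then segs u j else 0
  have hσ : ∀ j : Fin (ℓ - 1), σ (segLo j : Fin ℓ) + σ (segHi j : Fin ℓ) = segs u j := by
    intro j
    simp only [σ, segLo, segHi]
    rw [← Finset.sum_add_distrib, Finset.sum_eq_single j]
    · simp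
    · intro j' _ hj'
      have hj'' : (j' : ℕ) ≠ j := fun h => hj' (Fin.ext h)
      by_cases h1 : (j' : ℕ) < j
      · rw [if_pos h1, if_pos (by omega), ZMod2.fun_add_self]
      · rw [if_neg h1, if_neg (by omega), add_zero]
    · simp
  let v₀ : (Z ⊕ Σ i, D.Vert i) → ZMod 2 := Sum.elim 0 v
  let a : (Z ⊕ Σ i, D.Vert i) × Fin ℓ → ZMod 2 := fun z => σ z.2 z.1 + σ k₀ z.1 + v₀ z.1
  set u' := u + (B.reducedD2 ℓ h).mulVec a with hu'
  have hcyc : (B.reducedD1 ℓ h).mulVec u' = 0 := by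
    rw [hu', Matrix.mulVec_add, hu, Matrix.mulVec_mulVec, B.reduced_comm, Matrix.zero_mulVec,
      add_zero]
  have hsegs : ∀ j, segs u' j = 0 := by
    intro j
    have h1 : segs u' j = segs u j + segs ((B.reducedD2 ℓ h).mulVec a) j := rfl
    rw [h1, segs_reducedD2_mulVec, ← hσ j]
    funext z
    simp only [Pi.add_apply, Pi.zero_apply, a]
    generalize σ (segLo j : Fin ℓ) z = x1
    generalize σ (segHi j : Fin ℓ) z = x2
    generalize σ k₀ z = x3
    generalize v₀ z = x4
    revert x1 x2 x3 x4
    decide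
  have hconst : ∀ k k', slice u' k = slice u' k' := by
    refine eq_of_segLo_eq_segHi fun j => funext fun y => ?_
    have := congrFun hcyc (.inr (y, j))
    rw [reducedD1_mulVec_seg, hsegs, Matrix.mulVec_zero, Pi.zero_apply, add_zero] at this
    exact CharTwo.add_eq_zero.mp this
  have hslice : slice u' k₀ = Sum.elim (slice u k₀ ∘ .inl + D.f1.mulVec v) 0 := by
    have h1 : slice u' k₀ = slice u k₀ + slice ((B.reducedD2 ℓ h).mulVec a) k₀ := rfl
    have h2 : (fun z => a (z, k₀)) = v₀ := by
      funext z
      simp only [a]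
      rw [CharTwo.add_self_eq_zero, zero_add]
    rw [h1, slice_reducedD2_mulVec, h2]
    funext y
    rcases y with q | e
    · rw [Pi.add_apply, coneCode_d2_mulVec_inl]
      have h3 : v₀ ∘ Sum.inl = 0 := rfl
      have h4 : v₀ ∘ Sum.inr = v := rfl
      rw [h3, h4, Matrix.mulVec_zero, Pi.zero_apply, zero_add]
      rfl
    · rw [Pi.add_apply, coneCode_d2_mulVec_inr]
      have h4 : v₀ ∘ Sum.inr = v := rfl
      rw [h4, hv]
      exact CharTwo.add_self_eq_zero _
  have hface : ∀ (c : B.Cyc) (t : Fin (((B.get c).len - 1) / 2 + 1)),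
      (∑ s : Fin (((B.get c).len - 1) / 2),
        if (s : ℕ) = t ∨ (s : ℕ) + 1 = t then u' (.inr ⟨c, s⟩) else 0) = 0 := by
    intro c t
    have := congrFun hcyc (.inl (.inr ⟨c, t⟩))
    rw [reducedD1_mulVec_face, hconst _ k₀, hslice] at this
    simpa using this
  have hchord : ∀ s : B.Chord, u' (.inr s) = 0 := by
    rintro ⟨c, s, hs⟩
    induction s with
    | zero =>
      have := hface c ⟨0, by omega⟩
      rw [Finset.sum_eq_single ⟨0, hs⟩] at this
      · simpa using this
      · intro s _ hs'
        refine if_neg fun h' => hs' (Fin.ext ?_)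
        simpa using h'
      · simp
    | succ n ih =>
      have := hface c ⟨n + 1, by omega⟩
      rw [Finset.sum_eq_single ⟨n + 1, hs⟩] at this
      · simpa using this
      · intro s _ hs'
        split_ifs with h'
        · have : s = ⟨n, by omega⟩ := by
            have hs'' : (s : ℕ) ≠ n + 1 := fun h => hs' (Fin.ext h)
            refine Fin.ext ?_
            dsimp only at h' ⊢
            omega
          rw [this]
          exact ih (by omega)
        · rfl
      · simp
  have hfin : u' = B.constChain ℓ (slice u k₀ ∘ .inl + D.f1.mulVec v) := by
    refine rchain_ext (fun k => ?_) (fun j => ?_) fun s => ?_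
    · rw [hconst k k₀, hslice, slice_constChain]
    · rw [hsegs, segs_constChain]
    · rw [hchord]; rfl
  refine ⟨a, ?_⟩
  rw [← hfin, hu', ← add_assoc, ZMod2.fun_add_self, zero_add, Matrix.mulVecLin_apply]

/-- The edges in a slice of a cycle form a closed `0`-chain. -/
theorem bdry0_mulVec_slice {u : B.RChain ℓ} (hu : (B.reducedD1 ℓ h).mulVec u = 0)
    (k : Fin ℓ) (i : Fin D.m) : (B.bdry0 i).mulVec (fun e => slice u k (.inr ⟨i, e⟩)) = 0 := by
  funext c
  have := congrFun (coneCode_d1_mulVec_slice h hu k) (.inr ⟨i, c⟩)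
  rw [coneCode_d1_mulVec_inr, bdry0Sum_mulVec_apply] at this
  exact this

/-- The chain `p` to which a slice is homologous in the cone code is a cycle. -/
theorem d1_mulVec_slice_add {u : B.RChain ℓ} (hu : (B.reducedD1 ℓ h).mulVec u = 0)
    (k : Fin ℓ) {v : (Σ i, D.Vert i) → ZMod 2} (hv : D.bdrySum.mulVec v = slice u k ∘ .inr) :
    A.d1.mulVec (slice u k ∘ .inl + D.f1.mulVec v) = 0 := by
  funext x
  have := congrFun (coneCode_d1_mulVec_slice h hu k) (.inl x)
  rw [coneCode_d1_mulVec_inl] at this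
  rw [Matrix.mulVec_add, Matrix.mulVec_mulVec, D.chainMap, ← Matrix.mulVec_mulVec, hv]
  exact this

end CycleBasis

end ConeInput

/-! ### Logical qubits and distances -/

theorem hammingNorm_eq_sum {ι : Type*} [Fintype ι] (x : ι → ZMod 2) :
    hammingNorm x = ∑ j, if x j ≠ 0 then 1 else 0 := by
  rw [hammingNorm, Finset.card_filter]

open scoped Classical in
theorem hammingNorm_eq_sum_fiber {ι κ : Type*} [Fintype ι] [Fintype κ] (g : ι → κ)
    (y : ι → ZMod 2) : hammingNorm y = ∑ c, hammingNorm (fun x => if g x = c then y x else 0) := by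
  simp only [hammingNorm_eq_sum]
  rw [Finset.sum_comm]
  refine Finset.sum_congr rfl fun x _ => ?_
  rw [Finset.sum_eq_single (g x)]
  · simp
  · intro c _ hc
    simp [hc.symm]
  · simp

namespace ConeInput

variable {X Q Z : Type*} [Fintype X] [Fintype Q] {A : CSSCode X Q Z} {D : ConeInput A}

namespace CycleBasis

section Homology

variable [Fintype Z] {B : CycleBasis D} {ℓ : ℕ} (h : X ⊕ B.Cyc → Fin ℓ)

theorem exists_bdrySum_eq_slice {u : B.RChain ℓ} (hu : (B.reducedD1 ℓ h).mulVec u = 0) (k : Fin ℓ) :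
    ∃ v, D.bdrySum.mulVec v = slice u k ∘ .inr := by
  choose v hv using fun i => B.exists_bdry_eq (bdry0_mulVec_slice h hu k i)
  refine ⟨fun x => v x.1 x.2, funext fun ⟨i, e⟩ => ?_⟩
  rw [bdrySum_mulVec_apply]
  exact congrFun (hv i) e

/-- Repeating chains at all heights induces an isomorphism from the first homology of the induced code
to that of the reduced cone code. -/
theorem reducedConeCode_K (hℓ : 1 ≤ ℓ) : (B.reducedConeCode ℓ h).K = D.inducedCode.K := by
  let φ : LinearMap.ker A.d1.mulVecLin →ₗ[ZMod 2] LinearMap.ker (B.reducedD1 ℓ h).mulVecLin :=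
    (B.constChain ℓ).restrict fun p hp => constChain_mem_ker h hp
  let ψ := ((LinearMap.range (B.reducedD2 ℓ h).mulVecLin).submoduleOf
    (LinearMap.ker (B.reducedD1 ℓ h).mulVecLin)).mkQ ∘ₗ φ
  have hker : LinearMap.ker ψ = (LinearMap.range D.inducedCode.d2.mulVecLin).submoduleOf
      (LinearMap.ker A.d1.mulVecLin) := by
    ext p
    rw [LinearMap.mem_ker, LinearMap.comp_apply, Submodule.mkQ_apply,
      Submodule.Quotient.mk_eq_zero, Submodule.submoduleOf, Submodule.submoduleOf,
      Submodule.mem_comap, Submodule.mem_comap]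
    exact ⟨fun hp => mem_range_of_constChain_mem_range h hℓ hp, fun hp => constChain_mem_range h hp⟩
  have hsurj : Function.Surjective ψ := by
    intro y
    obtain ⟨⟨u, hu⟩, rfl⟩ := Submodule.mkQ_surjective _ y
    obtain ⟨v, hv⟩ := exists_bdrySum_eq_slice h hu ⟨0, hℓ⟩
    refine ⟨⟨slice u ⟨0, hℓ⟩ ∘ .inl + D.f1.mulVec v, d1_mulVec_slice_add h hu _ hv⟩, ?_⟩
    rw [LinearMap.comp_apply, Submodule.mkQ_apply, Submodule.mkQ_apply, Submodule.Quotient.eq,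
      Submodule.submoduleOf, Submodule.mem_comap]
    have := add_constChain_mem_range h hu ⟨0, hℓ⟩ hv
    rw [add_comm] at this
    change B.constChain ℓ (slice u ⟨0, hℓ⟩ ∘ .inl + D.f1.mulVec v) - u ∈ _
    rw [sub_eq_add_neg, ZMod2.fun_neg]
    exact this
  have e := (Submodule.quotEquivOfEq _ _ hker).symm.trans (ψ.quotKerEquivOfSurjective hsurj)
  exact e.finrank_eq.symm

theorem dotProduct_constChain (u : B.RChain ℓ) (p : Q → ZMod 2) :
    u ⬝ᵥ B.constChain ℓ p = (fun q => ∑ k, slice u k (.inl q)) ⬝ᵥ p := by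
  have : ∀ (x : ((Q ⊕ Σ i, D.Edge i) × Fin ℓ ⊕ (Z ⊕ Σ i, D.Vert i) × Fin (ℓ - 1)) ⊕ B.Chord),
      B.constChain ℓ p x = Sum.elim (Sum.elim (fun y => Sum.elim p 0 y.1) 0) 0 x := by
    rintro ((⟨_ | _, _⟩ | _) | _) <;> rfl
  simp only [dotProduct, this, Fintype.sum_sum_type, Fintype.sum_prod_type, Sum.elim_inl,
    Sum.elim_inr, Pi.zero_apply, mul_zero, Finset.sum_const_zero, add_zero]
  exact Finset.sum_congr rfl fun q _ => by rw [Finset.sum_mul]; rfl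

/-- Summing a cocycle of the reduced cone code over all heights gives a cocycle of the induced code, of
no larger weight; it is a coboundary only if the given cocycle is, because each cycle of the reduced
cone code is homologous to one that is repeated at all heights. -/
theorem inducedCode_dX_le (hℓ : 1 ≤ ℓ) : D.inducedCode.dX ≤ (B.reducedConeCode ℓ h).dX := by
  classical
  refine le_iInf fun u => le_iInf fun hu => le_iInf fun hnu => ?_
  change (B.reducedD2 ℓ h).transpose.mulVec u = 0 at hu
  change u ∉ LinearMap.range (B.reducedD1 ℓ h).transpose.mulVecLin at hnu
  have hbd : ∀ y ∈ LinearMap.range (B.reducedD2 ℓ h).mulVecLin, u ⬝ᵥ y = 0 := by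
    rintro _ ⟨a, rfl⟩
    rw [Matrix.mulVecLin_apply, Matrix.dotProduct_mulVec, ← Matrix.mulVec_transpose, hu,
      zero_dotProduct]
  refine iInf_le_of_le (fun q => ∑ k, slice u k (.inl q)) (iInf_le_of_le ?_ (iInf_le_of_le ?_ ?_))
  · refine dotProduct_eq_zero _ fun w => ?_
    rw [Matrix.mulVec_transpose, ← Matrix.dotProduct_mulVec, ← dotProduct_constChain]
    exact hbd _ (constChain_mem_range h ⟨w, rfl⟩)
  · rintro ⟨y, hy⟩
    refine hnu ((Matrix.mem_range_mulVecLin_iff _ _).mpr fun c hc => ?_)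
    rw [Matrix.transpose_transpose] at hc
    obtain ⟨v, hv⟩ := exists_bdrySum_eq_slice h hc ⟨0, hℓ⟩
    have h1 := hbd _ (add_constChain_mem_range h hc ⟨0, hℓ⟩ hv)
    rw [dotProduct_add, dotProduct_constChain, ← hy, Matrix.mulVecLin_apply,
      Matrix.mulVec_transpose, ← Matrix.dotProduct_mulVec] at h1
    have h2 : D.inducedCode.d1.mulVec (slice c ⟨0, hℓ⟩ ∘ .inl + D.f1.mulVec v) = 0 :=
      d1_mulVec_slice_add h hc _ hv
    rw [h2, dotProduct_zero, add_zero] at h1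
    rw [dotProduct_comm, h1]
  · refine Nat.cast_le.mpr ?_
    have hex : ∀ q, ∃ k, (∑ k, slice u k (.inl q)) ≠ 0 → slice u k (.inl q) ≠ 0 := by
      intro q
      by_cases hq : (∑ k, slice u k (.inl q)) = 0
      · exact ⟨⟨0, hℓ⟩, fun h => absurd hq h⟩
      · obtain ⟨k, -, hk⟩ := Finset.exists_ne_zero_of_sum_ne_zero hq
        exact ⟨k, fun _ => hk⟩
    choose k hk using hex
    refine Finset.card_le_card_of_injOn (fun q => .inl (.inl (.inl q, k q))) (fun q hq => ?_)
      fun q _ q' _ hqq => ?_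
    · have := hk q (by simpa using hq)
      simpa [slice] using this
    · simpa using congrArg Prod.fst (Sum.inl_injective (Sum.inl_injective hqq))

end Homology

section Soundness

/-- The maximum over `v` in the soundness factor is attained; the case `r = 0` is covered by `v = 0`. -/
theorem exists_soundness_mul_le (B : CycleBasis D) {i : Fin D.m} {r : D.Edge i → ZMod 2}
    (hr : (B.bdry0 i).mulVec r = 0) : ∃ v, (D.bdry i).mulVec v = r ∧
      B.soundness i * ((hammingNorm v : ℕ) : ℝ≥0∞) ≤ ((hammingNorm r : ℕ) : ℝ≥0∞) := by
  classical
  by_cases hr0 : r = 0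
  · exact ⟨0, by rw [hr0, Matrix.mulVec_zero], by simp⟩
  · obtain ⟨v₀, hv₀⟩ := B.exists_bdry_eq hr
    obtain ⟨v, hv, hmax⟩ := Finset.exists_max_image
      (Finset.univ.filter fun v => (D.bdry i).mulVec v = r)
      (fun v => ((hammingNorm r : ℕ) : ℝ≥0∞) / ((hammingNorm v : ℕ) : ℝ≥0∞))
      ⟨v₀, by simpa using hv₀⟩
    refine ⟨v, by simpa using hv, ENNReal.mul_le_of_le_div ?_⟩
    have hle : B.soundness i ≤ ⨆ (v : D.Vert i → ZMod 2) (_ : (D.bdry i).mulVec v = r),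
        ((hammingNorm r : ℕ) : ℝ≥0∞) / ((hammingNorm v : ℕ) : ℝ≥0∞) :=
      iInf_le_of_le r (iInf_le_of_le hr (iInf_le _ hr0))
    refine hle.trans ?_
    exact iSup_le fun v' => iSup_le fun hv' => hmax v' (by simpa using hv')

open scoped Classical in
/-- Within each component a chain `v` of vertices can be replaced by its complement, which does not change
the boundary, so that at most half of the vertices of each component remain. -/
theorem exists_small_sides {i : Fin D.m} (v : D.Vert i → ZMod 2) :
    ∃ v', (D.bdry i).mulVec v' = (D.bdry i).mulVec v ∧ ∀ c : D.Comp i,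
      2 * hammingNorm (fun x => if (D.graph i).connectedComponentMk x = c then v' x else 0) ≤
        c.supp.ncard := by
  let side : D.Comp i → Finset (D.Vert i) := fun c =>
    Finset.univ.filter fun x => (D.graph i).connectedComponentMk x = c ∧ v x ≠ 0
  let τ : D.Comp i → ZMod 2 := fun c => if 2 * (side c).card ≤ c.supp.ncard then 0 else 1
  refine ⟨fun x => v x + τ ((D.graph i).connectedComponentMk x), funext fun e => ?_, fun c => ?_⟩
  · rw [Matrix.mulVec, dotProduct, Matrix.mulVec, dotProduct,
      D.bdry_sum i e _ _ (D.edgeSrc_ne_edgeTgt i e) (D.edge_eq i e),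
      D.bdry_sum i e _ _ (D.edgeSrc_ne_edgeTgt i e) (D.edge_eq i e), edgeComp_eq_tgt, edgeComp]
    have := CharTwo.add_self_eq_zero (τ ((D.graph i).connectedComponentMk (D.edgeSrc i e)))
    linear_combination this
  · have hsupp : c.supp.ncard = (D.compVerts i c).card := by
      rw [← Set.ncard_coe_finset]
      congr 1
      ext x
      simp [compVerts, SimpleGraph.ConnectedComponent.mem_supp_iff]
    by_cases hc : 2 * (side c).card ≤ c.supp.ncard
    · refine le_trans (Nat.mul_le_mul_left 2 (Finset.card_le_card fun x hx => ?_)) hc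
      have hx := (Finset.mem_filter.mp hx).2
      by_cases hxc : (D.graph i).connectedComponentMk x = c
      · simp only [hxc, if_true, τ, if_pos hc, add_zero] at hx
        simpa [side] using ⟨hxc, hx⟩
      · simp [hxc] at hx
    · have hsub : hammingNorm (fun x => if (D.graph i).connectedComponentMk x = c then
          v x + τ ((D.graph i).connectedComponentMk x) else 0) ≤
          (D.compVerts i c \ side c).card := by
        refine Finset.card_le_card fun x hx => ?_
        have hx := (Finset.mem_filter.mp hx).2
        by_cases hxc : (D.graph i).connectedComponentMk x = c
        · simp only [hxc, if_true, τ, if_neg hc] at hx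
          refine Finset.mem_sdiff.mpr ⟨by simpa [compVerts] using hxc, fun hx' => hx ?_⟩
          rw [ZMod2.eq_one_of_ne_zero (Finset.mem_filter.mp hx').2.2]
          exact CharTwo.add_self_eq_zero _
        · simp [hxc] at hx
      have hss : side c ⊆ D.compVerts i c := fun x hx => by
        simpa [compVerts] using (Finset.mem_filter.mp hx).2.1
      rw [Finset.card_sdiff_of_subset hss] at hsub
      exact (Nat.mul_le_mul_left 2 hsub).trans (by omega)

/-- The preimage of `u` with at most half of the vertices of each component is split into its parts in the
components, to which the Cheeger bound applies. -/
theorem cheeger_le_soundness (B : CycleBasis D) (i : Fin D.m) : D.cheeger i ≤ B.soundness i := by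
  classical
  refine le_iInf fun u => le_iInf fun hu => le_iInf fun hu0 => ?_
  obtain ⟨v₀, hv₀⟩ := B.exists_bdry_eq hu
  obtain ⟨v, hv, hsmall⟩ := exists_small_sides v₀
  rw [hv₀] at hv
  refine le_iSup_of_le v (le_iSup_of_le hv ?_)
  have hv0 : hammingNorm v ≠ 0 := fun h0 => hu0 (by
    rw [← hv, hammingNorm_eq_zero.mp h0, Matrix.mulVec_zero])
  rw [ENNReal.le_div_iff_mul_le (Or.inl (by exact_mod_cast hv0)) (Or.inl (ENNReal.natCast_ne_top _))]
  -- split `v` and its boundary `u` into the parts in the components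
  let w : D.Comp i → D.Vert i → ZMod 2 := fun c x =>
    if (D.graph i).connectedComponentMk x = c then v x else 0
  have hw : ∀ c e, (D.bdry i).mulVec (w c) e = if D.edgeComp i e = c then u e else 0 := by
    intro c e
    rw [← hv, Matrix.mulVec, dotProduct, Matrix.mulVec, dotProduct,
      D.bdry_sum i e _ _ (D.edgeSrc_ne_edgeTgt i e) (D.edge_eq i e),
      D.bdry_sum i e _ _ (D.edgeSrc_ne_edgeTgt i e) (D.edge_eq i e)]
    simp only [w, edgeComp_eq_tgt]
    rw [← edgeComp]
    split_ifs <;> simp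
  rw [hammingNorm_eq_sum_fiber (fun x => (D.graph i).connectedComponentMk x) v,
    hammingNorm_eq_sum_fiber (fun e => D.edgeComp i e) u,
    Nat.cast_sum, Nat.cast_sum, Finset.mul_sum]
  refine Finset.sum_le_sum fun c _ => ?_
  have hwc : (fun e => if D.edgeComp i e = c then u e else 0) = (D.bdry i).mulVec (w c) :=
    funext fun e => (hw c e).symm
  rw [hwc]
  change D.cheeger i * ((hammingNorm (w c) : ℕ) : ℝ≥0∞) ≤ _
  rcases Nat.eq_zero_or_pos (hammingNorm (w c)) with h0 | hpos
  · rw [h0]; simp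
  · refine ENNReal.mul_le_of_le_div (iInf_le_of_le c (iInf_le_of_le (w c)
      (iInf_le_of_le (fun x hx => ?_) (iInf_le _ ⟨hpos, hsmall c⟩))))
    by_contra hxc
    exact hx (if_neg hxc)

theorem min_cheeger_le_soundnessFactor (B : CycleBasis D) :
    min 1 (⨅ i, D.cheeger i) ≤ B.soundnessFactor :=
  min_le_min_left _ (iInf_mono fun i => B.cheeger_le_soundness i)

end Soundness

section Distance

variable [Fintype Z] {B : CycleBasis D} {ℓ : ℕ} (h : X ⊕ B.Cyc → Fin ℓ)

theorem hammingNorm_f1_mulVec_le (v : (Σ i, D.Vert i) → ZMod 2) :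
    hammingNorm (D.f1.mulVec v) ≤ hammingNorm v := by
  classical
  refine (Finset.card_le_card (t := (Finset.univ.filter fun x => v x ≠ 0).image
    fun x : Σ i, D.Vert i => (x.2 : Q)) fun q hq => ?_).trans Finset.card_image_le
  have hq := (Finset.mem_filter.mp hq).2
  rw [f1_mulVec_apply] at hq
  obtain ⟨i, -, hi⟩ := Finset.exists_ne_zero_of_sum_ne_zero hq
  split_ifs at hi with hqi
  · exact Finset.mem_image.mpr ⟨⟨i, ⟨q, hqi⟩⟩, by simpa using hi, rfl⟩
  · exact absurd rfl hi

/-- Each slice of a nontrivial cycle of the reduced cone code has weight at least `λ d_Z`: replacing its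
edges by a chain of vertices, which is at most `1 / λ` times as large, gives a nontrivial cycle of the
induced code. -/
theorem inducedCode_dZ_mul_le_slice {u : B.RChain ℓ} (hu : (B.reducedD1 ℓ h).mulVec u = 0)
    (hnu : u ∉ LinearMap.range (B.reducedD2 ℓ h).mulVecLin) (k : Fin ℓ) :
    (D.inducedCode.dZ : ℝ≥0∞) * B.soundnessFactor ≤ ((hammingNorm (slice u k) : ℕ) : ℝ≥0∞) := by
  choose v hv hvs using fun i => B.exists_soundness_mul_le (bdry0_mulVec_slice h hu k i)
  let v' : (Σ i, D.Vert i) → ZMod 2 := fun x => v x.1 x.2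
  have hv' : D.bdrySum.mulVec v' = slice u k ∘ .inr := funext fun ⟨i, e⟩ => by
    rw [bdrySum_mulVec_apply]; exact congrFun (hv i) e
  set p := slice u k ∘ .inl + D.f1.mulVec v' with hp
  have hp1 : D.inducedCode.d1.mulVec p = 0 := d1_mulVec_slice_add h hu k hv'
  have hp2 : p ∉ LinearMap.range D.inducedCode.d2.mulVecLin := fun hp' => hnu (by
    have h1 := add_constChain_mem_range h hu k hv'
    have h2 := constChain_mem_range h hp'
    have h3 := Submodule.add_mem _ h1 h2
    rwa [add_assoc, ZMod2.fun_add_self, add_zero] at h3)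
  have hdZ : D.inducedCode.dZ ≤ ((hammingNorm p : ℕ) : ℕ∞) :=
    iInf_le_of_le p (iInf_le_of_le hp1 (iInf_le _ hp2))
  have hdZ' : (D.inducedCode.dZ : ℝ≥0∞) ≤ ((hammingNorm p : ℕ) : ℝ≥0∞) := by
    have := ENat.toENNReal_mono hdZ
    simpa using this
  have hpn : hammingNorm p ≤ hammingNorm (slice u k ∘ .inl) + ∑ i, hammingNorm (v i) := by
    refine (hammingNorm_add_le _ _).trans (Nat.add_le_add_left
      ((hammingNorm_f1_mulVec_le v').trans (le_of_eq ?_)) _)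
    simp only [hammingNorm_eq_sum, Fintype.sum_sigma]
    rfl
  have hsn : hammingNorm (slice u k) = hammingNorm (slice u k ∘ .inl) +
      ∑ i, hammingNorm fun e : D.Edge i => slice u k (.inr ⟨i, e⟩) := by
    simp only [hammingNorm_eq_sum, Fintype.sum_sum_type, Fintype.sum_sigma]
    rfl
  have hl1 : B.soundnessFactor ≤ 1 := min_le_left _ _
  have hl2 : ∀ i, B.soundnessFactor ≤ B.soundness i := fun i =>
    (min_le_right _ _).trans (iInf_le _ i)
  calc (D.inducedCode.dZ : ℝ≥0∞) * B.soundnessFactor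
      ≤ B.soundnessFactor * (((hammingNorm (slice u k ∘ .inl) + ∑ i, hammingNorm (v i) : ℕ)) :
          ℝ≥0∞) := by
        rw [mul_comm]
        gcongr
        exact hdZ'.trans (by exact_mod_cast hpn)
    _ = B.soundnessFactor * ((hammingNorm (slice u k ∘ .inl) : ℕ) : ℝ≥0∞) +
          ∑ i, B.soundnessFactor * ((hammingNorm (v i) : ℕ) : ℝ≥0∞) := by
        rw [Nat.cast_add, Nat.cast_sum, mul_add, Finset.mul_sum]
    _ ≤ 1 * ((hammingNorm (slice u k ∘ .inl) : ℕ) : ℝ≥0∞) +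
          ∑ i, ((hammingNorm fun e : D.Edge i => slice u k (.inr ⟨i, e⟩) : ℕ) : ℝ≥0∞) := by
        refine add_le_add (by gcongr) (Finset.sum_le_sum fun i _ => le_trans ?_ (hvs i))
        have := hl2 i
        gcongr
    _ = ((hammingNorm (slice u k) : ℕ) : ℝ≥0∞) := by
        rw [hsn, one_mul, Nat.cast_add, Nat.cast_sum]

theorem sum_hammingNorm_slice_le (u : B.RChain ℓ) :
    ∑ k, hammingNorm (slice u k) ≤ hammingNorm u := by
  have h1 : ∑ k, hammingNorm (slice u k) =
      ∑ y : (Q ⊕ Σ i, D.Edge i) × Fin ℓ, if u (.inl (.inl y)) ≠ 0 then 1 else 0 := by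
    simp only [hammingNorm_eq_sum]
    rw [Finset.sum_comm, Fintype.sum_prod_type]
    rfl
  rw [h1, hammingNorm_eq_sum u, Fintype.sum_sum_type, Fintype.sum_sum_type, add_assoc]
  exact Nat.le_add_right _ _

theorem inducedCode_dZ_mul_le : (D.inducedCode.dZ : ℝ≥0∞) * B.soundnessFactor * (ℓ : ℝ≥0∞) ≤
    ((B.reducedConeCode ℓ h).dZ : ℝ≥0∞) := by
  rw [CSSCode.dZ.eq_def (B.reducedConeCode ℓ h)]
  simp only [ENat.toENNReal_iInf]
  refine le_iInf fun u => le_iInf fun hu => le_iInf fun hnu => ?_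
  calc (D.inducedCode.dZ : ℝ≥0∞) * B.soundnessFactor * (ℓ : ℝ≥0∞)
      = ∑ _k : Fin ℓ, (D.inducedCode.dZ : ℝ≥0∞) * B.soundnessFactor := by
        rw [Finset.sum_const, Finset.card_univ, Fintype.card_fin, nsmul_eq_mul, mul_comm]
    _ ≤ ∑ k : Fin ℓ, ((hammingNorm (slice u k) : ℕ) : ℝ≥0∞) :=
        Finset.sum_le_sum fun k _ => inducedCode_dZ_mul_le_slice h hu hnu k
    _ ≤ ((hammingNorm u : ℕ) : ℝ≥0∞) := by
        rw [← Nat.cast_sum]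
        exact_mod_cast sum_hammingNorm_slice_le u
    _ = _ := by simp

end Distance

end CycleBasis

end ConeInput

/-! ### Weights of the building blocks -/

section Counting

theorem card_filter_le_two {α β : Type*} [Fintype α] (P : α → Prop) [DecidablePred P] (f : α → β)
    (a b : β) (hab : ∀ x, P x → f x = a ∨ f x = b)
    (hinj : ∀ x y, P x → P y → f x = f y → x = y) : (Finset.univ.filter P).card ≤ 2 := by
  classical
  refine (Finset.card_le_card_of_injOn (t := {a, b}) f (fun x hx => ?_) fun x hx y hy => ?_).trans
    Finset.card_le_two
  · simpa using hab x (by simpa using hx)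
  · exact hinj x y (by simpa using hx) (by simpa using hy)

theorem hammingNorm_le_of {ι : Type*} [Fintype ι] {x : ι → ZMod 2} {P : ι → Prop} [DecidablePred P]
    (h : ∀ j, x j ≠ 0 → P j) : hammingNorm x ≤ (Finset.univ.filter P).card :=
  Finset.card_le_card fun j hj => Finset.mem_filter.mpr
    ⟨Finset.mem_univ _, h j (Finset.mem_filter.mp hj).2⟩

theorem hammingNorm_sum {α β : Type*} [Fintype α] [Fintype β] (x : α ⊕ β → ZMod 2) :
    hammingNorm x = hammingNorm (fun a => x (.inl a)) + hammingNorm (fun b => x (.inr b)) := by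
  simp only [hammingNorm_eq_sum, Fintype.sum_sum_type]

theorem hammingNorm_prod_snd {α κ : Type*} [Fintype α] [Fintype κ] {x : α × κ → ZMod 2} (k : κ)
    (hx : ∀ a k', k' ≠ k → x (a, k') = 0) : hammingNorm x = hammingNorm fun a => x (a, k) := by
  classical
  simp only [hammingNorm_eq_sum, Fintype.sum_prod_type]
  refine Finset.sum_congr rfl fun a _ => Finset.sum_eq_single k (fun k' _ hk => ?_) (by simp)
  rw [if_neg (not_not.mpr (hx a k' hk))]

theorem hammingNorm_prod_fst {α κ : Type*} [Fintype α] [Fintype κ] {x : α × κ → ZMod 2} (a : α)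
    (hx : ∀ a' k, a' ≠ a → x (a', k) = 0) : hammingNorm x = hammingNorm fun k => x (a, k) := by
  classical
  simp only [hammingNorm_eq_sum, Fintype.sum_prod_type]
  refine Finset.sum_eq_single a (fun a' _ ha => Finset.sum_eq_zero fun k _ => ?_) (by simp)
  rw [if_neg (not_not.mpr (hx a' k ha))]

theorem hammingNorm_intervalBoundary_col_le {ℓ : ℕ} (j : Fin (ℓ - 1)) :
    hammingNorm (fun k => intervalBoundary ℓ k j) ≤ 2 := by
  classical
  refine (hammingNorm_le_of (P := fun k : Fin ℓ => (k : ℕ) = j ∨ (k : ℕ) = j + 1) fun k hk => ?_).trans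
    (card_filter_le_two _ (fun k => (k : ℕ)) j (j + 1) (fun k hk => hk) fun k k' _ _ h => Fin.ext h)
  by_contra h
  exact hk (if_neg h)

theorem hammingNorm_intervalBoundary_row_le {ℓ : ℕ} (k : Fin ℓ) :
    hammingNorm (fun j => intervalBoundary ℓ k j) ≤ 2 := by
  classical
  refine (hammingNorm_le_of (P := fun j : Fin (ℓ - 1) => (k : ℕ) = j ∨ (k : ℕ) = j + 1)
    fun j hj => ?_).trans (card_filter_le_two _ (fun j => (j : ℕ)) k (k - 1) (fun j hj => ?_)
      fun k k' _ _ h => Fin.ext h)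
  · by_contra h
    exact hj (if_neg h)
  · rcases hj with h | h
    · exact Or.inl h.symm
    · exact Or.inr (by omega)

end Counting

namespace CSSCode

variable {X Q Z : Type*} [Fintype Q] (C : CSSCode X Q Z)

theorem le_wX [Fintype X] (x : X) : hammingNorm (fun q => C.d1 x q) ≤ C.wX :=
  Finset.le_sup (f := fun x : X => (Finset.univ.filter fun q : Q => C.d1 x q ≠ 0).card)
    (Finset.mem_univ x)

theorem le_qX [Fintype X] (q : Q) : hammingNorm (fun x => C.d1 x q) ≤ C.qX :=
  Finset.le_sup (f := fun q : Q => (Finset.univ.filter fun x : X => C.d1 x q ≠ 0).card)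
    (Finset.mem_univ q)

theorem le_wZ [Fintype Z] (z : Z) : hammingNorm (fun q => C.d2 q z) ≤ C.wZ :=
  Finset.le_sup (f := fun z : Z => (Finset.univ.filter fun q : Q => C.d2 q z ≠ 0).card)
    (Finset.mem_univ z)

theorem le_qZ [Fintype Z] (q : Q) : hammingNorm (fun z => C.d2 q z) ≤ C.qZ :=
  Finset.le_sup (f := fun q : Q => (Finset.univ.filter fun z : Z => C.d2 q z ≠ 0).card)
    (Finset.mem_univ q)

end CSSCode

namespace ConeInput

section Degrees

variable {X Q Z : Type*} [Fintype X] [Fintype Q] {A : CSSCode X Q Z} {D : ConeInput A}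

/-- The edges of `Gᵢ` at a vertex belong to different `X`-stabilizers, which act on the vertex. -/
theorem hammingNorm_bdry_col_le (i : Fin D.m) (v : D.Vert i) :
    hammingNorm (fun e => D.bdry i e v) ≤ A.qX := by
  classical
  refine le_trans (Finset.card_le_card_of_injOn (fun e : D.Edge i => e.1) (fun e he => ?_)
    fun e he e' he' hee => ?_) (A.le_qX (v : Q))
  · have he : (v : Q) ∈ (e.2 : Sym2 Q) := by simpa [bdry] using he
    simpa using (D.mem_pair i e.1 e.2 e.2.2 v he).2
  · have he : (v : Q) ∈ (e.2 : Sym2 Q) := by simpa [bdry] using he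
    have he' : (v : Q) ∈ (e'.2 : Sym2 Q) := by simpa [bdry] using he'
    obtain ⟨s, p⟩ := e
    obtain ⟨s', p'⟩ := e'
    obtain rfl : s = s' := hee
    have hs := (D.mem_pair i s p p.2 v he).2
    have := (D.cover i s v v.2 hs).unique ⟨p.2, he⟩ ⟨p'.2, he'⟩
    rw [Subtype.ext this]

theorem hammingNorm_bdry_row (i : Fin D.m) (e : D.Edge i) :
    hammingNorm (fun v => D.bdry i e v) = 2 := by
  classical
  refine Eq.trans (congrArg Finset.card ?_) (Finset.card_pair (D.edgeSrc_ne_edgeTgt i e))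
  ext v
  simp only [bdry, Matrix.of_apply, mem_edge_iff, ne_eq, ite_eq_right_iff, one_ne_zero, imp_false,
    not_not, Finset.mem_filter, Finset.mem_univ, true_and, Finset.mem_insert, Finset.mem_singleton]
  exact or_congr eq_comm eq_comm

open scoped Classical in
/-- The number of the sets `Qset i` in which a qubit lies. -/
noncomputable def numSets (D : ConeInput A) (q : Q) : ℕ :=
  (Finset.univ.filter fun i : Fin D.m => q ∈ D.Qset i).card

theorem hammingNorm_f1_row (q : Q) : hammingNorm (fun v => D.f1 q v) = D.numSets q := by
  classical
  rw [hammingNorm_eq_sum, numSets, Finset.card_filter, Fintype.sum_sigma]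
  refine Finset.sum_congr rfl fun i _ => ?_
  by_cases hq : q ∈ D.Qset i
  · rw [if_pos hq, Finset.sum_eq_single ⟨q, hq⟩]
    · simp [f1]
    · intro v _ hv
      have : q ≠ (v : Q) := fun h => hv (Subtype.ext h.symm)
      simp [f1, this]
    · simp
  · rw [if_neg hq]
    refine Finset.sum_eq_zero fun v _ => ?_
    have : q ≠ (v : Q) := fun h => hq (by rw [h]; exact v.2)
    simp [f1, this]

theorem hammingNorm_f1_col (v : Σ i, D.Vert i) : hammingNorm (fun q => D.f1 q v) = 1 := by
  classical
  rw [hammingNorm, Finset.card_eq_one]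
  refine ⟨v.2, ?_⟩
  ext q
  simp [f1]

theorem hammingNorm_f0_col (e : Σ i, D.Edge i) : hammingNorm (fun x => D.f0 x e) = 1 := by
  classical
  rw [hammingNorm, Finset.card_eq_one]
  refine ⟨e.2.1, ?_⟩
  ext q
  simp [f0]

/-- A qubit takes part in one induced `Z`-stabilizer for each `Qset i` in which it lies. -/
theorem hammingNorm_inducedCode_d2_row [Fintype Z] (q : Q) :
    hammingNorm (fun z => D.inducedCode.d2 q z) =
      hammingNorm (fun z => A.d2 q z) + D.numSets q := by
  classical
  rw [hammingNorm_sum]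
  congr 1
  have h1 : ∀ c : Σ i, D.Comp i, D.inducedCode.d2 q (.inr c) = (D.f1 * D.compInd) q c := fun _ => rfl
  rw [hammingNorm_eq_sum, numSets, Finset.card_filter, Fintype.sum_sigma]
  refine Finset.sum_congr rfl fun i _ => ?_
  simp only [h1, f1_mul_compInd_apply]
  by_cases hq : q ∈ D.Qset i
  · rw [if_pos hq, Finset.sum_eq_single ((D.graph i).connectedComponentMk ⟨q, hq⟩)]
    · simp [hq]
    · intro c _ hc
      have hn : ¬ ∃ h : q ∈ D.Qset i, (D.graph i).connectedComponentMk ⟨q, h⟩ = c :=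
        fun ⟨_, h⟩ => hc h.symm
      rw [if_neg (not_not.mpr (if_neg hn))]
    · simp
  · simp [hq]

theorem bdrySum_apply_same (i : Fin D.m) (e : D.Edge i) (v : D.Vert i) :
    D.bdrySum ⟨i, e⟩ ⟨i, v⟩ = D.bdry i e v :=
  Matrix.blockDiagonal'_apply_eq _ _ _ _

theorem hammingNorm_bdrySum_col (i : Fin D.m) (v : D.Vert i) :
    hammingNorm (fun e => D.bdrySum e ⟨i, v⟩) = hammingNorm (fun e => D.bdry i e v) := by
  classical
  rw [hammingNorm_eq_sum, hammingNorm_eq_sum, Fintype.sum_sigma, Finset.sum_eq_single i]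
  · simp only [bdrySum_apply_same]
  · intro j _ hj
    refine Finset.sum_eq_zero fun e _ => ?_
    rw [bdrySum, Matrix.blockDiagonal'_apply_ne _ _ _ hj]
    simp
  · simp

theorem hammingNorm_bdrySum_row (e : Σ i, D.Edge i) :
    hammingNorm (fun v => D.bdrySum e v) = 2 := by
  classical
  obtain ⟨i, e⟩ := e
  refine Eq.trans ?_ (hammingNorm_bdry_row i e)
  rw [hammingNorm_eq_sum, hammingNorm_eq_sum, Fintype.sum_sigma,
    Finset.sum_eq_single i]
  · simp only [bdrySum_apply_same]
  · intro j _ hj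
    refine Finset.sum_eq_zero fun v _ => ?_
    rw [bdrySum, Matrix.blockDiagonal'_apply_ne _ _ _ hj.symm]
    simp
  · simp

/-- Twice the number of edges that belong to an `X`-stabilizer: the edges pair off the qubits of each
`Qset i` on which the stabilizer acts. -/
theorem two_mul_hammingNorm_f0_row_le [Fintype Z] (x : X) :
    2 * hammingNorm (fun e => D.f0 x e) ≤ A.wX * D.inducedCode.qZ := by
  classical
  have hrow : hammingNorm (fun e => D.f0 x e) * 2 = ∑ i, ∑ p : ↥(D.pairs i x),
      hammingNorm (fun v => D.bdry i ⟨x, p⟩ v) := by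
    simp only [hammingNorm_bdry_row]
    rw [hammingNorm_eq_sum, Fintype.sum_sigma, Finset.sum_mul]
    refine Finset.sum_congr rfl fun i _ => ?_
    rw [Fintype.sum_sigma, Finset.sum_eq_single x]
    · simp [f0]
    · intro s _ hs
      simp [f0, hs.symm]
    · simp
  have hcol : ∀ i, (∑ p : ↥(D.pairs i x), hammingNorm (fun v => D.bdry i ⟨x, p⟩ v)) ≤
      ∑ q : Q, if A.d1 x q ≠ 0 ∧ q ∈ D.Qset i then 1 else 0 := by
    intro i
    simp only [hammingNorm_eq_sum]
    rw [Finset.sum_comm]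
    have hsub : (∑ q : Q, if A.d1 x q ≠ 0 ∧ q ∈ D.Qset i then 1 else 0) =
        ∑ v : D.Vert i, if A.d1 x v ≠ 0 then 1 else 0 := by
      rw [Finset.sum_coe_sort (D.Qset i) fun q => if A.d1 x q ≠ 0 then 1 else 0,
        ← Finset.sum_filter, ← Finset.sum_filter]
      refine Finset.sum_congr ?_ fun _ _ => rfl
      ext q
      simp [and_comm]
    rw [hsub]
    refine Finset.sum_le_sum fun v _ => ?_
    by_cases hv : A.d1 x v = 0
    · rw [if_neg (not_not.mpr hv)]
      refine le_of_eq (Finset.sum_eq_zero fun p _ => if_neg (not_not.mpr ?_))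
      by_contra hne
      have hm : (v : Q) ∈ (p : Sym2 Q) := by simpa [bdry] using hne
      exact (D.mem_pair i x p p.2 v hm).2 hv
    · rw [if_pos hv, ← Finset.card_filter]
      refine Finset.card_le_one.mpr fun p hp p' hp' => ?_
      have hp : (v : Q) ∈ (p : Sym2 Q) := by simpa [bdry] using hp
      have hp' : (v : Q) ∈ (p' : Sym2 Q) := by simpa [bdry] using hp'
      exact Subtype.ext ((D.cover i x v v.2 hv).unique ⟨p.2, hp⟩ ⟨p'.2, hp'⟩)
  calc 2 * hammingNorm (fun e => D.f0 x e)
      = ∑ i, ∑ p : ↥(D.pairs i x), hammingNorm (fun v => D.bdry i ⟨x, p⟩ v) := by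
        rw [mul_comm, hrow]
    _ ≤ ∑ i : Fin D.m, ∑ q : Q, if A.d1 x q ≠ 0 ∧ q ∈ D.Qset i then 1 else 0 :=
        Finset.sum_le_sum fun i _ => hcol i
    _ = ∑ q : Q, if A.d1 x q ≠ 0 then D.numSets q else 0 := by
        rw [Finset.sum_comm]
        refine Finset.sum_congr rfl fun q _ => ?_
        by_cases hq : A.d1 x q = 0
        · simp [hq]
        · rw [if_pos hq, numSets, Finset.card_filter]
          exact Finset.sum_congr rfl fun i _ => by simp [hq]
    _ ≤ ∑ q : Q, if A.d1 x q ≠ 0 then D.inducedCode.qZ else 0 := by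
        refine Finset.sum_le_sum fun q _ => ?_
        split_ifs
        · have h1 := D.inducedCode.le_qZ q
          rw [hammingNorm_inducedCode_d2_row] at h1
          omega
        · exact le_rfl
    _ = hammingNorm (fun q => A.d1 x q) * D.inducedCode.qZ := by
        rw [hammingNorm_eq_sum, Finset.sum_mul]
        exact Finset.sum_congr rfl fun q _ => by split_ifs <;> simp
    _ ≤ _ := Nat.mul_le_mul_right _ (A.le_wX x)

theorem two_mul_card_edge_le (i : Fin D.m) :
    2 * Fintype.card (D.Edge i) ≤ (D.Qset i).card * A.qX := by
  have h1 : 2 * Fintype.card (D.Edge i) = ∑ e : D.Edge i, hammingNorm (fun v => D.bdry i e v) := by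
    simp only [hammingNorm_bdry_row]
    rw [Finset.sum_const, Finset.card_univ, smul_eq_mul, mul_comm]
  have h2 : (∑ e : D.Edge i, hammingNorm (fun v => D.bdry i e v)) =
      ∑ v : D.Vert i, hammingNorm (fun e => D.bdry i e v) := by
    simp only [hammingNorm_eq_sum]
    exact Finset.sum_comm
  rw [h1, h2]
  refine (Finset.sum_le_card_nsmul _ _ A.qX fun v _ => hammingNorm_bdry_col_le i v).trans ?_
  rw [Finset.card_univ, Fintype.card_coe, smul_eq_mul]

end Degrees

end ConeInput

/-! ### Chords and faces -/

namespace ConeInput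

namespace CycleBasis

section Discs

variable {X Q Z : Type*} [Fintype X] [Fintype Q] [Fintype Z] {A : CSSCode X Q Z} {D : ConeInput A}
  {B : CycleBasis D} {ℓ : ℕ} (h : X ⊕ B.Cyc → Fin ℓ)

/-- The edge of a cycle of the basis at a given position, as an edge of the disjoint union of the graphs. -/
def cycEdge (c : B.Cyc) (r : Fin (B.get c).len) : Σ i, D.Edge i := ⟨c.1, (B.get c).edge r⟩

theorem cycEdge_injective (c : B.Cyc) : Function.Injective (cycEdge c) := fun _ _ hr =>
  (B.get c).edge_inj (eq_of_heq (Sigma.mk.inj hr).2)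

theorem cycVert_injective (c : B.Cyc) : Function.Injective
    fun r => (⟨c.1, (B.get c).vert r⟩ : Σ i, D.Vert i) := fun _ _ hr =>
  (B.get c).vert_inj (eq_of_heq (Sigma.mk.inj hr).2)

open scoped Classical in
/-- The basis cycles through the edge `e` that are placed at the height `k`. -/
noncomputable def cyclesAt (e : Σ i, D.Edge i) (k : Fin ℓ) : Finset B.Cyc :=
  Finset.univ.filter fun c => (∃ r, cycEdge c r = e) ∧ h (.inr c) = k

theorem mem_cyclesAt {e : Σ i, D.Edge i} {k : Fin ℓ} {c : B.Cyc} :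
    c ∈ cyclesAt h e k ↔ (∃ r, cycEdge c r = e) ∧ h (.inr c) = k := by
  simp [cyclesAt]

theorem card_cyclesAt (e : Σ i, D.Edge i) (k : Fin ℓ) :
    (cyclesAt h e k).card = B.multiplicity h e.1 e.2 k := by
  classical
  obtain ⟨i, e⟩ := e
  have himg : (cyclesAt h ⟨i, e⟩ k : Set B.Cyc) =
      Sigma.mk i '' {c : Fin (B.num i) | (∃ t, (B.cyc i c).edge t = e) ∧ h (.inr ⟨i, c⟩) = k} := by
    ext ⟨i', c⟩
    rw [Finset.mem_coe, mem_cyclesAt]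
    constructor
    · rintro ⟨⟨r, hr⟩, hk⟩
      obtain rfl : i' = i := (Sigma.mk.inj hr).1
      exact ⟨c, ⟨⟨r, eq_of_heq (Sigma.mk.inj hr).2⟩, hk⟩, rfl⟩
    · rintro ⟨c', ⟨⟨r, hr⟩, hk⟩, hc⟩
      rw [← hc]
      exact ⟨⟨r, congrArg (Sigma.mk i) hr⟩, hk⟩
  rw [← Set.ncard_coe_finset, himg, Set.ncard_image_of_injective _ sigma_mk_injective]
  rfl

/-- At most one chord of a cycle ends at a given position. -/
theorem chord_eq_of_pos {s s' : B.Chord} (h1 : s.1 = s'.1) {r r' : ℕ} (hr : r = r')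
    (hs : r = s.2 + 1 ∨ r + s.2 + 1 = (B.get s.1).len)
    (hs' : r' = s'.2 + 1 ∨ r' + s'.2 + 1 = (B.get s'.1).len) : s = s' := by
  obtain ⟨c, s⟩ := s
  obtain ⟨c', s'⟩ := s'
  obtain rfl : c = c' := h1
  have := s.2
  have := s'.2
  have : s = s' := Fin.ext (by dsimp only at *; omega)
  rw [this]

open scoped Classical in
/-- Each chord at a vertex belongs to a cycle with two edges at the vertex, and the cycle has no
further chord there. -/
theorem card_chords_at_mul_two_le {b : ℕ} (hb : ∀ i e k, B.multiplicity h i e k ≤ b) (i : Fin D.m)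
    (v : D.Vert i) (k : Fin ℓ) :
    (Finset.univ.filter fun s : B.Chord => B.chordVert s ⟨i, v⟩ ∧ k = h (.inr s.1)).card * 2 ≤
      hammingNorm (fun e => D.bdry i e v) * b := by
  refine Finset.card_mul_le_card_mul (t := Finset.univ.filter fun e => D.bdry i e v ≠ 0)
    (fun (s : B.Chord) (e : D.Edge i) => ∃ r, cycEdge s.1 r = ⟨i, e⟩) (fun s hs => ?_) fun e _ => ?_
  · obtain ⟨⟨r, hr, -⟩, -⟩ := (Finset.mem_filter.mp hs).2
    obtain ⟨⟨i', c⟩, s⟩ := s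
    obtain rfl : i = i' := (Sigma.mk.inj hr).1
    obtain rfl : v = (B.cyc i c).vert r := eq_of_heq (Sigma.mk.inj hr).2
    have hne : (finRotate (B.cyc i c).len).symm r ≠ r := by
      intro heq
      have := finRotate_symm_val (B.cyc i c).two_le r
      rw [heq] at this
      have := r.2
      have := (B.cyc i c).two_le
      split_ifs at * <;> omega
    have hsub : ({(B.cyc i c).edge ((finRotate (B.cyc i c).len).symm r), (B.cyc i c).edge r} :
        Finset (D.Edge i)) ⊆ Finset.bipartiteAbove
          (fun (s : B.Chord) (e : D.Edge i) => ∃ r, cycEdge s.1 r = ⟨i, e⟩)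
          (Finset.univ.filter fun e => D.bdry i e ((B.cyc i c).vert r) ≠ 0) ⟨⟨i, c⟩, s⟩ := by
      intro e he
      rw [Finset.mem_bipartiteAbove, Finset.mem_filter]
      rcases Finset.mem_insert.mp he with rfl | he
      · refine ⟨⟨Finset.mem_univ _, ?_⟩, _, rfl⟩
        have h1 := (B.cyc i c).ends ((finRotate (B.cyc i c).len).symm r)
        rw [Equiv.apply_symm_apply] at h1
        simp only [bdry, Matrix.of_apply, h1, Sym2.mem_mk_right, if_true]
        exact one_ne_zero
      · obtain rfl := Finset.mem_singleton.mp he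
        refine ⟨⟨Finset.mem_univ _, ?_⟩, _, rfl⟩
        simp [bdry, (B.cyc i c).ends]
    refine le_of_eq_of_le ?_ (Finset.card_le_card hsub)
    rw [Finset.card_pair fun heq => hne ((B.cyc i c).edge_inj heq)]
  · refine le_trans (Finset.card_le_card_of_injOn (t := cyclesAt h ⟨i, e⟩ k) (fun s => s.1)
      (fun s hs => ?_) fun s hs s' hs' hss => ?_) ((card_cyclesAt h ⟨i, e⟩ k).trans_le (hb i e k))
    · rw [Finset.mem_coe, Finset.mem_bipartiteBelow, Finset.mem_filter] at hs
      exact (mem_cyclesAt h).mpr ⟨hs.2, hs.1.2.2.symm⟩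
    · rw [Finset.mem_coe, Finset.mem_bipartiteBelow, Finset.mem_filter] at hs hs'
      obtain ⟨⟨-, ⟨r, hr, hrs⟩, -⟩, -⟩ := hs
      obtain ⟨⟨-, ⟨r', hr', hrs'⟩, -⟩, -⟩ := hs'
      refine chord_eq_of_pos hss ?_ hrs hrs'
      obtain ⟨c, s⟩ := s
      obtain ⟨c', s'⟩ := s'
      obtain rfl : c = c' := hss
      exact congrArg Fin.val (cycVert_injective c (hr.symm.trans hr'))

open scoped Classical in
/-- An edge of a cycle lies in exactly one face of its disc. -/
theorem card_faces_at_le {b : ℕ} (hb : ∀ i e k, B.multiplicity h i e k ≤ b) (e : Σ i, D.Edge i)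
    (k : Fin ℓ) :
    (Finset.univ.filter fun φ : B.Face => B.faceEdge φ e ∧ k = h (.inr φ.1)).card ≤ b := by
  refine le_trans (Finset.card_le_card_of_injOn (t := cyclesAt h e k) (fun φ => φ.1)
    (fun φ hφ => ?_) fun φ hφ φ' hφ' hh => ?_) ((card_cyclesAt h e k).trans_le (hb e.1 e.2 k))
  · obtain ⟨⟨r, hr, -⟩, hk⟩ := (Finset.mem_filter.mp hφ).2
    exact (mem_cyclesAt h).mpr ⟨⟨r, hr.symm⟩, hk.symm⟩
  · obtain ⟨⟨r, hr, hrt⟩, -⟩ := (Finset.mem_filter.mp hφ).2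
    obtain ⟨⟨r', hr', hrt'⟩, -⟩ := (Finset.mem_filter.mp hφ').2
    obtain ⟨c, t⟩ := φ
    obtain ⟨c', t'⟩ := φ'
    obtain rfl : c = c' := hh
    have hrr := congrArg Fin.val (cycEdge_injective c (hr.symm.trans hr'))
    have := t.2
    have := t'.2
    have : t = t' := Fin.ext (by dsimp only at *; omega)
    rw [this]

/-- The positions of the two ends of a chord give two edges of its cycle, and each edge is obtained
from at most one chord of the cycle. -/
theorem card_chord_mul_two_le {b : ℕ} (hb : ∀ i e k, B.multiplicity h i e k ≤ b) :
    Fintype.card B.Chord * 2 ≤ (∑ i, Fintype.card (D.Edge i)) * ℓ * b := by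
  classical
  have hcard : Fintype.card ((Σ i, D.Edge i) × Fin ℓ) = (∑ i, Fintype.card (D.Edge i)) * ℓ := by
    rw [Fintype.card_prod, Fintype.card_sigma, Fintype.card_fin]
  rw [← hcard, ← Finset.card_univ, ← Finset.card_univ]
  refine Finset.card_mul_le_card_mul (fun (s : B.Chord) (p : (Σ i, D.Edge i) × Fin ℓ) =>
    (cycEdge s.1 (chordFst s) = p.1 ∨ cycEdge s.1 (chordSnd s) = p.1) ∧ h (.inr s.1) = p.2)
    (fun s _ => ?_) fun p _ => ?_
  · refine (Finset.card_pair (a := (cycEdge s.1 (chordFst s), h (.inr s.1)))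
      (b := (cycEdge s.1 (chordSnd s), h (.inr s.1))) fun heq => chordFst_ne_chordSnd s
        (cycEdge_injective _ (Prod.mk.inj heq).1)).ge.trans (Finset.card_le_card fun p hp => ?_)
    rw [Finset.mem_bipartiteAbove]
    rcases Finset.mem_insert.mp hp with rfl | hp
    · exact ⟨Finset.mem_univ _, Or.inl rfl, rfl⟩
    · obtain rfl := Finset.mem_singleton.mp hp
      exact ⟨Finset.mem_univ _, Or.inr rfl, rfl⟩
  · have hpos : ∀ s : B.Chord, s ∈ Finset.bipartiteBelow (fun (s : B.Chord)
        (p : (Σ i, D.Edge i) × Fin ℓ) => (cycEdge s.1 (chordFst s) = p.1 ∨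
          cycEdge s.1 (chordSnd s) = p.1) ∧ h (.inr s.1) = p.2) Finset.univ p →
        (∃ r : Fin (B.get s.1).len, cycEdge s.1 r = p.1 ∧
          ((r : ℕ) = s.2 + 1 ∨ (r : ℕ) + s.2 + 1 = (B.get s.1).len)) ∧ h (.inr s.1) = p.2 := by
      intro s hs
      rw [Finset.mem_bipartiteBelow] at hs
      refine ⟨?_, hs.2.2⟩
      rcases hs.2.1 with hs | hs
      · exact ⟨_, hs, Or.inl rfl⟩
      · refine ⟨_, hs, Or.inr ?_⟩
        have := s.2.2
        simp only [chordSnd]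
        omega
    refine le_trans (Finset.card_le_card_of_injOn (t := cyclesAt h p.1 p.2) (fun s => s.1)
      (fun s hs => ?_) fun s hs s' hs' hss => ?_)
      ((card_cyclesAt h p.1 p.2).trans_le (hb p.1.1 p.1.2 p.2))
    · obtain ⟨⟨r, hr, -⟩, hk⟩ := hpos s hs
      exact (mem_cyclesAt h).mpr ⟨⟨r, hr⟩, hk⟩
    · obtain ⟨⟨r, hr, hrs⟩, -⟩ := hpos s hs
      obtain ⟨⟨r', hr', hrs'⟩, -⟩ := hpos s' hs'
      refine chord_eq_of_pos hss ?_ hrs hrs'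
      obtain ⟨c, s⟩ := s
      obtain ⟨c', s'⟩ := s'
      obtain rfl : c = c' := hss
      exact congrArg Fin.val (cycEdge_injective c (hr.trans hr'.symm))

open scoped Classical in
theorem card_edges_of_face_le (φ : B.Face) :
    (Finset.univ.filter fun e => B.faceEdge φ e).card ≤ 2 := by
  have hφ := φ.2.2
  have hw := (B.get φ.1).two_le
  refine card_filter_le_two _ id (cycEdge φ.1 ⟨φ.2, by omega⟩)
    (cycEdge φ.1 ⟨(B.get φ.1).len - 1 - φ.2, by omega⟩) ?_ fun _ _ _ _ heq => heq
  rintro e ⟨r, rfl, hr | hr⟩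
  · exact Or.inl (congrArg (cycEdge φ.1) (Fin.ext hr))
  · exact Or.inr (congrArg (cycEdge φ.1) (Fin.ext (by dsimp only; omega)))

open scoped Classical in
theorem card_chords_of_face_le (φ : B.Face) :
    (Finset.univ.filter fun s => B.faceChord φ s).card ≤ 2 := by
  refine card_filter_le_two _ (fun s => (s.2 : ℕ)) φ.2 (φ.2 - 1) (fun s hs => ?_) ?_
  · have := hs.2
    omega
  · rintro ⟨c, s⟩ ⟨c', s'⟩ ⟨h1, -⟩ ⟨h2, -⟩ hss
    obtain rfl : c = c' := h1.symm.trans h2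
    exact congrArg (Sigma.mk c) (Fin.ext hss)

open scoped Classical in
theorem card_faces_of_chord_le (s : B.Chord) :
    (Finset.univ.filter fun φ => B.faceChord φ s).card ≤ 2 := by
  refine card_filter_le_two _ (fun φ => (φ.2 : ℕ)) s.2 (s.2 + 1) (fun φ hφ => ?_) ?_
  · have := hφ.2
    omega
  · rintro ⟨c, t⟩ ⟨c', t'⟩ ⟨h1, -⟩ ⟨h2, -⟩ htt
    obtain rfl : c = c' := h1.trans h2.symm
    exact congrArg (Sigma.mk c) (Fin.ext htt)

open scoped Classical in
theorem card_ends_of_chord_le (s : B.Chord) :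
    (Finset.univ.filter fun v => B.chordVert s v).card ≤ 2 :=
  card_filter_le_two _ id _ _ (fun v hv => (chordVert_iff s v).mp hv) fun _ _ _ _ heq => heq

end Discs

end CycleBasis

end ConeInput

/-! ### Weights of the reduced cone code -/

namespace ConeInput

section Induced

variable {X Q Z : Type*} [Fintype X] [Fintype Q] [Fintype Z] {A : CSSCode X Q Z} (D : ConeInput A)

theorem inducedCode_wX : D.inducedCode.wX = A.wX := rfl

theorem inducedCode_qX : D.inducedCode.qX = A.qX := rfl

end Induced

namespace CycleBasis

section Weights

variable {X Q Z : Type*} [Fintype X] [Fintype Q] [Fintype Z] {A : CSSCode X Q Z} {D : ConeInput A}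
  {B : CycleBasis D} {ℓ : ℕ} {h : X ⊕ B.Cyc → Fin ℓ}

theorem hammingNorm_coneCode_d2_col_inl (z : Z) :
    hammingNorm (fun y => B.coneCode.d2 y (.inl z)) = hammingNorm (fun q => A.d2 q z) := by
  rw [hammingNorm_sum]
  exact congrArg (_ + ·) hammingNorm_zero

theorem hammingNorm_coneCode_d2_col_inr (v : Σ i, D.Vert i) :
    hammingNorm (fun y => B.coneCode.d2 y (.inr v)) = 1 + hammingNorm (fun e => D.bdry v.1 e v.2) := by
  rw [hammingNorm_sum, ← hammingNorm_bdrySum_col, ← D.hammingNorm_f1_col v]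
  rfl

theorem hammingNorm_coneCode_d2_row_inl (q : Q) :
    hammingNorm (fun z => B.coneCode.d2 (.inl q) z) = hammingNorm (fun z => D.inducedCode.d2 q z) := by
  rw [hammingNorm_inducedCode_d2_row, ← D.hammingNorm_f1_row q, hammingNorm_sum]
  rfl

theorem hammingNorm_coneCode_d2_row_inr (e : Σ i, D.Edge i) :
    hammingNorm (fun z => B.coneCode.d2 (.inr e) z) = 2 := by
  refine Eq.trans ?_ (D.hammingNorm_bdrySum_row e)
  rw [hammingNorm_sum]
  exact Eq.trans (congrArg (· + _) hammingNorm_zero) (Nat.zero_add _)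

theorem hammingNorm_reducedD2_col (z : Z ⊕ Σ i, D.Vert i) (k : Fin ℓ) :
    hammingNorm (fun y => B.reducedD2 ℓ h y (z, k)) =
      hammingNorm (fun y => B.coneCode.d2 y z) + hammingNorm (fun j => intervalBoundary ℓ k j) +
        hammingNorm (fun s => B.reducedD2 ℓ h (.inr s) (z, k)) := by
  classical
  have h1 : hammingNorm (fun p => B.reducedD2 ℓ h (.inl (.inl p)) (z, k)) =
      hammingNorm (fun y => B.coneCode.d2 y z) := by
    refine (hammingNorm_prod_snd k fun y k' hk => if_neg hk).trans ?_
    simp [reducedD2, thicken_d2_inl]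
  have h2 : hammingNorm (fun p => B.reducedD2 ℓ h (.inl (.inr p)) (z, k)) =
      hammingNorm (fun j => intervalBoundary ℓ k j) := by
    refine (hammingNorm_prod_fst z fun z' j hz => if_neg hz).trans ?_
    simp [reducedD2, CSSCode.thicken, CSSCode.thickenD2]
  rw [hammingNorm_sum, hammingNorm_sum, h1, h2]

theorem reducedConeCode_wZ_le {b : ℕ} (hb : ∀ i e k, B.multiplicity h i e k ≤ b) :
    (B.reducedConeCode ℓ h).wZ ≤ max A.wZ (A.qX + 1 + b * A.qX / 2) + 2 := by
  classical
  refine Finset.sup_le fun zk _ => ?_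
  obtain ⟨z, k⟩ := zk
  refine (hammingNorm_reducedD2_col z k).trans_le ?_
  have h2 := hammingNorm_intervalBoundary_row_le k
  rcases z with z | v
  · have h3 : hammingNorm (fun s => B.reducedD2 ℓ h (.inr s) (.inl z, k)) = 0 := hammingNorm_zero
    rw [h3, hammingNorm_coneCode_d2_col_inl]
    have := A.le_wZ z
    omega
  · rw [hammingNorm_coneCode_d2_col_inr]
    have h1 := hammingNorm_bdry_col_le v.1 v.2
    have h3 : hammingNorm (fun s => B.reducedD2 ℓ h (.inr s) (.inr v, k)) ≤
        (Finset.univ.filter fun s : B.Chord => B.chordVert s v ∧ k = h (.inr s.1)).card :=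
      hammingNorm_le_of fun s hs => by
        by_contra hn
        exact hs (if_neg hn)
    have h4 := card_chords_at_mul_two_le h hb v.1 v.2 k
    have h5 : hammingNorm (fun e => D.bdry v.1 e v.2) * b ≤ b * A.qX := by
      rw [mul_comm b]
      exact Nat.mul_le_mul_right _ h1
    have h6 := h3.trans ((Nat.le_div_iff_mul_le two_pos).mpr (h4.trans h5))
    omega

theorem reducedConeCode_qZ_le :
    (B.reducedConeCode ℓ h).qZ ≤ max D.inducedCode.qZ 2 := by
  classical
  refine Finset.sup_le fun y _ => ?_
  rcases y with (⟨y, k⟩ | ⟨z, j⟩) | s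
  · have h1 : hammingNorm (fun z => B.reducedD2 ℓ h (.inl (.inl (y, k))) z) =
        hammingNorm (fun z => B.coneCode.d2 y z) := by
      refine (hammingNorm_prod_snd k fun z k' hk => if_neg hk.symm).trans ?_
      simp [reducedD2, thicken_d2_inl]
    refine h1.trans_le ?_
    rcases y with q | e
    · rw [hammingNorm_coneCode_d2_row_inl]
      exact (D.inducedCode.le_qZ q).trans (le_max_left _ _)
    · rw [hammingNorm_coneCode_d2_row_inr]
      exact le_max_right _ _
  · have h1 : hammingNorm (fun p => B.reducedD2 ℓ h (.inl (.inr (z, j))) p) =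
        hammingNorm (fun k => intervalBoundary ℓ k j) := by
      refine (hammingNorm_prod_fst z fun z' k hz => if_neg hz.symm).trans ?_
      simp [reducedD2, CSSCode.thicken, CSSCode.thickenD2]
    exact h1.trans_le ((hammingNorm_intervalBoundary_col_le j).trans (le_max_right _ _))
  · refine le_trans (le_trans (Finset.card_le_card_of_injOn
      (t := (Finset.univ.filter fun v => B.chordVert s v).image fun v => (.inr v, h (.inr s.1)))
      id (fun zk hzk => ?_) fun _ _ _ _ heq => heq) Finset.card_image_le)
      ((card_ends_of_chord_le s).trans (le_max_right _ _))
    have hne := (Finset.mem_filter.mp hzk).2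
    obtain ⟨z | v, k⟩ := zk
    · exact absurd rfl hne
    · have hv : B.chordVert s v ∧ k = h (.inr s.1) := by
        by_contra hn
        exact hne (if_neg hn)
      refine Finset.mem_coe.mpr (Finset.mem_image.mpr ⟨v, by simpa using hv.1, ?_⟩)
      rw [hv.2]
      rfl

theorem hammingNorm_reducedD1_stab (x : X) :
    hammingNorm (fun y => B.reducedD1 ℓ h (.inl (.inl x)) y) =
      hammingNorm (fun q => A.d1 x q) + hammingNorm (fun e => D.f0 x e) := by
  classical
  have h1 : hammingNorm (fun s => B.reducedD1 ℓ h (.inl (.inl x)) (.inr s)) = 0 := hammingNorm_zero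
  have h2 : hammingNorm (fun p => B.reducedD1 ℓ h (.inl (.inl x)) (.inl (.inr p))) = 0 :=
    hammingNorm_zero
  have h3 : hammingNorm (fun p => B.reducedD1 ℓ h (.inl (.inl x)) (.inl (.inl p))) =
      hammingNorm (fun y => B.coneCode.d1 (.inl x) y) := by
    rw [hammingNorm_prod_snd (h (.inl x)) fun y k hk => if_neg hk]
    simp [reducedD1, CSSCode.thicken, CSSCode.thickenD1]
  rw [hammingNorm_sum, h1, hammingNorm_sum, h2, h3, hammingNorm_sum]
  rfl

theorem wX_le_reducedConeCode_wX : A.wX ≤ (B.reducedConeCode ℓ h).wX := by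
  refine Finset.sup_le fun x _ => le_trans ?_ ((B.reducedConeCode ℓ h).le_wX (.inl (.inl x)))
  exact le_trans (Nat.le_add_right _ _) (hammingNorm_reducedD1_stab x).ge

theorem hammingNorm_reducedD1_seg_row (y : Q ⊕ Σ i, D.Edge i) (j : Fin (ℓ - 1)) :
    hammingNorm (fun y' => B.reducedD1 ℓ h (.inr (y, j)) y') =
      hammingNorm (fun k => intervalBoundary ℓ k j) + hammingNorm (fun z => B.coneCode.d2 y z) := by
  classical
  have h1 : hammingNorm (fun s => B.reducedD1 ℓ h (.inr (y, j)) (.inr s)) = 0 := hammingNorm_zero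
  rw [hammingNorm_sum, h1, hammingNorm_sum, hammingNorm_prod_fst y fun y' k hy => if_neg hy.symm,
    hammingNorm_prod_snd j fun z j' hj => if_neg hj.symm]
  simp [reducedD1, CSSCode.thicken, CSSCode.thickenD1]

theorem reducedConeCode_wX_le :
    (B.reducedConeCode ℓ h).wX ≤
      max (A.wX + A.wX * D.inducedCode.qZ / 2) (max (D.inducedCode.qZ + 2) 4) := by
  classical
  refine Finset.sup_le fun r _ => ?_
  rcases r with (x | φ) | ⟨y, j⟩
  · refine (hammingNorm_reducedD1_stab x).trans_le (le_max_of_le_left ?_)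
    have h1 := A.le_wX x
    have h2 := D.two_mul_hammingNorm_f0_row_le x
    omega
  · refine le_max_of_le_right (le_max_of_le_right ?_)
    have h1 : hammingNorm (fun y => B.reducedD1 ℓ h (.inl (.inr φ)) y) =
        hammingNorm (fun e => B.reducedD1 ℓ h (.inl (.inr φ)) (.inl (.inl (.inr e, h (.inr φ.1))))) +
        hammingNorm (fun s => B.reducedD1 ℓ h (.inl (.inr φ)) (.inr s)) := by
      have h2 : hammingNorm (fun p => B.reducedD1 ℓ h (.inl (.inr φ)) (.inl (.inr p))) = 0 :=
        hammingNorm_zero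
      have h3 : hammingNorm (fun p =>
          B.reducedD1 ℓ h (.inl (.inr φ)) (.inl (.inl (.inl p, h (.inr φ.1))))) = 0 :=
        hammingNorm_zero
      rw [hammingNorm_sum, hammingNorm_sum, h2, hammingNorm_prod_snd (h (.inr φ.1)),
        hammingNorm_sum, h3, zero_add, add_zero]
      rintro (q | e) k hk
      · rfl
      · exact if_neg fun hn => hk hn.2
    refine h1.trans_le ?_
    have h4 := (hammingNorm_le_of (P := fun e => B.faceEdge φ e)
      (x := fun e => B.reducedD1 ℓ h (.inl (.inr φ)) (.inl (.inl (.inr e, h (.inr φ.1)))))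
      fun e he => by
        by_contra hn
        exact he (if_neg fun hn' => hn hn'.1)).trans (card_edges_of_face_le φ)
    have h5 := (hammingNorm_le_of (P := fun s => B.faceChord φ s)
      (x := fun s => B.reducedD1 ℓ h (.inl (.inr φ)) (.inr s))
      fun s hs => by
        by_contra hn
        exact hs (if_neg hn)).trans (card_chords_of_face_le φ)
    omega
  · refine (hammingNorm_reducedD1_seg_row y j).trans_le (le_max_of_le_right ?_)
    have h1 := hammingNorm_intervalBoundary_col_le j
    rcases y with q | e
    · rw [hammingNorm_coneCode_d2_row_inl]
      have := D.inducedCode.le_qZ q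
      omega
    · rw [hammingNorm_coneCode_d2_row_inr]
      omega

/-- The stabilizers of the cone code and the faces that act on a qubit, followed by those that belong to
segments. -/
theorem hammingNorm_reducedD1_col (y) :
    hammingNorm (fun r => B.reducedD1 ℓ h r y) =
      hammingNorm (fun x => B.reducedD1 ℓ h (.inl (.inl x)) y) +
      hammingNorm (fun φ => B.reducedD1 ℓ h (.inl (.inr φ)) y) +
      hammingNorm (fun p => B.reducedD1 ℓ h (.inr p) y) := by
  rw [hammingNorm_sum, hammingNorm_sum]

theorem hammingNorm_reducedD1_col_stab_le (y : Q ⊕ Σ i, D.Edge i) (k : Fin ℓ) :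
    hammingNorm (fun x => B.reducedD1 ℓ h (.inl (.inl x)) (.inl (.inl (y, k)))) ≤
      hammingNorm (fun x => B.coneCode.d1 (.inl x) y) := by
  classical
  refine Finset.card_le_card fun x hx => ?_
  rw [Finset.mem_filter] at hx ⊢
  refine ⟨hx.1, fun h0 => hx.2 ?_⟩
  simp [reducedD1, CSSCode.thicken, CSSCode.thickenD1, h0]

theorem hammingNorm_reducedD1_col_seg_le (y : Q ⊕ Σ i, D.Edge i) (k : Fin ℓ) :
    hammingNorm (fun p => B.reducedD1 ℓ h (.inr p) (.inl (.inl (y, k)))) ≤ 2 := by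
  classical
  rw [hammingNorm_prod_fst y fun y' j hy => if_neg hy]
  refine le_of_eq_of_le ?_ (hammingNorm_intervalBoundary_row_le k)
  simp [reducedD1, CSSCode.thicken, CSSCode.thickenD1]

theorem reducedConeCode_qX_le {b : ℕ} (hb : ∀ i e k, B.multiplicity h i e k ≤ b) :
    (B.reducedConeCode ℓ h).qX ≤ max (A.qX + 2) (max A.wZ (b + 3)) := by
  classical
  refine Finset.sup_le fun y _ => ?_
  refine (hammingNorm_reducedD1_col y).trans_le ?_
  rcases y with (⟨q | e, k⟩ | ⟨z, j⟩) | s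
  · have h1 := hammingNorm_reducedD1_col_stab_le (h := h) (.inl q) k
    have h2 : hammingNorm (fun φ => B.reducedD1 ℓ h (.inl (.inr φ)) (.inl (.inl (.inl q, k)))) = 0 :=
      hammingNorm_zero
    have h3 := hammingNorm_reducedD1_col_seg_le (h := h) (.inl q) k
    have h4 : hammingNorm (fun x => B.coneCode.d1 (.inl x) (.inl q)) ≤ A.qX := A.le_qX q
    omega
  · have h1 := hammingNorm_reducedD1_col_stab_le (h := h) (.inr e) k
    have h2 := (hammingNorm_le_of (P := fun φ => B.faceEdge φ e ∧ k = h (.inr φ.1))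
      (x := fun φ => B.reducedD1 ℓ h (.inl (.inr φ)) (.inl (.inl (.inr e, k))))
      fun φ hφ => by
        by_contra hn
        exact hφ (if_neg hn)).trans (card_faces_at_le h hb e k)
    have h3 := hammingNorm_reducedD1_col_seg_le (h := h) (.inr e) k
    have h4 : hammingNorm (fun x => B.coneCode.d1 (.inl x) (.inr e)) = 1 := D.hammingNorm_f0_col e
    omega
  · have h1 : hammingNorm (fun x => B.reducedD1 ℓ h (.inl (.inl x)) (.inl (.inr (z, j)))) = 0 :=
      hammingNorm_zero
    have h2 : hammingNorm (fun φ => B.reducedD1 ℓ h (.inl (.inr φ)) (.inl (.inr (z, j)))) = 0 :=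
      hammingNorm_zero
    have h3 : hammingNorm (fun p => B.reducedD1 ℓ h (.inr p) (.inl (.inr (z, j)))) =
        hammingNorm (fun y => B.coneCode.d2 y z) := by
      rw [hammingNorm_prod_snd j fun y j' hj => if_neg hj]
      simp [reducedD1, CSSCode.thicken, CSSCode.thickenD1]
    rw [h1, h2, h3]
    rcases z with z | v
    · rw [hammingNorm_coneCode_d2_col_inl]
      have := A.le_wZ z
      omega
    · rw [hammingNorm_coneCode_d2_col_inr]
      have := hammingNorm_bdry_col_le v.1 v.2
      omega
  · have h1 : hammingNorm (fun x => B.reducedD1 ℓ h (.inl (.inl x)) (.inr s)) = 0 :=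
      hammingNorm_zero
    have h2 := (hammingNorm_le_of (P := fun φ => B.faceChord φ s)
      (x := fun φ => B.reducedD1 ℓ h (.inl (.inr φ)) (.inr s))
      fun φ hφ => by
        by_contra hn
        exact hφ (if_neg hn)).trans (card_faces_of_chord_le s)
    have h3 : hammingNorm (fun p => B.reducedD1 ℓ h (.inr p) (.inr s)) = 0 := hammingNorm_zero
    omega

theorem card_qubits_le {b : ℕ} (hq : 1 ≤ A.qX) (hb : ∀ i e k, B.multiplicity h i e k ≤ b) :
    Fintype.card (((Q ⊕ Σ i, D.Edge i) × Fin ℓ ⊕ (Z ⊕ Σ i, D.Vert i) × Fin (ℓ - 1)) ⊕ B.Chord) ≤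
      (b + 2) * (max (Fintype.card Q) (Fintype.card Z) + ∑ i, (D.Qset i).card * A.qX) * ℓ := by
  classical
  have hchord := card_chord_mul_two_le h hb
  have hE : (∑ i, Fintype.card (D.Edge i)) * 2 ≤ ∑ i, (D.Qset i).card * A.qX := by
    rw [Finset.sum_mul]
    exact Finset.sum_le_sum fun i _ => (mul_comm _ _).trans_le (D.two_mul_card_edge_le i)
  have hV : ∑ i, (D.Qset i).card ≤ ∑ i, (D.Qset i).card * A.qX :=
    Finset.sum_le_sum fun i _ => Nat.le_mul_of_pos_right _ hq
  simp only [Fintype.card_sum, Fintype.card_prod, Fintype.card_fin]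
  rw [Fintype.card_sigma (α := fun i => D.Edge i), Fintype.card_sigma (α := fun i => D.Vert i)]
  simp only [Fintype.card_coe]
  generalize Fintype.card B.Chord = c at *
  generalize (∑ i, Fintype.card (D.Edge i)) = E at *
  generalize (∑ i, (D.Qset i).card) = V at *
  generalize (∑ i, (D.Qset i).card * A.qX) = S at *
  have hQ : Fintype.card Q ≤ max (Fintype.card Q) (Fintype.card Z) := le_max_left _ _
  have hZ : Fintype.card Z ≤ max (Fintype.card Q) (Fintype.card Z) := le_max_right _ _
  generalize max (Fintype.card Q) (Fintype.card Z) = M at *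
  have h1 : (Fintype.card Q + E) * ℓ ≤ (M + S) * ℓ := Nat.mul_le_mul_right _ (by omega)
  have h2 : (Fintype.card Z + V) * (ℓ - 1) ≤ (M + S) * ℓ :=
    Nat.mul_le_mul (by omega) (Nat.sub_le _ _)
  have h3 : c ≤ b * (M + S) * ℓ := by
    refine le_trans (by omega) (hchord.trans ?_)
    rw [mul_right_comm, mul_comm E b]
    exact Nat.mul_le_mul_right _ (Nat.mul_le_mul_left _ (by omega))
  calc _ ≤ (M + S) * ℓ + (M + S) * ℓ + b * (M + S) * ℓ := by omega
    _ = _ := by ring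

end Weights

end CycleBasis

end ConeInput

/-! ### Parameters of the reduced cone code -/

theorem mainTheorem3 :
    -- the constants: `κ` is absolute, `b` depends on `ε` and `a` only
    ∃ κ : ℝ, ∀ ε : ℝ, 0 < ε → ∀ a : ℝ, 0 < a → ∃ b : ℕ,
      ∀ (X Q Z : Type*) [Fintype X] [Fintype Q] [Fintype Z]
        (A : CSSCode X Q Z) (D : ConeInput A) (ℓ : ℕ), 1 ≤ A.qX → 1 ≤ ℓ →
        a * Real.log (D.inducedCode.wZ : ℝ) ^ (2 + 2 * ε) * (D.inducedCode.wZ : ℝ) ^ ε ≤ (ℓ : ℝ) →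
        -- cycle bases of low congestion and heights as required by the construction exist
        (∃ (B : D.CycleBasis) (h : X ⊕ B.Cyc → Fin ℓ),
          (∀ i e, (B.congestion i e : ℝ) ≤ κ * Real.log ((D.Qset i).card : ℝ) ^ 2) ∧
          (∀ i e k, B.multiplicity h i e k ≤ b)) ∧
        -- and each such choice of cycle bases and heights gives a code with the stated parameters
        ∀ (B : D.CycleBasis) (h : X ⊕ B.Cyc → Fin ℓ),
          (∀ i e k, B.multiplicity h i e k ≤ b) →
          -- number of qubits
          Fintype.card (((Q ⊕ Σ i, D.Edge i) × Fin ℓ ⊕ (Z ⊕ Σ i, D.Vert i) × Fin (ℓ - 1)) ⊕ B.Chord) ≤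
            (b + 2) * (max (Fintype.card Q) (Fintype.card Z) +
              ∑ i, (D.Qset i).card * D.inducedCode.qX) * ℓ ∧
          -- number of logical qubits
          (B.reducedConeCode ℓ h).K = D.inducedCode.K ∧
          -- stabilizer weights and numbers of stabilizers acting on a qubit
          (B.reducedConeCode ℓ h).wZ ≤
            max A.wZ (D.inducedCode.qX + 1 + b * D.inducedCode.qX / 2) + 2 ∧
          (B.reducedConeCode ℓ h).qZ ≤ max D.inducedCode.qZ 2 ∧
          D.inducedCode.wX ≤ (B.reducedConeCode ℓ h).wX ∧
          (B.reducedConeCode ℓ h).wX ≤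
            max (D.inducedCode.wX + D.inducedCode.wX * D.inducedCode.qZ / 2)
              (max (D.inducedCode.qZ + 2) 4) ∧
          (B.reducedConeCode ℓ h).qX ≤ max (D.inducedCode.qX + 2) (max A.wZ (b + 3)) ∧
          -- distances
          D.inducedCode.dX ≤ (B.reducedConeCode ℓ h).dX ∧
          (D.inducedCode.dZ : ℝ≥0∞) * B.soundnessFactor * (ℓ : ℝ≥0∞) ≤
            ((B.reducedConeCode ℓ h).dZ : ℝ≥0∞) ∧
          min 1 (⨅ i, D.cheeger i) ≤ B.soundnessFactor := by
  refine ⟨64, fun ε hε a ha => ?_⟩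
  obtain ⟨b, hb⟩ := exists_multiplicity_bound hε ha
  refine ⟨b, fun X Q Z _ _ _ A D ℓ hq hℓ hℓa => ⟨?_, fun B h hBh => ?_⟩⟩
  · exact D.exists_cycleBasis_heights hℓ fun n h2 hn => hb _ n ℓ h2 hn hℓ hℓa
  · rw [D.inducedCode_qX, D.inducedCode_wX]
    exact ⟨ConeInput.CycleBasis.card_qubits_le hq hBh, B.reducedConeCode_K h hℓ,
      ConeInput.CycleBasis.reducedConeCode_wZ_le hBh, ConeInput.CycleBasis.reducedConeCode_qZ_le,
      ConeInput.CycleBasis.wX_le_reducedConeCode_wX, ConeInput.CycleBasis.reducedConeCode_wX_le,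
      ConeInput.CycleBasis.reducedConeCode_qX_le hBh, B.inducedCode_dX_le h hℓ,
      B.inducedCode_dZ_mul_le h, B.min_cheeger_le_soundnessFactor⟩
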